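/- **Theorem 5.2.** Let $N\ge 1$, $\hbar>0$ and $(\gamma_{N1},\dots,\gamma_{NN})\in\mathbb R^N$. For $1\le n\le N-1$, $1\le j\le n$ let $\gamma_{nj}$ be real integration variables, and put $\gamma_{nj}=0$ for $j>n$ and $\gamma_{0j}=0$. For $x\in\mathbb R^N$ set $$ I(x)=\int_{\mathbb R^{N(N-1)/2}}\prod_{n=1}^{N-1}\frac{\prod_{k=1}^n\prod_{m=1}^{n+1}\left|\Gamma\!\left(\frac{\gamma_{nk}-\gamma_{n+1,m}}{2i\hbar}+\frac14\right)\right|^2}{\prod_{1\le s<p\le n}\left|\Gamma\!\left(\frac{\gamma_{ns}-\gamma_{np}}{i\hbar}\right)\right|^2}\;e^{\frac i\hbar\sum_{n,j=1}^N(\gamma_{nj}-\gamma_{n-1,j})x_n}\prod_{n=1}^{N-1}\prod_{j=1}^{n}d\gamma_{nj}, \qquad \Psi(x)=\prod_{j<k}\sinh^{1/2}(x_j-x_k)\; I(x), $$ with the principal square root where $\sinh(x_j-x_k)<0$. Then: 1. The integral $I(x)$ converges absolutely for every $x\in\mathbb R^N$. 2. $\Psi$ is $C^\infty$ on the set of $x\in\mathbb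 R^N$ with pairwise distinct coordinates, is not identically zero on the chamber $x_1>\dots>x_N$, and on this whole set satisfies, with $p_n=-i\hbar\,\partial/\partial x_n$, $$ \sum_{n=1}^N p_n\Psi=\Big(\sum_{n=1}^N\gamma_{Nn}\Big)\Psi,\qquad \sum_{m<n}\Big\{p_np_m+\frac{\hbar^2/4}{\sinh^2(x_m-x_n)}\Big\}\Psi=\Big(\sum_{m<n}\gamma_{Nm}\gamma_{Nn}\Big)\Psi . $$ 3. Consider the Gelfand–Zetlin operators on meromorphic functions of the complex variables $\gamma_{nj}$, $1\le j\le n\le N-1$: $$ E_{nn}=\frac1{i\hbar}\Big(\sum_{j=1}^n\gamma_{nj}-\sum_{j=1}^{n-1}\gamma_{n-1,j}\Big)\quad(1\le n\le N), $$ $$ E_{n,n+1}=-\frac1{i\hbar}\sum_{j=1}^n\frac{\prod_{r=1}^{n+1}(\gamma_{nj}-\gamma_{n+1,r}-\frac{i\hbar}2)}{\prod_{s\ne j}(\gamma_{nj}-\gamma_{ns})}e^{-i\hbar\partial_{\gamma_{nj}}},\qquad E_{n+1,n}=\frac1{i\hbar}\sum_{j=1}^n\frac{\prod_{r=1}^{n-1}(\gamma_{nj}-\gamma_{n-1,r}+\frac{i\hbar}2)}{\prod_{s\ne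 j}(\gamma_{nj}-\gamma_{ns})}e^{i\hbar\partial_{\gamma_{nj}}}\quad(1\le n\le N-1). $$ The function $$ v=e^{-\frac{\pi}{2\hbar}\sum_{n=1}^{N-1}(n-1)\sum_{j=1}^n\gamma_{nj}}\prod_{n=1}^{N-1}\prod_{k=1}^n\prod_{m=1}^{n+1}(2\hbar)^{\frac{\gamma_{nk}-\gamma_{n+1,m}}{2i\hbar}+\frac14}\,\Gamma\!\Big(\frac{\gamma_{nk}-\gamma_{n+1,m}}{2i\hbar}+\frac14\Big) $$ satisfies $(E_{n,n+1}-E_{n+1,n})v=0$ for $n=1,\dots,N-1$. 4. $I(x)$ is, up to an explicit constant, the corresponding matrix element: for the pairing $$ \langle\phi,\psi\rangle=\int_{\mathbb R^{N(N-1)/2}}\prod_{n=2}^{N-1}\prod_{s<p}(\gamma_{ns}-\gamma_{np})\big(e^{2\pi\gamma_{np}/\hbar}-e^{2\pi\gamma_{ns}/\hbar}\big)\;\overline{\phi(\gamma)}\,\psi(\gamma)\prod_{n=1}^{N-1}\prod_{j=1}^n d\gamma_{nj} $$ the integral $\langle v,e^{-\sum_{k}x_kE_{kk}}v\rangle$ converges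 absolutely for every $x\in\mathbb R^N$ and equals $(-2\pi\hbar)^{\binom N3}(2\hbar)^{\binom{N+1}3}\,I(x)$. -/

import Mathlib

open scoped ContDiff

noncomputable section

namespace Sutherland

/-- The partial derivative `∂_{x_n} f`. -/
def partialDeriv {N : ℕ} (n : Fin N) (f : (Fin N → ℝ) → ℂ) : (Fin N → ℝ) → ℂ :=
  fun x => fderiv ℝ f x (Pi.single n 1)

/-- The momentum operator `p_n = -iħ ∂_{x_n}`. -/
def momentum {N : ℕ} (ħ : ℝ) (n : Fin N) (f : (Fin N → ℝ) → ℂ) : (Fin N → ℝ) → ℂ :=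
  fun x => -(Complex.I * (ħ : ℂ)) * partialDeriv n f x

/-- The first Hamiltonian `h₁ = ∑ₙ pₙ`. -/
def hamiltonian₁ {N : ℕ} (ħ : ℝ) (f : (Fin N → ℝ) → ℂ) : (Fin N → ℝ) → ℂ :=
  fun x => ∑ n, momentum ħ n f x

/-- The second Hamiltonian `h₂ = ∑_{m<n} (pₙ pₘ + (ħ²/4) / sinh²(xₘ - xₙ))`. -/
def hamiltonian₂ {N : ℕ} (ħ : ℝ) (f : (Fin N → ℝ) → ℂ) : (Fin N → ℝ) → ℂ :=
  fun x => ∑ n, ∑ m ∈ Finset.Iio n,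
    (momentum ħ n (momentum ħ m f) x
      + ((ħ ^ 2 / 4 / Real.sinh (x m - x n) ^ 2 : ℝ) : ℂ) * f x)

/-- The configuration space: points of `ℝ^N` with pairwise distinct coordinates. -/
def regularSet (N : ℕ) : Set (Fin N → ℝ) := {x | Function.Injective x}

/-- `Ψ` is an eigenfunction of the hyperbolic Sutherland Hamiltonians with the eigenvalues
`σ₁(a)` and `σ₂(a)`: it is smooth on the configuration space, satisfies both
differential equations there, and is not identically zero on the chamber
`x₁ > x₂ > ⋯ > x_N`. -/
structure IsEigenfunction {N : ℕ} (ħ : ℝ) (a : Fin N → ℝ) (Ψ : (Fin N → ℝ) → ℂ) : Prop where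
  smooth : ContDiffOn ℝ ∞ Ψ (regularSet N)
  eq₁ : ∀ x ∈ regularSet N, hamiltonian₁ ħ Ψ x = ((∑ n, a n : ℝ) : ℂ) * Ψ x
  eq₂ : ∀ x ∈ regularSet N,
    hamiltonian₂ ħ Ψ x = ((∑ n, ∑ m ∈ Finset.Iio n, a m * a n : ℝ) : ℂ) * Ψ x
  ne_zero : ∃ x : Fin N → ℝ, StrictAnti x ∧ Ψ x ≠ 0

/-- Index set of the interior variables `γ_{nj}`, `1 ≤ j ≤ n ≤ N - 1`, of a triangular array:
row `n` has the `n` entries `j = 0, …, n - 1` (row `0` is empty). It has `N(N-1)/2` elements. -/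
abbrev Tri (N : ℕ) : Type := (n : Fin N) × Fin (n : ℕ)

/-- The full triangular array with interior variables `γ` and row `N` equal to the label `a`:
`entry a γ n j` is the entry number `j + 1` of row `n`; it is `0` outside the triangle. -/
def entry {α : Type*} [Zero α] {N : ℕ} (a : Fin N → α) (γ : Tri N → α) (n j : ℕ) : α :=
  if hj : j < n then
    if hn : n < N then γ ⟨⟨n, hn⟩, ⟨j, hj⟩⟩
    else if hN : n = N then a ⟨j, lt_of_lt_of_eq hj hN⟩
    else 0
  else 0

/-- `∏_{n=1}^{N-1} ∏_{k≤n} ∏_{m≤n+1} |Γ((γ_{nk} - γ_{n+1,m})/(2iħ) + 1/4)|²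
  / ∏_{s<p≤n} |Γ((γ_{ns} - γ_{np})/(iħ))|²`.
Where `γ_{ns} = γ_{np}` the factor `1/|Γ|²` is `0`, the value of `1/Γ` at its zero; this is also
what Lean's conventions `Γ(0) = 0` and `1/0 = 0` give. -/
def weight {N : ℕ} (ħ : ℝ) (a : Fin N → ℝ) (γ : Tri N → ℝ) : ℝ :=
  ∏ n ∈ Finset.Ico 1 N,
    (∏ k ∈ Finset.range n, ∏ m ∈ Finset.range (n + 1),
      ‖Complex.Gamma (((entry a γ n k - entry a γ (n + 1) m : ℝ) : ℂ) / (2 * Complex.I * (ħ : ℂ))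
        + 1 / 4)‖ ^ 2)
    / (∏ p ∈ Finset.range n, ∏ s ∈ Finset.range p,
      ‖Complex.Gamma (((entry a γ n s - entry a γ n p : ℝ) : ℂ) / (Complex.I * (ħ : ℂ)))‖ ^ 2)

/-- The integrand: the weight times `exp((i/ħ) ∑_{n,j=1}^N (γ_{nj} - γ_{n-1,j}) x_n)`. -/
def integrand {N : ℕ} (ħ : ℝ) (a : Fin N → ℝ) (x : Fin N → ℝ) (γ : Tri N → ℝ) : ℂ :=
  (weight ħ a γ : ℂ) *
    Complex.exp (Complex.I / (ħ : ℂ) *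
      ((∑ n : Fin N, ∑ j ∈ Finset.range N,
        (entry a γ ((n : ℕ) + 1) j - entry a γ (n : ℕ) j) * x n : ℝ) : ℂ))

/-- `∏_{j<k} sinh^{1/2}(x_j - x_k)`; the principal square root is used where
`sinh(x_j - x_k)` is negative. -/
def sinhFactor {N : ℕ} (x : Fin N → ℝ) : ℂ :=
  ∏ k, ∏ j ∈ Finset.Iio k, ((Real.sinh (x j - x k) : ℝ) : ℂ) ^ (1 / 2 : ℂ)

/-- The wave function `Ψ_{a}(x)`. -/
def waveFunction {N : ℕ} (ħ : ℝ) (a : Fin N → ℝ) (x : Fin N → ℝ) : ℂ :=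
  sinhFactor x * ∫ γ : Tri N → ℝ, integrand ħ a x γ

/-! Gelfand–Zetlin operators on functions of the interior variables, with label `a`. -/

/-- The function by which `E_{kk}` acts by multiplication
(the argument `k` stands for the index `k + 1`):
`(1/(iħ)) (∑_{j≤k} γ_{kj} - ∑_{j≤k-1} γ_{k-1,j})`. -/
def cartan {N : ℕ} (ħ : ℝ) (a : Fin N → ℂ) (k : Fin N) (γ : Tri N → ℂ) : ℂ :=
  1 / (Complex.I * (ħ : ℂ)) *
    ((∑ j ∈ Finset.range ((k : ℕ) + 1), entry a γ ((k : ℕ) + 1) j)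
      - ∑ j ∈ Finset.range (k : ℕ), entry a γ (k : ℕ) j)

/-- `exp(-∑ₖ xₖ E_{kk})`. -/
def torus {N : ℕ} (ħ : ℝ) (a : Fin N → ℂ) (x : Fin N → ℝ) (F : (Tri N → ℂ) → ℂ) :
    (Tri N → ℂ) → ℂ :=
  fun γ => Complex.exp (-∑ k, (x k : ℂ) * cartan ħ a k γ) * F γ

/-- Replace the variable `γ_{nj}` by `γ_{nj} + c`. -/
def shift {N : ℕ} (n : Fin N) (j : Fin (n : ℕ)) (c : ℂ) (γ : Tri N → ℂ) : Tri N → ℂ :=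
  Function.update γ ⟨n, j⟩ (γ ⟨n, j⟩ + c)

/-- `E_{n,n+1}` for `1 ≤ n ≤ N - 1`:
`-(1/(iħ)) ∑_j ∏_{r≤n+1} (γ_{nj} - γ_{n+1,r} - iħ/2) / ∏_{s≠j} (γ_{nj} - γ_{ns})
  e^{-iħ ∂_{γ_{nj}}}`. -/
def raising {N : ℕ} (ħ : ℝ) (a : Fin N → ℂ) (n : Fin N) (F : (Tri N → ℂ) → ℂ) :
    (Tri N → ℂ) → ℂ :=
  fun γ => -(1 / (Complex.I * (ħ : ℂ))) * ∑ j : Fin (n : ℕ),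
    (∏ r ∈ Finset.range ((n : ℕ) + 1),
        (γ ⟨n, j⟩ - entry a γ ((n : ℕ) + 1) r - Complex.I * (ħ : ℂ) / 2))
      / (∏ s ∈ Finset.univ.erase j, (γ ⟨n, j⟩ - γ ⟨n, s⟩))
      * F (shift n j (-(Complex.I * (ħ : ℂ))) γ)

/-- `E_{n+1,n}` for `1 ≤ n ≤ N - 1`:
`(1/(iħ)) ∑_j ∏_{r≤n-1} (γ_{nj} - γ_{n-1,r} + iħ/2) / ∏_{s≠j} (γ_{nj} - γ_{ns})
  e^{iħ ∂_{γ_{nj}}}`. -/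
def lowering {N : ℕ} (ħ : ℝ) (a : Fin N → ℂ) (n : Fin N) (F : (Tri N → ℂ) → ℂ) :
    (Tri N → ℂ) → ℂ :=
  fun γ => 1 / (Complex.I * (ħ : ℂ)) * ∑ j : Fin (n : ℕ),
    (∏ r ∈ Finset.range ((n : ℕ) - 1),
        (γ ⟨n, j⟩ - entry a γ ((n : ℕ) - 1) r + Complex.I * (ħ : ℂ) / 2))
      / (∏ s ∈ Finset.univ.erase j, (γ ⟨n, j⟩ - γ ⟨n, s⟩))
      * F (shift n j (Complex.I * (ħ : ℂ)) γ)

/-- The vector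
`v = exp(-(π/(2ħ)) ∑_{n=1}^{N-1} (n-1) ∑_{j≤n} γ_{nj}) ∏_{n=1}^{N-1} ∏_{k≤n} ∏_{m≤n+1}
  (2ħ)^{z} Γ(z)` with `z = (γ_{nk} - γ_{n+1,m})/(2iħ) + 1/4`. -/
def vec {N : ℕ} (ħ : ℝ) (a : Fin N → ℂ) (γ : Tri N → ℂ) : ℂ :=
  Complex.exp (-((Real.pi / (2 * ħ) : ℝ) : ℂ) *
      ∑ n ∈ Finset.Ico 1 N, ((n : ℂ) - 1) * ∑ j ∈ Finset.range n, entry a γ n j)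
    * ∏ n ∈ Finset.Ico 1 N, ∏ k ∈ Finset.range n, ∏ m ∈ Finset.range (n + 1),
      (((2 * ħ : ℝ) : ℂ) ^
          ((entry a γ n k - entry a γ (n + 1) m) / (2 * Complex.I * (ħ : ℂ)) + 1 / 4)
        * Complex.Gamma
          ((entry a γ n k - entry a γ (n + 1) m) / (2 * Complex.I * (ħ : ℂ)) + 1 / 4))

/-- The complement of the hyperplanes that carry the poles of the coefficients of the operators
above and the poles and shifted poles of `vec`. Two meromorphic functions
with poles on these hyperplanes are equal iff they agree on this dense open set. -/
def genericSet {N : ℕ} (ħ : ℝ) (a : Fin N → ℂ) : Set (Tri N → ℂ) :=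
  {γ | (∀ (n : Fin N) (s p : Fin (n : ℕ)), s ≠ p → γ ⟨n, s⟩ ≠ γ ⟨n, p⟩) ∧
    ∀ n ∈ Finset.Ico 1 N, ∀ k ∈ Finset.range n, ∀ m ∈ Finset.range (n + 1), ∀ l : ℤ,
      (entry a γ n k - entry a γ (n + 1) m) / (Complex.I * (ħ : ℂ)) + 1 / 2 ≠ (l : ℂ)}

/-- `μ₀(γ) = ∏_{n=2}^{N-1} ∏_{s<p} (γ_{ns} - γ_{np}) (e^{2πγ_{np}/ħ} - e^{2πγ_{ns}/ħ})`. -/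
def mu₀ {N : ℕ} (ħ : ℝ) (a : Fin N → ℝ) (γ : Tri N → ℝ) : ℝ :=
  ∏ n ∈ Finset.Ico 2 N, ∏ p ∈ Finset.range n, ∏ s ∈ Finset.range p,
    (entry a γ n s - entry a γ n p)
      * (Real.exp (2 * Real.pi * entry a γ n p / ħ) - Real.exp (2 * Real.pi * entry a γ n s / ħ))

/-- The integrand of the pairing `⟨φ, ψ⟩ = ∫ μ₀(γ) conj(φ(γ)) ψ(γ) dγ` over real arrays. -/
def pairingIntegrand {N : ℕ} (ħ : ℝ) (a : Fin N → ℝ) (φ ψ : (Tri N → ℂ) → ℂ)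
    (γ : Tri N → ℝ) : ℂ :=
  (mu₀ ħ a γ : ℂ) * (starRingEnd ℂ) (φ fun t => (γ t : ℂ)) * ψ fun t => (γ t : ℂ)

/-- The pairing `⟨φ, ψ⟩`. -/
def pairing {N : ℕ} (ħ : ℝ) (a : Fin N → ℝ) (φ ψ : (Tri N → ℂ) → ℂ) : ℂ :=
  ∫ γ : Tri N → ℝ, pairingIntegrand ħ a φ ψ γ

end Sutherland

end

/-!
# The Gelfand–Zetlin integral for the hyperbolic Sutherland model

Write `Z = γ / (iħ)` for the rescaled triangular array, with the top row fixed. Up to the factor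
`phase`, which is `exp (-∑ xᵢ Eᵢᵢ)`, the integrand is `kernel N 0 Z`, a product of Gamma functions
over pairs of entries in adjacent rows, divided by a product over pairs in the same row.

**Convergence.** On vertical lines `|Γ|` decays like `exp (-π |y| / 2)` (`exists_norm_gamma_le`), so
that the modulus of the kernel is about `exp (-(π / 2) (C - 2 D) / ħ)`, where `C` is the sum of the
distances between entries of adjacent rows and `D` the sum of those within the rows. The
elementary inequality `interlacing_energy` for two neighbouring rows, summed over all rows, shows
that `C - 2 D` bounds every entry of the array (`abs_le_sum_energy`). Hence the kernel decays
exponentially (`exists_norm_kernel_le`), the integral converges absolutely, and one may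
differentiate under the integral sign (`IsExpDecaying.contDiff_transform`): a derivative `-∂/∂xᵢ`
inserts the difference of two consecutive row sums, which is the eigenvalue of `Eᵢᵢ`.

**The differential equations.** The first one says that these eigenvalues add up to the sum of the
top row. The second one is the radial part of the quadratic Casimir operator, and the integral
provides it without reference to a representation. Choose one entry in each of the rows
`i + 1, …, n` and translate these entries by `2`. The *marked* kernel, in which some Gamma functions
are shifted by `1` so that this translation crosses no poles, has the same integral before
and after (`integral_kernel_shift`), while `phase` picks up the factor `exp (-2 (xᵢ - xₙ))`. As
rational multiples of the unmarked kernel, the two integrands carry the factors `ratio (-Z)` and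
`ratio Z`. The sum of these factors over all choices of entries is the path sum
`pathSum`, the diagonal part of the product of two root vectors in the Gelfand–Zetlin realization.
Two identities between rational functions, both proved with divided differences (`divDiff_prod`),
replace the commutation relations of `gl_N`:

* `pathSum_sub_neg`: the path sums at `Z` and `-Z` differ by the difference of the eigenvalues of
  two diagonal operators (the commutator of two root vectors);
* `sum_pathSum_add_neg`: added up over the bottom row of the path, the path sums at `Z` and `-Z`
  give power sums of degree two of the entries (the quadratic Casimir element).

With the contour shift, the first identity turns the path sums into
`coth (xᵢ - xₙ) (∂ᵢ - ∂ₙ)` (`coth_mul_partialDeriv_sub`), and the second one yields a second-order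
differential equation for the integral (`sum_coth_mul_partialDeriv`). Conjugation with the factor
`∏ sinh^{1/2}` removes the first-order terms; what is left is the potential, plus constants that
cancel by the addition formula for `coth` (`sum_cothSum_sq`). The wave function does not vanish on
the chamber, because the integral at `x = 0` is that of a nonnegative function that is positive
almost everywhere.

**The Whittaker vector and the pairing.** By `Γ(z + 1) = z Γ(z)`, the two operators produce the same
summand for every `j` (`raising_vec_sub_lowering_vec`). By the reflection formula, the
density of the pairing times `|v|²` is a constant times the weight of the integral
(`mu₀_mul_norm_vec_sq`), so that the two integrands agree pointwise.
-/

open scoped ContDiff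

noncomputable section

namespace Sutherland

/-! ### Bounds for the Gamma function -/

theorem norm_gammaSeq_mul_le {s t : ℝ} (hs : 0 < s) (hst : s ≤ t) (y : ℝ) {n : ℕ} (hn : n ≠ 0) :
    ‖Complex.GammaSeq (s + y * Complex.I) n‖ * ‖Complex.GammaSeq t n‖ ≤
      ‖Complex.GammaSeq (t + y * Complex.I) n‖ * ‖Complex.GammaSeq s n‖ := by
  have hn' : 0 < n := Nat.pos_of_ne_zero hn
  have ht : 0 < t := hs.trans_le hst
  have hc : ∀ z : ℂ, ‖(n : ℂ) ^ z‖ = (n : ℝ) ^ z.re := fun z =>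
    Complex.norm_natCast_cpow_of_pos hn' z
  have hpos : ∀ (r u : ℝ), 0 < r → ∀ j : ℕ, 0 < ‖(r : ℂ) + u * Complex.I + (j : ℂ)‖ := by
    intro r u hr j
    rw [norm_pos_iff]
    intro h
    have := congrArg Complex.re h
    simp at this
    have : (0 : ℝ) ≤ j := Nat.cast_nonneg j
    linarith
  have hpos' : ∀ (r : ℝ), 0 < r → ∀ j : ℕ, 0 < ‖(r : ℂ) + (j : ℂ)‖ := by
    intro r hr j
    simpa using hpos r 0 hr j
  simp only [Complex.GammaSeq, norm_div, norm_mul, hc, norm_prod]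
  simp only [Complex.add_re, Complex.ofReal_re, Complex.mul_re, Complex.I_re, mul_zero,
    Complex.ofReal_im, Complex.I_im, mul_one, sub_self, add_zero]
  rw [div_mul_div_comm, div_mul_div_comm]
  have key : (∏ j ∈ Finset.range (n + 1), ‖(t : ℂ) + y * Complex.I + (j : ℂ)‖) *
        ∏ j ∈ Finset.range (n + 1), ‖(s : ℂ) + (j : ℂ)‖ ≤
      (∏ j ∈ Finset.range (n + 1), ‖(s : ℂ) + y * Complex.I + (j : ℂ)‖) *
        ∏ j ∈ Finset.range (n + 1), ‖(t : ℂ) + (j : ℂ)‖ := by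
    rw [← Finset.prod_mul_distrib, ← Finset.prod_mul_distrib]
    refine Finset.prod_le_prod (fun _ _ => by positivity) fun j _ => ?_
    have hj : (0 : ℝ) ≤ j := Nat.cast_nonneg j
    have e1 : ∀ r : ℝ, ‖(r : ℂ) + y * Complex.I + (j : ℂ)‖ ^ 2 = (r + j) ^ 2 + y ^ 2 := by
      intro r
      rw [← Complex.normSq_eq_norm_sq, Complex.normSq_apply]
      simp
      ring
    have e2 : ∀ r : ℝ, ‖(r : ℂ) + (j : ℂ)‖ ^ 2 = (r + j) ^ 2 := by
      intro r
      rw [← Complex.normSq_eq_norm_sq, Complex.normSq_apply]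
      simp
      ring
    refine le_of_sq_le_sq ?_ (by positivity)
    rw [mul_pow, mul_pow, e1, e1, e2, e2]
    have : (s + j) ^ 2 ≤ (t + j) ^ 2 := by gcongr
    nlinarith [mul_le_mul_of_nonneg_right this (sq_nonneg y)]
  have hX := Finset.prod_pos fun j (_ : j ∈ Finset.range (n + 1)) => hpos s y hs j
  have hY := Finset.prod_pos fun j (_ : j ∈ Finset.range (n + 1)) => hpos t y ht j
  have hX' := Finset.prod_pos fun j (_ : j ∈ Finset.range (n + 1)) => hpos' s hs j
  have hY' := Finset.prod_pos fun j (_ : j ∈ Finset.range (n + 1)) => hpos' t ht j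
  have hn0 : (0 : ℝ) < n := Nat.cast_pos.2 hn'
  rw [div_le_div_iff₀ (by positivity) (by positivity)]
  have : (0 : ℝ) ≤ (n : ℝ) ^ s * ‖(Nat.factorial n : ℂ)‖ * ((n : ℝ) ^ t * ‖(Nat.factorial n : ℂ)‖) := by
    positivity
  calc _ ≤ (n : ℝ) ^ s * ‖(Nat.factorial n : ℂ)‖ * ((n : ℝ) ^ t * ‖(Nat.factorial n : ℂ)‖) * _ :=
        mul_le_mul_of_nonneg_left key this
    _ = _ := by ring

/-- The quotient `|Γ(s + iy)| / Γ(s)` increases with `s > 0`: in Euler's product each factor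
`(s + j) / |s + j + iy|` does. -/
theorem norm_gamma_mul_le {s t : ℝ} (hs : 0 < s) (hst : s ≤ t) (y : ℝ) :
    ‖Complex.Gamma (s + y * Complex.I)‖ * ‖Complex.Gamma t‖ ≤
      ‖Complex.Gamma (t + y * Complex.I)‖ * ‖Complex.Gamma s‖ := by
  refine le_of_tendsto_of_tendsto
    ((Complex.GammaSeq_tendsto_Gamma _).norm.mul (Complex.GammaSeq_tendsto_Gamma _).norm)
    ((Complex.GammaSeq_tendsto_Gamma _).norm.mul (Complex.GammaSeq_tendsto_Gamma _).norm) ?_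
  filter_upwards [Filter.eventually_ne_atTop 0] with n hn
  exact norm_gammaSeq_mul_le hs hst y hn

/-- The critical line `re = 1 / 2`, where the reflection formula gives the modulus exactly. -/
theorem norm_gamma_half_sq (y : ℝ) :
    ‖Complex.Gamma (1 / 2 + y * Complex.I)‖ ^ 2 = Real.pi / Real.cosh (Real.pi * y) := by
  have h := Complex.Gamma_mul_Gamma_one_sub (1 / 2 + y * Complex.I)
  have e : (1 : ℂ) - (1 / 2 + y * Complex.I) = (starRingEnd ℂ) (1 / 2 + y * Complex.I) := by
    apply Complex.ext <;> simp
    norm_num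
  rw [e, Complex.Gamma_conj, Complex.mul_conj, Complex.normSq_eq_norm_sq] at h
  have e2 : Complex.sin (Real.pi * (1 / 2 + y * Complex.I)) = (Real.cosh (Real.pi * y) : ℝ) := by
    rw [show (Real.pi : ℂ) * (1 / 2 + y * Complex.I) =
      (Real.pi * y : ℝ) * Complex.I + Real.pi / 2 by push_cast; ring]
    rw [Complex.sin_add_pi_div_two, Complex.cos_mul_I, Complex.ofReal_cosh]
  rw [e2] at h
  exact_mod_cast h

theorem one_add_abs_le {δ : ℝ} (hδ : 0 < δ) (y : ℝ) :
    1 + |y| ≤ (1 + 1 / δ) * Real.exp (δ * |y|) := by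
  have h1 := Real.add_one_le_exp (δ * |y|)
  have h2 : 0 ≤ δ * |y| := by positivity
  have h3 : |y| = 1 / δ * (δ * |y|) := by field_simp
  have h4 : 1 ≤ Real.exp (δ * |y|) := by linarith
  have h5 : 1 / δ * (δ * |y|) ≤ 1 / δ * Real.exp (δ * |y|) :=
    mul_le_mul_of_nonneg_left (by linarith) (by positivity)
  nlinarith

/-- Exponential decay of the Gamma function on vertical lines, uniform on `[3/16, 3/2]`. -/
theorem exists_norm_gamma_le {δ : ℝ} (hδ : 0 < δ) :
    ∃ C : ℝ, 0 < C ∧ ∀ z : ℂ, 3 / 16 ≤ z.re → z.re ≤ 3 / 2 →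
      ‖Complex.Gamma z‖ ≤ C * Real.exp (-((Real.pi / 2 - δ) * |z.im|)) := by
  obtain ⟨M, hM⟩ : ∃ M : ℝ, ∀ s ∈ Set.Icc (3 / 16 : ℝ) (3 / 2), ‖Complex.Gamma s‖ ≤ M := by
    refine isCompact_Icc.exists_bound_of_continuousOn (f := fun s : ℝ => Complex.Gamma s) ?_
    intro s hs
    refine ContinuousAt.continuousWithinAt ?_
    refine ContinuousAt.comp (f := fun s : ℝ => (s : ℂ)) (Complex.continuousAt_Gamma _ ?_)
      Complex.continuous_ofReal.continuousAt
    intro m h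
    have := congrArg Complex.re h
    simp at this
    have h0 : (0 : ℝ) ≤ m := Nat.cast_nonneg m
    have := hs.1
    linarith
  have hM0 : 0 ≤ M := (norm_nonneg _).trans (hM 1 (by norm_num))
  have hG : 0 < ‖Complex.Gamma (3 / 2 : ℝ)‖ :=
    norm_pos_iff.2 (Complex.Gamma_ne_zero_of_re_pos (by simp))
  refine ⟨(M / ‖Complex.Gamma (3 / 2 : ℝ)‖ * Real.sqrt (2 * Real.pi)) * (1 + 1 / δ) + 1,
    by positivity, ?_⟩
  intro z h1 h2
  set y := z.im with hy
  have hz : z = (z.re : ℂ) + y * Complex.I := (Complex.re_add_im z).symm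
  have h3 := norm_gamma_mul_le (s := z.re) (t := 3 / 2) (by linarith) h2 y
  rw [← hz] at h3
  have h4 : ‖Complex.Gamma ((3 / 2 : ℝ) + y * Complex.I)‖ ≤
      (1 + |y|) * (Real.sqrt (2 * Real.pi) * Real.exp (-(Real.pi / 2 * |y|))) := by
    have e : (((3 / 2 : ℝ) : ℂ) + y * Complex.I) = (1 / 2 + y * Complex.I) + 1 := by
      push_cast; ring
    have hne : (1 / 2 + y * Complex.I : ℂ) ≠ 0 := by
      intro h
      have := congrArg Complex.re h
      simp at this
    rw [e, Complex.Gamma_add_one _ hne, norm_mul]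
    gcongr
    · refine (norm_add_le _ _).trans ?_
      simp
      norm_num
    · refine le_of_sq_le_sq ?_ (by positivity)
      rw [norm_gamma_half_sq, mul_pow, Real.sq_sqrt (by positivity), ← Real.exp_nat_mul,
        div_le_iff₀ (Real.cosh_pos _)]
      have : Real.exp (Real.pi * |y|) ≤ 2 * Real.cosh (Real.pi * y) := by
        rw [Real.cosh_eq]
        rcases abs_cases y with ⟨h, -⟩ | ⟨h, -⟩ <;> rw [h]
        · linarith [Real.exp_pos (-(Real.pi * y))]
        · rw [mul_neg]
          linarith [Real.exp_pos (Real.pi * y)]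
      have e3 : Real.exp (((2 : ℕ) : ℝ) * -(Real.pi / 2 * |y|)) * Real.exp (Real.pi * |y|) = 1 := by
        rw [← Real.exp_add, ← Real.exp_zero]
        congr 1
        push_cast; ring
      have hp := Real.pi_pos
      calc Real.pi = Real.pi * (Real.exp (((2 : ℕ) : ℝ) * -(Real.pi / 2 * |y|)) *
            Real.exp (Real.pi * |y|)) := by rw [e3, mul_one]
        _ ≤ Real.pi * (Real.exp (((2 : ℕ) : ℝ) * -(Real.pi / 2 * |y|)) *
            (2 * Real.cosh (Real.pi * y))) := by gcongr
        _ = _ := by ring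
  have h5 : ‖Complex.Gamma z‖ ≤
      ‖Complex.Gamma ((3 / 2 : ℝ) + y * Complex.I)‖ * M / ‖Complex.Gamma (3 / 2 : ℝ)‖ := by
    rw [le_div_iff₀ hG]
    exact h3.trans (mul_le_mul_of_nonneg_left (hM _ ⟨h1, h2⟩) (norm_nonneg _))
  have e4 : Real.exp (-((Real.pi / 2 - δ) * |y|)) =
      Real.exp (δ * |y|) * Real.exp (-(Real.pi / 2 * |y|)) := by
    rw [← Real.exp_add]; congr 1; ring
  calc ‖Complex.Gamma z‖ ≤ _ := h5
    _ ≤ ((1 + |y|) * (Real.sqrt (2 * Real.pi) * Real.exp (-(Real.pi / 2 * |y|)))) * M /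
        ‖Complex.Gamma (3 / 2 : ℝ)‖ := by gcongr
    _ ≤ (((1 + 1 / δ) * Real.exp (δ * |y|)) *
        (Real.sqrt (2 * Real.pi) * Real.exp (-(Real.pi / 2 * |y|)))) * M /
        ‖Complex.Gamma (3 / 2 : ℝ)‖ := by
          gcongr
          exact one_add_abs_le hδ y
    _ = (M / ‖Complex.Gamma (3 / 2 : ℝ)‖ * Real.sqrt (2 * Real.pi)) * (1 + 1 / δ) *
        Real.exp (-((Real.pi / 2 - δ) * |y|)) := by rw [e4]; ring
    _ ≤ _ := by
      have := Real.exp_pos (-((Real.pi / 2 - δ) * |y|))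
      nlinarith

theorem norm_sin_le_exp (w : ℂ) : ‖Complex.sin w‖ ≤ Real.exp |w.im| := by
  rw [Complex.sin, norm_div, norm_mul, Complex.norm_I]
  have h1 : ‖Complex.exp (-w * Complex.I)‖ ≤ Real.exp |w.im| := by
    rw [Complex.norm_exp]
    simp only [Complex.mul_re, Complex.neg_re, Complex.I_re, mul_zero, Complex.neg_im, Complex.I_im,
      mul_one, zero_sub, neg_neg]
    exact Real.exp_le_exp.2 (le_abs_self _)
  have h2 : ‖Complex.exp (w * Complex.I)‖ ≤ Real.exp |w.im| := by
    rw [Complex.norm_exp]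
    simp only [Complex.mul_re, Complex.I_re, mul_zero, Complex.I_im,
      mul_one, zero_sub]
    exact Real.exp_le_exp.2 (neg_le_abs _)
  have := (norm_sub_le (Complex.exp (-w * Complex.I)) (Complex.exp (w * Complex.I)))
  simp only [Complex.norm_ofNat, mul_one]
  linarith

theorem inv_gamma_mul_gamma_neg (w : ℂ) :
    (Complex.Gamma w * Complex.Gamma (-w))⁻¹ = -(w * Complex.sin (Real.pi * w) / Real.pi) := by
  have hpi : (Real.pi : ℂ) ≠ 0 := Complex.ofReal_ne_zero.2 Real.pi_ne_zero
  by_cases hw : w = 0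
  · simp [hw, Complex.Gamma_zero]
  have h := Complex.Gamma_mul_Gamma_one_sub w
  rw [show (1 : ℂ) - w = -w + 1 by ring, Complex.Gamma_add_one _ (neg_ne_zero.2 hw)] at h
  have h2 : Complex.Gamma w * Complex.Gamma (-w) = -(Real.pi / (w * Complex.sin (Real.pi * w))) := by
    rw [← div_div, div_right_comm, ← h]
    field_simp
  rw [h2, inv_neg, inv_div]

theorem inv_gamma_mul_gamma_two_sub {w : ℂ} (hw : w ≠ 1) :
    (Complex.Gamma w * Complex.Gamma (2 - w))⁻¹ =
      Complex.sin (Real.pi * w) / (Real.pi * (1 - w)) := by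
  have h := Complex.Gamma_mul_Gamma_one_sub w
  have hw' : (1 : ℂ) - w ≠ 0 := sub_ne_zero.2 hw.symm
  rw [show (2 : ℂ) - w = (1 - w) + 1 by ring, Complex.Gamma_add_one _ hw']
  rw [show Complex.Gamma w * ((1 - w) * Complex.Gamma (1 - w)) =
    (1 - w) * (Complex.Gamma w * Complex.Gamma (1 - w)) by ring, h]
  rw [mul_div_assoc', inv_div, mul_comm (1 - w)]

theorem exists_norm_inv_gamma_neg_le {δ : ℝ} (hδ : 0 < δ) :
    ∃ C : ℝ, 0 < C ∧ ∀ w : ℂ, w.re = 0 → ‖(Complex.Gamma w * Complex.Gamma (-w))⁻¹‖ ≤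
      C * Real.exp ((Real.pi + δ) * |w.im|) := by
  have hp := Real.pi_pos
  refine ⟨(1 + 1 / δ) / Real.pi, by positivity, fun w hw => ?_⟩
  rw [inv_gamma_mul_gamma_neg, norm_neg, norm_div, norm_mul, Complex.norm_real, Real.norm_eq_abs,
    abs_of_pos hp]
  have h1 : ‖w‖ ≤ (1 + 1 / δ) * Real.exp (δ * |w.im|) := by
    have : ‖w‖ ≤ |w.im| := by simpa [hw] using Complex.norm_le_abs_re_add_abs_im w
    linarith [one_add_abs_le hδ w.im]
  have h2 : ‖Complex.sin (Real.pi * w)‖ ≤ Real.exp (Real.pi * |w.im|) := by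
    refine (norm_sin_le_exp _).trans_eq ?_
    simp [abs_mul, abs_of_pos hp]
  calc _ ≤ ((1 + 1 / δ) * Real.exp (δ * |w.im|)) * Real.exp (Real.pi * |w.im|) / Real.pi := by
        gcongr
    _ = (1 + 1 / δ) / Real.pi * (Real.exp (Real.pi * |w.im|) * Real.exp (δ * |w.im|)) := by ring
    _ = _ := by rw [← Real.exp_add, add_mul]

theorem differentiable_inv_gamma_mul_gamma_two_sub :
    Differentiable ℂ fun w : ℂ => (Complex.Gamma w * Complex.Gamma (2 - w))⁻¹ := by
  simp only [mul_inv]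
  exact Complex.differentiable_one_div_Gamma.mul
    (Complex.differentiable_one_div_Gamma.comp (differentiable_id.const_sub 2))

theorem exists_norm_inv_gamma_two_sub_le :
    ∃ C : ℝ, 0 < C ∧ ∀ w : ℂ, ‖(Complex.Gamma w * Complex.Gamma (2 - w))⁻¹‖ ≤
      C * Real.exp (Real.pi * |w.im|) := by
  have hp := Real.pi_pos
  obtain ⟨M, hM⟩ := (isCompact_closedBall (1 : ℂ) 1).exists_bound_of_continuousOn
    (f := fun w : ℂ => (Complex.Gamma w * Complex.Gamma (2 - w))⁻¹)
    differentiable_inv_gamma_mul_gamma_two_sub.continuous.continuousOn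
  refine ⟨|M| + 1, by positivity, fun w => ?_⟩
  have h1 : 1 ≤ Real.exp (Real.pi * |w.im|) := Real.one_le_exp (by positivity)
  have hM0 := abs_nonneg M
  by_cases hw : w ∈ Metric.closedBall (1 : ℂ) 1
  · have := hM w hw
    have := le_abs_self M
    nlinarith
  · rw [Metric.mem_closedBall, not_le, dist_comm, Complex.dist_eq] at hw
    have hne : w ≠ 1 := by
      rintro rfl
      norm_num at hw
    rw [inv_gamma_mul_gamma_two_sub hne, norm_div, norm_mul, Complex.norm_real, Real.norm_eq_abs,
      abs_of_pos hp]
    have h2 : ‖Complex.sin (Real.pi * w)‖ ≤ Real.exp (Real.pi * |w.im|) := by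
      refine (norm_sin_le_exp _).trans_eq ?_
      simp [abs_mul, abs_of_pos hp]
    have h3 : 1 ≤ Real.pi * ‖1 - w‖ := by nlinarith [Real.pi_gt_three]
    calc _ ≤ ‖Complex.sin (Real.pi * w)‖ := div_le_self (norm_nonneg _) h3
      _ ≤ Real.exp (Real.pi * |w.im|) := h2
      _ ≤ _ := by nlinarith

/-! ### Interlacing energy of triangular arrays -/

/-- For two finite families of reals, the second with one more member, the mutual distances exceed
the distances within the families, by at least twice the excess of any member `f a` of the first
family over the maximum of the second. (Sums over ordered pairs, whence the factors `2`.) -/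
theorem interlacing_energy {α β : Type*} [DecidableEq α] [DecidableEq β] (f : α → ℝ) (g : β → ℝ)
    (n : ℕ) : ∀ (S : Finset α) (T : Finset β), S.card = n → T.card = n + 1 →
      0 ≤ 2 * (∑ a ∈ S, ∑ b ∈ T, |f a - g b|) - (∑ p ∈ S, ∑ s ∈ S, |f s - f p|)
          - (∑ p ∈ T, ∑ s ∈ T, |g s - g p|) ∧
      ∀ a ∈ S, ∀ M, (∀ b ∈ T, g b ≤ M) →
        4 * (f a - M) ≤ 2 * (∑ a ∈ S, ∑ b ∈ T, |f a - g b|) - (∑ p ∈ S, ∑ s ∈ S, |f s - f p|)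
          - (∑ p ∈ T, ∑ s ∈ T, |g s - g p|) := by
  induction n with
  | zero =>
    intro S T hS hT
    rw [Finset.card_eq_zero] at hS
    obtain ⟨b, rfl⟩ := Finset.card_eq_one.1 hT
    subst hS
    simp
  | succ n ih =>
    intro S T hS hT
    have hSne : S.Nonempty := Finset.card_pos.1 (by omega)
    have hTne : T.Nonempty := Finset.card_pos.1 (by omega)
    obtain ⟨a0, ha0, hamax⟩ := S.exists_max_image f hSne
    obtain ⟨b0, hb0, hbmax⟩ := T.exists_max_image g hTne
    set S' := S.erase a0 with hS'
    set T' := T.erase b0 with hT'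
    have haS : a0 ∉ S' := Finset.notMem_erase _ _
    have hbT : b0 ∉ T' := Finset.notMem_erase _ _
    have hSi : S = insert a0 S' := (Finset.insert_erase ha0).symm
    have hTi : T = insert b0 T' := (Finset.insert_erase hb0).symm
    have hSc : S'.card = n := by rw [hS', Finset.card_erase_of_mem ha0]; omega
    have hTc : T'.card = n + 1 := by rw [hT', Finset.card_erase_of_mem hb0]; omega
    obtain ⟨ih0, -⟩ := ih S' T' hSc hTc
    have hamax' : ∀ a ∈ S', f a ≤ f a0 := fun a ha => hamax a (Finset.mem_of_mem_erase ha)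
    have hbmax' : ∀ b ∈ T', g b ≤ g b0 := fun b hb => hbmax b (Finset.mem_of_mem_erase hb)
    have e1 : ∑ p ∈ S, ∑ s ∈ S, |f s - f p| =
        (∑ p ∈ S', ∑ s ∈ S', |f s - f p|) + 2 * (n * f a0 - ∑ a ∈ S', f a) := by
      have h1 : ∑ s ∈ S', |f s - f a0| = n * f a0 - ∑ a ∈ S', f a := by
        rw [← hSc, ← nsmul_eq_mul, ← Finset.sum_const, ← Finset.sum_sub_distrib]
        refine Finset.sum_congr rfl fun a ha => ?_
        rw [abs_sub_comm, abs_of_nonneg (sub_nonneg.2 (hamax' a ha))]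
      have h2 : ∑ s ∈ S', |f a0 - f s| = n * f a0 - ∑ a ∈ S', f a := by
        rw [← h1]
        exact Finset.sum_congr rfl fun a _ => abs_sub_comm _ _
      rw [hSi, Finset.sum_insert haS, Finset.sum_insert haS]
      simp only [Finset.sum_insert haS, Finset.sum_add_distrib, sub_self, abs_zero, zero_add]
      rw [h1, h2]
      ring
    have e2 : ∑ p ∈ T, ∑ s ∈ T, |g s - g p| =
        (∑ p ∈ T', ∑ s ∈ T', |g s - g p|) + 2 * ((n + 1) * g b0 - ∑ b ∈ T', g b) := by
      have h1 : ∑ s ∈ T', |g s - g b0| = (n + 1) * g b0 - ∑ b ∈ T', g b := by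
        rw [show ((n : ℝ) + 1) = ((T'.card : ℕ) : ℝ) by rw [hTc]; push_cast; ring,
          ← nsmul_eq_mul, ← Finset.sum_const, ← Finset.sum_sub_distrib]
        refine Finset.sum_congr rfl fun a ha => ?_
        rw [abs_sub_comm, abs_of_nonneg (sub_nonneg.2 (hbmax' a ha))]
      have h2 : ∑ s ∈ T', |g b0 - g s| = (n + 1) * g b0 - ∑ b ∈ T', g b := by
        rw [← h1]
        exact Finset.sum_congr rfl fun a _ => abs_sub_comm _ _
      rw [hTi, Finset.sum_insert hbT, Finset.sum_insert hbT]
      simp only [Finset.sum_insert hbT, Finset.sum_add_distrib, sub_self, abs_zero, zero_add]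
      rw [h1, h2]
      ring
    have e3 : ∑ a ∈ S, ∑ b ∈ T, |f a - g b| = (∑ a ∈ S', ∑ b ∈ T', |f a - g b|) +
        |f a0 - g b0| + (∑ b ∈ T', |f a0 - g b|) + ∑ a ∈ S', |f a - g b0| := by
      rw [hSi, Finset.sum_insert haS, hTi]
      simp only [Finset.sum_insert hbT, Finset.sum_add_distrib]
      ring
    have l1 : (n + 1) * f a0 - ∑ b ∈ T', g b ≤ ∑ b ∈ T', |f a0 - g b| := by
      rw [show ((n : ℝ) + 1) = ((T'.card : ℕ) : ℝ) by rw [hTc]; push_cast; ring,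
          ← nsmul_eq_mul, ← Finset.sum_const, ← Finset.sum_sub_distrib]
      exact Finset.sum_le_sum fun b _ => le_abs_self _
    have l2 : n * g b0 - ∑ a ∈ S', f a ≤ ∑ a ∈ S', |f a - g b0| := by
      rw [← hSc, ← nsmul_eq_mul, ← Finset.sum_const, ← Finset.sum_sub_distrib]
      exact Finset.sum_le_sum fun b _ => by rw [abs_sub_comm]; exact le_abs_self _
    have key : 2 * ((f a0 - g b0) + |f a0 - g b0|) ≤
        2 * (∑ a ∈ S, ∑ b ∈ T, |f a - g b|) - (∑ p ∈ S, ∑ s ∈ S, |f s - f p|)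
          - (∑ p ∈ T, ∑ s ∈ T, |g s - g p|) := by
      rw [e1, e2, e3]
      linarith
    refine ⟨?_, fun a ha M hM => ?_⟩
    · have := neg_abs_le (f a0 - g b0)
      linarith
    · have h1 := hamax a ha
      have h2 := hM b0 hb0
      have h3 := le_abs_self (f a0 - g b0)
      linarith

theorem sum_range_range_symm (F : ℕ → ℕ → ℝ) (hs : ∀ s p, F s p = F p s) (h0 : ∀ s, F s s = 0)
    (n : ℕ) : ∑ p ∈ Finset.range n, ∑ s ∈ Finset.range n, F s p =
      2 * ∑ p ∈ Finset.range n, ∑ s ∈ Finset.range p, F s p := by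
  induction n with
  | zero => simp
  | succ n ih =>
    rw [Finset.sum_range_succ, Finset.sum_range_succ _ n, Finset.sum_range_succ _ n]
    simp only [Finset.sum_range_succ _ n, Finset.sum_add_distrib]
    rw [ih, h0, Finset.sum_congr rfl fun x _ => hs n x]
    ring

/-- The sum of the distances between adjacent rows `n` and `n + 1`. -/
def crossDist (e : ℕ → ℕ → ℝ) (n : ℕ) : ℝ :=
  ∑ k ∈ Finset.range n, ∑ m ∈ Finset.range (n + 1), |e n k - e (n + 1) m|

/-- The sum of the distances within row `n`. -/
def rowDist (e : ℕ → ℕ → ℝ) (n : ℕ) : ℝ :=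
  ∑ p ∈ Finset.range n, ∑ s ∈ Finset.range p, |e n s - e n p|

theorem rowDist_nonneg (e : ℕ → ℕ → ℝ) (n : ℕ) : 0 ≤ rowDist e n :=
  Finset.sum_nonneg fun _ _ => Finset.sum_nonneg fun _ _ => abs_nonneg _

theorem crossDist_sub_nonneg (e : ℕ → ℕ → ℝ) (n : ℕ) :
    0 ≤ crossDist e n - rowDist e n - rowDist e (n + 1) := by
  have h := (interlacing_energy (e n) (e (n + 1)) n (Finset.range n) (Finset.range (n + 1))
    (by simp) (by simp)).1
  rw [sum_range_range_symm (fun s p => |e n s - e n p|) (fun _ _ => abs_sub_comm _ _) (by simp),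
    sum_range_range_symm (fun s p => |e (n + 1) s - e (n + 1) p|) (fun _ _ => abs_sub_comm _ _)
      (by simp)] at h
  unfold crossDist rowDist
  linarith

theorem le_crossDist_sub (e : ℕ → ℕ → ℝ) (n k : ℕ) (hk : k < n) (M : ℝ)
    (hM : ∀ m < n + 1, e (n + 1) m ≤ M) :
    2 * (e n k - M) ≤ crossDist e n - rowDist e n - rowDist e (n + 1) := by
  have h := (interlacing_energy (e n) (e (n + 1)) n (Finset.range n) (Finset.range (n + 1))
    (by simp) (by simp)).2 k (by simpa using hk) M (by simpa using hM)
  rw [sum_range_range_symm (fun s p => |e n s - e n p|) (fun _ _ => abs_sub_comm _ _) (by simp),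
    sum_range_range_symm (fun s p => |e (n + 1) s - e (n + 1) p|) (fun _ _ => abs_sub_comm _ _)
      (by simp)] at h
  unfold crossDist rowDist
  linarith

/-- Downward induction over the rows; the entry is compared with the largest one of the next row. -/
theorem le_sum_energy_from (e : ℕ → ℕ → ℝ) (N : ℕ) (A : ℝ) (hA : ∀ m < N, e N m ≤ A) (d : ℕ) :
    ∀ r, r + d = N → ∀ k < r,
      2 * (e r k - A) - rowDist e r ≤
        ∑ n ∈ Finset.Ico r N, (crossDist e n - 2 * rowDist e n) := by
  induction d with
  | zero =>
    intro r hr k hk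
    obtain rfl : r = N := by omega
    have := hA k hk
    have := rowDist_nonneg e r
    simp
    linarith
  | succ d ih =>
    intro r hr k hk
    obtain ⟨m0, hm0, hmax⟩ := (Finset.range (r + 1)).exists_max_image (e (r + 1)) ⟨0, by simp⟩
    rw [Finset.sum_eq_sum_Ico_succ_bot (by omega)]
    have h1 := ih (r + 1) (by omega) m0 (by simpa using hm0)
    have h2 := le_crossDist_sub e r k hk (e (r + 1) m0) (fun m hm => hmax m (by simpa using hm))
    linarith

/-- Below row `r`, the differences in `crossDist_sub_nonneg` are dropped; `rowDist` vanishes in row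
`1`. -/
theorem le_sum_energy_one (e : ℕ → ℕ → ℝ) (N : ℕ) (A : ℝ) (hA : ∀ m < N, e N m ≤ A) {r k : ℕ}
    (hr1 : 1 ≤ r) (hr : r ≤ N) (hk : k < r) :
    2 * (e r k - A) ≤ ∑ n ∈ Finset.Ico 1 N, (crossDist e n - 2 * rowDist e n) := by
  have h : ∀ q, 1 ≤ q → q ≤ r → 2 * (e r k - A) - rowDist e q ≤
      ∑ n ∈ Finset.Ico q N, (crossDist e n - 2 * rowDist e n) := by
    intro q hq1 hq
    induction hq using Nat.decreasingInduction with
    | self => exact le_sum_energy_from e N A hA (N - r) r (by omega) k hk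
    | of_succ q hq ih =>
      rw [Finset.sum_eq_sum_Ico_succ_bot (by omega)]
      have h1 := ih (by omega)
      have h2 := crossDist_sub_nonneg e q
      linarith
  have := h 1 le_rfl hr1
  simpa [rowDist] using this

/-- The mutual distances of adjacent rows, less twice the distances within the rows, grow with every
entry of the array, when the top row `N` is bounded. -/
theorem abs_le_sum_energy (e : ℕ → ℕ → ℝ) (N : ℕ) (A : ℝ) (hA : ∀ m < N, |e N m| ≤ A) {r k : ℕ}
    (hr1 : 1 ≤ r) (hr : r ≤ N) (hk : k < r) :
    2 * (|e r k| - A) ≤ ∑ n ∈ Finset.Ico 1 N, (crossDist e n - 2 * rowDist e n) := by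
  rcases abs_cases (e r k) with ⟨h, -⟩ | ⟨h, -⟩
  · rw [h]
    exact le_sum_energy_one e N A (fun m hm => (le_abs_self _).trans (hA m hm)) hr1 hr hk
  · rw [h]
    have := le_sum_energy_one (fun n k => -e n k) N A
      (fun m hm => (neg_le_abs _).trans (hA m hm)) hr1 hr hk
    refine this.trans_eq (Finset.sum_congr rfl fun n _ => ?_)
    have e0 : ∀ x y : ℝ, |-x - -y| = |x - y| := fun x y => by
      rw [← abs_neg]; congr 1; ring
    simp only [crossDist, rowDist, e0]

/-! ### A contour shift in many variables -/

/-- Let `θ ↦ g γ θ` be holomorphic on a vertical strip, with locally uniform integrable bounds, and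
let translating `θ` along the imaginary axis amount to translating `γ`. Then `∫ g γ θ dγ` is a
holomorphic function of `θ` that does not change along the imaginary axis, hence a constant. -/
theorem integral_eq_of_translation {E : Type*} [AddCommGroup E] [MeasurableSpace E]
    [MeasurableAdd E] (μ : MeasureTheory.Measure E) [μ.IsAddRightInvariant] {l r : ℝ}
    (g : E → ℂ → ℂ)
    (hd : ∀ γ, ∀ θ : ℂ, l < θ.re → θ.re < r → DifferentiableAt ℂ (g γ) θ)
    (hm : ∀ θ : ℂ, l < θ.re → θ.re < r → MeasureTheory.AEStronglyMeasurable (fun γ => g γ θ) μ)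
    (hb : ∀ η : ℝ, ∃ b : E → ℝ, MeasureTheory.Integrable b μ ∧ ∀ γ, ∀ θ : ℂ, l < θ.re → θ.re < r →
      |θ.im| ≤ η → ‖g γ θ‖ ≤ b γ)
    (ht : ∀ s : ℝ, ∃ v : E, ∀ γ θ, g γ (θ + s * Complex.I) = g (γ + v) θ)
    {θ₁ θ₂ : ℂ} (h1 : l < θ₁.re) (h1' : θ₁.re < r) (h2 : l < θ₂.re) (h2' : θ₂.re < r) :
    ∫ γ, g γ θ₁ ∂μ = ∫ γ, g γ θ₂ ∂μ := by
  set S : Set ℂ := {θ | l < θ.re ∧ θ.re < r} with hS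
  have hSo : IsOpen S := (isOpen_lt continuous_const Complex.continuous_re).inter
    (isOpen_lt Complex.continuous_re continuous_const)
  have hSc : Convex ℝ S := (convex_halfSpace_re_gt l).inter (convex_halfSpace_re_lt r)
  set Φ : ℂ → ℂ := fun θ => ∫ γ, g γ θ ∂μ with hΦ
  have hderiv : ∀ θ ∈ S, DifferentiableAt ℂ Φ θ := by
    intro θ hθ
    obtain ⟨ρ, hρ, hball⟩ := Metric.isOpen_iff.1 hSo θ hθ
    obtain ⟨b, hbi, hbb⟩ := hb (|θ.im| + ρ)
    have hin : ∀ w ∈ Metric.ball θ (ρ / 2), ∀ z ∈ Metric.closedBall w (ρ / 4), z ∈ S ∧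
        |z.im| ≤ |θ.im| + ρ := by
      intro w hw z hz
      have h : dist z θ < ρ := by
        have := dist_triangle z w θ
        rw [Metric.mem_ball] at hw
        rw [Metric.mem_closedBall] at hz
        linarith
      refine ⟨hball h, ?_⟩
      have h3 : |z.im - θ.im| ≤ dist z θ := by
        rw [Complex.dist_eq, ← Complex.sub_im]; exact Complex.abs_im_le_norm _
      have := abs_sub_abs_le_abs_sub z.im θ.im
      linarith
    have hself : ∀ w ∈ Metric.ball θ (ρ / 2), w ∈ S := fun w hw =>
      (hin w hw w (Metric.mem_closedBall_self (by positivity))).1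
    have hθb : θ ∈ Metric.ball θ (ρ / 2) := Metric.mem_ball_self (by positivity)
    refine (hasDerivAt_integral_of_dominated_loc_of_deriv_le (F := fun θ γ => g γ θ)
      (F' := fun θ γ => deriv (g γ) θ) (bound := fun γ => b γ / (ρ / 4))
      (Metric.ball_mem_nhds θ (ε := ρ / 2) (by positivity)) ?_ ?_ ?_ ?_ (hbi.div_const _)
      ?_).2.differentiableAt
    · filter_upwards [hSo.mem_nhds hθ] with w hw using hm w hw.1 hw.2
    · refine hbi.mono' (hm θ hθ.1 hθ.2) (Filter.Eventually.of_forall fun γ => ?_)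
      have := hin θ hθb θ (Metric.mem_closedBall_self (by positivity))
      exact hbb γ θ this.1.1 this.1.2 this.2
    · -- the derivative is measurable as a limit of difference quotients
      obtain ⟨u, hu0, hu, hulim⟩ : ∃ u : ℕ → ℂ, (∀ n, u n ≠ 0) ∧ (∀ n, θ + u n ∈ S) ∧
          Filter.Tendsto u Filter.atTop (nhds 0) := by
        refine ⟨fun n => ((ρ / 2 * (1 / ((n : ℝ) + 1)) : ℝ) : ℂ), fun n => ?_, fun n => ?_, ?_⟩
        · have : (0 : ℝ) < ρ / 2 * (1 / ((n : ℝ) + 1)) := by positivity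
          exact Complex.ofReal_ne_zero.2 this.ne'
        · apply hball
          rw [Metric.mem_ball, dist_eq_norm, add_sub_cancel_left, Complex.norm_real,
            Real.norm_eq_abs, abs_of_nonneg (by positivity)]
          have : 1 / ((n : ℝ) + 1) ≤ 1 := by
            rw [div_le_one (by positivity)]
            linarith [Nat.cast_nonneg (α := ℝ) n]
          nlinarith
        · have := (tendsto_one_div_add_atTop_nhds_zero_nat (𝕜 := ℝ)).const_mul (ρ / 2)
          rw [mul_zero] at this
          exact_mod_cast (Complex.continuous_ofReal.tendsto 0).comp this
      refine aestronglyMeasurable_of_tendsto_ae Filter.atTop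
        (f := fun n γ => (u n)⁻¹ • (g γ (θ + u n) - g γ θ))
        (fun n => ((hm _ (hu n).1 (hu n).2).sub (hm θ hθ.1 hθ.2)).const_smul (u n)⁻¹) ?_
      refine Filter.Eventually.of_forall fun γ => ?_
      have := (hasDerivAt_iff_tendsto_slope_zero.1 (hd γ θ hθ.1 hθ.2).hasDerivAt)
      exact this.comp (tendsto_nhdsWithin_iff.2 ⟨hulim, Filter.Eventually.of_forall hu0⟩)
    · refine Filter.Eventually.of_forall fun γ w hw => ?_
      refine Complex.norm_deriv_le_of_forall_mem_sphere_norm_le (by positivity) ?_ ?_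
      · refine DifferentiableOn.diffContOnCl ?_
        intro z hz
        have := (hin w hw z (Metric.closure_ball_subset_closedBall hz)).1
        exact (hd γ z this.1 this.2).differentiableWithinAt
      · intro z hz
        have := hin w hw z (Metric.sphere_subset_closedBall hz)
        exact hbb γ z this.1.1 this.1.2 this.2
    · exact Filter.Eventually.of_forall fun γ w hw =>
        (hd γ w (hself w hw).1 (hself w hw).2).hasDerivAt
  have hinv : ∀ θ, ∀ s : ℝ, Φ (θ + s * Complex.I) = Φ θ := by
    intro θ s
    obtain ⟨v, hv⟩ := ht s
    simp only [hΦ, hv]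
    exact MeasureTheory.integral_add_right_eq_self (fun γ => g γ θ) v
  have hzero : ∀ θ ∈ S, deriv Φ θ = 0 := by
    intro θ hθ
    have h := (hderiv θ hθ).hasDerivAt
    have hl : HasDerivAt (fun s : ℝ => θ + s * Complex.I) Complex.I 0 := by
      simpa using ((Complex.ofRealCLM.hasDerivAt (x := (0 : ℝ))).mul_const Complex.I).const_add θ
    have hcomp : HasDerivAt (fun s : ℝ => Φ (θ + s * Complex.I)) (deriv Φ θ * Complex.I) 0 := by
      have h' : HasDerivAt Φ (deriv Φ θ) (θ + (0 : ℝ) * Complex.I) := by simpa using h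
      exact h'.comp (0 : ℝ) hl
    have hconst : HasDerivAt (fun s : ℝ => Φ (θ + s * Complex.I)) 0 0 := by
      simp only [hinv]
      exact hasDerivAt_const _ _
    have := hcomp.unique hconst
    simpa using this
  refine hSo.is_const_of_deriv_eq_zero hSc.isPreconnected
    (fun θ hθ => (hderiv θ hθ).differentiableWithinAt) (fun θ hθ => hzero θ hθ) ⟨h1, h1'⟩ ⟨h2, h2'⟩

/-! ### Divided differences -/

/-- The divided difference `∑ᵢ f(vᵢ) / ∏_{j ≠ i} (vᵢ - vⱼ)` of `f` at the nodes `v`. -/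
def divDiff {ι : Type*} [DecidableEq ι] (s : Finset ι) (v : ι → ℂ) (f : ℂ → ℂ) : ℂ :=
  ∑ i ∈ s, f (v i) / ∏ j ∈ s, if j = i then 1 else v i - v j

section DivDiff

variable {ι κ : Type*} [DecidableEq ι] [DecidableEq κ]

theorem divDiff_sub_mul {s : Finset ι} {v : ι → ℂ} (hv : Set.InjOn v s) {j : ι} (hj : j ∈ s)
    (c : ℂ) (g : ℂ → ℂ) :
    divDiff s v (fun x => (x - c) * g x) = divDiff (s.erase j) v g + (v j - c) * divDiff s v g := by
  have hz : divDiff s v (fun x => (x - v j) * g x) = divDiff (s.erase j) v g := by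
    unfold divDiff
    rw [← Finset.add_sum_erase s _ hj]
    simp only [sub_self, zero_mul, zero_div, zero_add]
    refine Finset.sum_congr rfl fun i hi => ?_
    have hne : j ≠ i := (Finset.ne_of_mem_erase hi).symm
    have hi' := Finset.mem_of_mem_erase hi
    rw [← Finset.mul_prod_erase s _ hj, if_neg hne]
    have : v i - v j ≠ 0 := sub_ne_zero.2 fun h => hne (hv hj hi' h.symm)
    rw [mul_div_mul_left _ _ this]
  rw [← hz]
  unfold divDiff
  rw [Finset.mul_sum, ← Finset.sum_add_distrib]
  refine Finset.sum_congr rfl fun i _ => ?_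
  ring

theorem divDiff_one (n : ℕ) : ∀ (s : Finset ι) (v : ι → ℂ), Set.InjOn v s → s.card = n + 1 →
    divDiff s v (fun _ => 1) = if n = 0 then 1 else 0 := by
  induction n with
  | zero =>
    intro s v _ hs
    obtain ⟨a, rfl⟩ := Finset.card_eq_one.1 (by simpa using hs)
    simp [divDiff]
  | succ n ih =>
    intro s v hv hs
    obtain ⟨a, ha, b, hb, hab⟩ := Finset.one_lt_card.1 (show 1 < s.card by omega)
    have ea := divDiff_sub_mul hv ha 0 (fun _ => 1)
    have eb := divDiff_sub_mul hv hb 0 (fun _ => 1)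
    rw [ih _ v (hv.mono (by simp)) (by rw [Finset.card_erase_of_mem ha]; omega)] at ea
    rw [ih _ v (hv.mono (by simp)) (by rw [Finset.card_erase_of_mem hb]; omega)] at eb
    have hne : v a - v b ≠ 0 := sub_ne_zero.2 fun h => hab (hv ha hb h)
    have : (v a - v b) * divDiff s v (fun _ => 1) = 0 := by
      linear_combination eb - ea
    simpa [hne] using this

/-- The divided difference of a monic polynomial of degree at most two above the order of the
divided difference: the complete symmetric polynomials of degree `≤ 2` in "nodes minus zeros". -/
theorem divDiff_prod (t : Finset κ) (c : κ → ℂ) : ∀ (s : Finset ι) (v : ι → ℂ), Set.InjOn v s →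
    (t.card + 1 < s.card → divDiff s v (fun x => ∏ i ∈ t, (x - c i)) = 0) ∧
    (s.card = t.card + 1 → divDiff s v (fun x => ∏ i ∈ t, (x - c i)) = 1) ∧
    (s.card = t.card → divDiff s v (fun x => ∏ i ∈ t, (x - c i)) = ∑ i ∈ s, v i - ∑ i ∈ t, c i) ∧
    (s.card + 1 = t.card → divDiff s v (fun x => ∏ i ∈ t, (x - c i)) =
      ((∑ i ∈ s, v i - ∑ i ∈ t, c i) ^ 2 + ∑ i ∈ s, v i ^ 2 - ∑ i ∈ t, c i ^ 2) / 2) := by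
  induction t using Finset.induction_on with
  | empty =>
    intro s v hv
    simp only [Finset.prod_empty, Finset.card_empty]
    refine ⟨fun h => ?_, fun h => ?_, fun h => ?_, fun h => by omega⟩
    · rw [divDiff_one (s.card - 1) s v hv (by omega), if_neg (by omega)]
    · rw [divDiff_one 0 s v hv (by omega), if_pos rfl]
    · rw [Finset.card_eq_zero.1 h]
      simp [divDiff]
  | insert a t ha ih =>
    intro s v hv
    rw [Finset.card_insert_of_notMem ha, Finset.sum_insert ha, Finset.sum_insert ha]
    simp only [Finset.prod_insert ha]
    by_cases hs : s.Nonempty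
    · obtain ⟨j, hj⟩ := hs
      have hcard := Finset.card_erase_of_mem hj
      have hpos : 0 < s.card := Finset.card_pos.2 ⟨j, hj⟩
      obtain ⟨i1, i2, i3, i4⟩ := ih (s.erase j) v (hv.mono (by simp))
      obtain ⟨j1, j2, j3, j4⟩ := ih s v hv
      rw [divDiff_sub_mul hv hj, ← Finset.add_sum_erase s _ hj, ← Finset.add_sum_erase s _ hj]
      refine ⟨fun h => ?_, fun h => ?_, fun h => ?_, fun h => ?_⟩
      · rw [i1 (by omega), j1 (by omega)]; ring
      · rw [i2 (by omega), j1 (by omega)]; ring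
      · rw [i3 (by omega), j2 (by omega)]; ring
      · rw [i4 (by omega), j3 (by omega), ← Finset.add_sum_erase s _ hj]; ring
    · rw [Finset.not_nonempty_iff_eq_empty] at hs
      subst hs
      refine ⟨fun h => by simp at h, fun h => by simp at h, fun h => by simp at h, fun h => ?_⟩
      have : t = ∅ := Finset.card_eq_zero.1 (by simpa using h.symm)
      subst this
      simp [divDiff]

end DivDiff

/-- Divided differences at the nodes `yₗ` and `yₗ - 1`. -/
theorem sum_sub_sum_shift {κ : Type*} [DecidableEq κ] (n : ℕ) (y : ℕ → ℂ)
    (hd : ∀ s < n, ∀ p < n, s ≠ p → y s ≠ y p) (hd1 : ∀ s < n, ∀ p < n, y s ≠ y p - 1)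
    (t : Finset κ) (c : κ → ℂ) :
    (t.card + 1 = 2 * n →
      (∑ l ∈ Finset.range n, (∏ i ∈ t, (y l - c i)) /
        ∏ s ∈ Finset.range n, if s = l then 1 else (y l - y s) * (y l - y s + 1)) -
      (∑ l ∈ Finset.range n, (∏ i ∈ t, (y l - 1 - c i)) /
        ∏ s ∈ Finset.range n, if s = l then 1 else (y l - y s) * (y l - y s - 1)) = 1) ∧
    (t.card = 2 * n →
      (∑ l ∈ Finset.range n, (∏ i ∈ t, (y l - c i)) /
        ∏ s ∈ Finset.range n, if s = l then 1 else (y l - y s) * (y l - y s + 1)) -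
      (∑ l ∈ Finset.range n, (∏ i ∈ t, (y l - 1 - c i)) /
        ∏ s ∈ Finset.range n, if s = l then 1 else (y l - y s) * (y l - y s - 1)) =
        2 * (∑ l ∈ Finset.range n, y l) - n - ∑ i ∈ t, c i) := by
  set v : ℕ ⊕ ℕ → ℂ := Sum.elim y (fun i => y i - 1) with hv
  set S : Finset (ℕ ⊕ ℕ) := (Finset.range n).disjSum (Finset.range n) with hS
  have hinj : Set.InjOn v S := by
    rintro (i | i) hi (j | j) hj h
    all_goals
      simp only [hS, Finset.mem_coe, Finset.inl_mem_disjSum, Finset.inr_mem_disjSum,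
        Finset.mem_range] at hi hj
      simp only [hv, Sum.elim_inl, Sum.elim_inr] at h
    · by_contra hne
      exact hd i hi j hj (fun h' => hne (by rw [h'])) h
    · exact absurd h (hd1 i hi j hj)
    · exact absurd h.symm (hd1 j hj i hi)
    · by_contra hne
      exact hd i hi j hj (fun h' => hne (by rw [h'])) (by linear_combination h)
  have hcard : S.card = 2 * n := by simp [hS, Finset.card_disjSum]; ring
  have hsum : ∑ i ∈ S, v i = 2 * (∑ l ∈ Finset.range n, y l) - n := by
    rw [hS, Finset.sum_disjSum]
    simp only [hv, Sum.elim_inl, Sum.elim_inr, Finset.sum_sub_distrib]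
    simp
    ring
  have hdd : divDiff S v (fun x => ∏ i ∈ t, (x - c i)) =
      (∑ l ∈ Finset.range n, (∏ i ∈ t, (y l - c i)) /
        ∏ s ∈ Finset.range n, if s = l then 1 else (y l - y s) * (y l - y s + 1)) -
      (∑ l ∈ Finset.range n, (∏ i ∈ t, (y l - 1 - c i)) /
        ∏ s ∈ Finset.range n, if s = l then 1 else (y l - y s) * (y l - y s - 1)) := by
    unfold divDiff
    rw [hS, Finset.sum_disjSum, sub_eq_add_neg, ← Finset.sum_neg_distrib]
    congr 1
    · refine Finset.sum_congr rfl fun l hl => ?_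
      rw [Finset.prod_disjSum]
      simp only [hv, Sum.elim_inl, Sum.elim_inr, Sum.inl.injEq, reduceCtorEq, if_false]
      rw [← Finset.prod_mul_distrib]
      congr 1
      refine Finset.prod_congr rfl fun s _ => ?_
      split_ifs with h
      · rw [h]; ring
      · ring
    · refine Finset.sum_congr rfl fun l hl => ?_
      rw [Finset.prod_disjSum]
      simp only [hv, Sum.elim_inl, Sum.elim_inr, Sum.inr.injEq, reduceCtorEq, if_false]
      rw [← Finset.prod_mul_distrib, ← Finset.mul_prod_erase _ _ hl,
        ← Finset.mul_prod_erase _ (fun s => if s = l then (1 : ℂ) else _) hl, ← div_neg]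
      congr 1
      rw [if_pos rfl, if_pos rfl, one_mul, show (y l - 1 - y l) * 1 = (-1 : ℂ) by ring, neg_one_mul]
      congr 1
      refine Finset.prod_congr rfl fun s hs => ?_
      rw [if_neg (Finset.ne_of_mem_erase hs), if_neg (Finset.ne_of_mem_erase hs)]
      ring
  obtain ⟨-, h2, h3, -⟩ := divDiff_prod t c S v hinj
  rw [hdd] at h2 h3
  refine ⟨fun h => h2 (by omega), fun h => ?_⟩
  rw [h3 (by omega), hsum]

/-! ### Sums over paths in a triangular array -/

/-- The contribution of the entry `y l` of a row of length `q + 1` with lower neighbours `w` and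
upper neighbours `a`. -/
def rowTerm (q : ℕ) (w y a : ℕ → ℂ) (l : ℕ) : ℂ :=
  (∏ m ∈ Finset.range (q + 2), (y l - a m + 1 / 2)) * (∏ m ∈ Finset.range q, (y l - w m + 1 / 2)) /
    ∏ s ∈ Finset.range (q + 1), if s = l then 1 else (y l - y s) * (y l - y s + 1)

section RowTerm

variable {q : ℕ} {w y a : ℕ → ℂ}

theorem prod_ite_neg (l : ℕ) : (∏ s ∈ Finset.range (q + 1), if s = l then (1 : ℂ) else
      ((-y) l - (-y) s) * ((-y) l - (-y) s + 1)) =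
    ∏ s ∈ Finset.range (q + 1), if s = l then (1 : ℂ) else (y l - y s) * (y l - y s - 1) := by
  refine Finset.prod_congr rfl fun s _ => ?_
  split_ifs
  · rfl
  · simp only [Pi.neg_apply]; ring

theorem sum_rowTerm_sub (hd : ∀ s < q + 1, ∀ p < q + 1, s ≠ p → y s ≠ y p)
    (hy : ∀ s, (y s).re = 0) :
    (∑ l ∈ Finset.range (q + 1), rowTerm q w y a l) -
      (∑ l ∈ Finset.range (q + 1), rowTerm q (-w) (-y) (-a) l) =
      2 * (∑ l ∈ Finset.range (q + 1), y l) - (∑ m ∈ Finset.range (q + 2), a m) -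
        ∑ m ∈ Finset.range q, w m := by
  have hd1 : ∀ s < q + 1, ∀ p < q + 1, y s ≠ y p - 1 := fun s _ p _ h => by
    have := congrArg Complex.re h
    simp [hy] at this
  have h := (sum_sub_sum_shift (q + 1) y hd hd1
    ((Finset.range (q + 2)).disjSum (Finset.range q))
    (Sum.elim (fun m => a m - 1 / 2) (fun m => w m - 1 / 2))).2
    (by simp [Finset.card_disjSum]; ring)
  simp only [Finset.prod_disjSum, Finset.sum_disjSum, Sum.elim_inl, Sum.elim_inr] at h
  have e1 : ∀ l, rowTerm q w y a l = (∏ m ∈ Finset.range (q + 2), (y l - (a m - 1 / 2))) *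
      (∏ m ∈ Finset.range q, (y l - (w m - 1 / 2))) /
      ∏ s ∈ Finset.range (q + 1), if s = l then 1 else (y l - y s) * (y l - y s + 1) := by
    intro l
    simp only [rowTerm, ← sub_add]
  have e2 : ∀ l, rowTerm q (-w) (-y) (-a) l =
      (∏ m ∈ Finset.range (q + 2), (y l - 1 - (a m - 1 / 2))) *
      (∏ m ∈ Finset.range q, (y l - 1 - (w m - 1 / 2))) /
      ∏ s ∈ Finset.range (q + 1), if s = l then 1 else (y l - y s) * (y l - y s - 1) := by
    intro l
    rw [rowTerm, prod_ite_neg]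
    congr 1
    have f1 : ∀ b : ℕ → ℂ, ∀ m, (-y) l - (-b) m + 1 / 2 = -1 * (y l - 1 - (b m - 1 / 2)) := by
      intro b m
      simp only [Pi.neg_apply]; ring
    simp only [f1, Finset.prod_mul_distrib, Finset.prod_const, Finset.card_range]
    rw [show q + 2 = q + 1 + 1 by ring, pow_succ, pow_succ]
    have : ((-1 : ℂ) ^ q) * (-1) ^ q = 1 := by rw [← mul_pow]; simp
    linear_combination (∏ m ∈ Finset.range (q + 1 + 1), (y l - 1 - (a m - 1 / 2))) *
      (∏ m ∈ Finset.range q, (y l - 1 - (w m - 1 / 2))) * this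
  rw [Finset.sum_congr rfl fun l _ => e1 l, Finset.sum_congr rfl fun l _ => e2 l, h]
  simp only [Finset.sum_sub_distrib, Finset.sum_const, Finset.card_range, nsmul_eq_mul]
  push_cast
  ring

theorem sum_rowTerm_div_add (hd : ∀ s < q + 1, ∀ p < q + 1, s ≠ p → y s ≠ y p)
    (hy : ∀ s, (y s).re = 0) (hw : ∀ s, (w s).re = 0) {k : ℕ} (hk : k < q) :
    ∑ l ∈ Finset.range (q + 1), (rowTerm q w y a l / (1 / 2 + (y l - w k)) +
      rowTerm q (-w) (-y) (-a) l / (1 / 2 - (y l - w k))) = 1 := by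
  have hd1 : ∀ s < q + 1, ∀ p < q + 1, y s ≠ y p - 1 := fun s _ p _ h => by
    have := congrArg Complex.re h
    simp [hy] at this
  have hk' := Finset.mem_range.2 hk
  have h := (sum_sub_sum_shift (q + 1) y hd hd1
    ((Finset.range (q + 2)).disjSum ((Finset.range q).erase k))
    (Sum.elim (fun m => a m - 1 / 2) (fun m => w m - 1 / 2))).1
    (by rw [Finset.card_disjSum, Finset.card_erase_of_mem hk', Finset.card_range,
          Finset.card_range]; omega)
  simp only [Finset.prod_disjSum, Sum.elim_inl, Sum.elim_inr] at h
  have n1 : ∀ l, (1 / 2 + (y l - w k) : ℂ) ≠ 0 := fun l h => by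
    have := congrArg Complex.re h
    simp [hy, hw] at this
  have n2 : ∀ l, (1 / 2 - (y l - w k) : ℂ) ≠ 0 := fun l h => by
    have := congrArg Complex.re h
    simp [hy, hw] at this
  have e1 : ∀ l, rowTerm q w y a l / (1 / 2 + (y l - w k)) =
      (∏ m ∈ Finset.range (q + 2), (y l - (a m - 1 / 2))) *
      (∏ m ∈ (Finset.range q).erase k, (y l - (w m - 1 / 2))) /
      ∏ s ∈ Finset.range (q + 1), if s = l then 1 else (y l - y s) * (y l - y s + 1) := by
    intro l
    rw [rowTerm, ← Finset.mul_prod_erase _ _ hk', div_div, mul_comm _ (1 / 2 + (y l - w k)),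
      ← div_div]
    congr 1
    rw [div_eq_iff (n1 l)]
    simp only [← sub_add]
    ring
  have e2 : ∀ l, rowTerm q (-w) (-y) (-a) l / (1 / 2 - (y l - w k)) =
      -((∏ m ∈ Finset.range (q + 2), (y l - 1 - (a m - 1 / 2))) *
      (∏ m ∈ (Finset.range q).erase k, (y l - 1 - (w m - 1 / 2))) /
      ∏ s ∈ Finset.range (q + 1), if s = l then 1 else (y l - y s) * (y l - y s - 1)) := by
    intro l
    rw [rowTerm, prod_ite_neg, ← Finset.mul_prod_erase _ _ hk', div_div,
      mul_comm _ (1 / 2 - (y l - w k)), ← div_div, ← neg_div]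
    congr 1
    rw [div_eq_iff (n2 l)]
    have f1 : ∀ b : ℕ → ℂ, ∀ m, (-y) l - (-b) m + 1 / 2 = -1 * (y l - 1 - (b m - 1 / 2)) := by
      intro b m
      simp only [Pi.neg_apply]; ring
    simp only [f1, Finset.prod_mul_distrib, Finset.prod_const, Finset.card_range,
      Finset.card_erase_of_mem hk']
    obtain ⟨q', rfl⟩ : ∃ q', q = q' + 1 := ⟨q - 1, by omega⟩
    simp only [Nat.add_sub_cancel]
    rw [show q' + 1 + 2 = q' + 1 + 1 + 1 by ring, pow_succ, pow_succ, pow_succ]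
    have : ((-1 : ℂ) ^ q') * (-1) ^ q' = 1 := by rw [← mul_pow]; simp
    linear_combination (∏ m ∈ Finset.range (q' + 1 + 1 + 1), (y l - 1 - (a m - 1 / 2))) *
      (∏ m ∈ (Finset.range (q' + 1)).erase k, (y l - 1 - (w m - 1 / 2))) *
      (y l - 1 - (w k - 1 / 2)) * this
  rw [Finset.sum_add_distrib, Finset.sum_congr rfl fun l _ => e1 l,
    Finset.sum_congr rfl fun l _ => e2 l, Finset.sum_neg_distrib, ← sub_eq_add_neg, h]

end RowTerm

/-- The sum over all paths `k_j, …, k_n = l` (one marked entry in each of the rows `j, …, n`) of the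
product of the factors `Y - Y' + 1/2` for adjacent rows (`Y` marked, `Y'` unmarked) and
`1 / ((Y - Y') (Y - Y' + 1))` within the rows, up to row `n`. -/
def pathAmp (Y : ℕ → ℕ → ℂ) (j : ℕ) : ℕ → ℕ → ℂ
  | 0, _ => 0
  | n + 1, l =>
    ((if n + 1 = j then ∏ m ∈ Finset.range n, (Y (n + 1) l - Y n m + 1 / 2) else 0) +
      ∑ k ∈ Finset.range n,
        (∏ m ∈ Finset.range n, if m = k then 1 else (Y (n + 1) l - Y n m + 1 / 2)) *
        (∏ m ∈ Finset.range (n + 1), if m = l then 1 else (Y n k - Y (n + 1) m + 1 / 2)) *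
        pathAmp Y j n k) /
    ∏ s ∈ Finset.range (n + 1), if s = l then 1 else
      (Y (n + 1) l - Y (n + 1) s) * (Y (n + 1) l - Y (n + 1) s + 1)

/-- The sum over all paths in the rows `j, …, n`, with the unmarked row `a` on top of row `n`. -/
def pathSum (Y : ℕ → ℕ → ℂ) (j n : ℕ) (a : ℕ → ℂ) : ℂ :=
  ∑ l ∈ Finset.range n, (∏ m ∈ Finset.range (n + 1), (Y n l - a m + 1 / 2)) * pathAmp Y j n l

theorem pathAmp_of_lt (Y : ℕ → ℕ → ℂ) (j n l : ℕ) (h : n < j) : pathAmp Y j n l = 0 := by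
  induction n generalizing l with
  | zero => rfl
  | succ n ih =>
    rw [pathAmp, if_neg (by omega), Finset.sum_eq_zero fun k _ => by rw [ih k (by omega), mul_zero]]
    simp

section Generic

variable {Y : ℕ → ℕ → ℂ}

theorem mul_div_prod_ite (l : ℕ) {n : ℕ} (hl : l < n) (f : ℕ → ℂ) (hf : f l ≠ 0) :
    (∏ m ∈ Finset.range n, if m = l then 1 else f m) = (∏ m ∈ Finset.range n, f m) / f l := by
  rw [eq_div_iff hf, ← Finset.mul_prod_erase _ _ (Finset.mem_range.2 hl),
    ← Finset.mul_prod_erase _ f (Finset.mem_range.2 hl), if_pos rfl, one_mul, mul_comm]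
  congr 1
  exact Finset.prod_congr rfl fun m hm => if_neg (Finset.ne_of_mem_erase hm)

theorem pathSum_self (q : ℕ) (a : ℕ → ℂ) :
    pathSum Y (q + 1) (q + 1) a = ∑ l ∈ Finset.range (q + 1), rowTerm q (Y q) (Y (q + 1)) a l := by
  refine Finset.sum_congr rfl fun l _ => ?_
  rw [pathAmp, if_pos rfl, Finset.sum_eq_zero fun k _ => by
    rw [pathAmp_of_lt _ _ _ _ (Nat.lt_succ_self q), mul_zero], rowTerm, add_zero, mul_div_assoc]

theorem pathSum_succ (hre : ∀ r k, (Y r k).re = 0) {j q : ℕ} (hj : j ≤ q) (a : ℕ → ℂ) :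
    pathSum Y j (q + 1) a = ∑ l ∈ Finset.range (q + 1), ∑ k ∈ Finset.range q,
      (∏ m ∈ Finset.range (q + 1), (Y q k - Y (q + 1) m + 1 / 2)) * pathAmp Y j q k *
      rowTerm q (Y q) (Y (q + 1)) a l /
      ((1 / 2 + (Y (q + 1) l - Y q k)) * (1 / 2 - (Y (q + 1) l - Y q k))) := by
  refine Finset.sum_congr rfl fun l hl => ?_
  rw [pathAmp, if_neg (by omega), zero_add, Finset.sum_div, Finset.mul_sum]
  refine Finset.sum_congr rfl fun k hk => ?_
  have n1 : (Y (q + 1) l - Y q k + 1 / 2 : ℂ) ≠ 0 := fun h => by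
    have := congrArg Complex.re h
    simp [hre] at this
  have n2 : (Y q k - Y (q + 1) l + 1 / 2 : ℂ) ≠ 0 := fun h => by
    have := congrArg Complex.re h
    simp [hre] at this
  rw [mul_div_prod_ite k (Finset.mem_range.1 hk) (fun m => Y (q + 1) l - Y q m + 1 / 2) n1,
    mul_div_prod_ite l (Finset.mem_range.1 hl) (fun m => Y q k - Y (q + 1) m + 1 / 2) n2, rowTerm,
    show (1 / 2 + (Y (q + 1) l - Y q k)) = Y (q + 1) l - Y q k + 1 / 2 by ring,
    show (1 / 2 - (Y (q + 1) l - Y q k)) = Y q k - Y (q + 1) l + 1 / 2 by ring]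
  simp only [div_eq_mul_inv, mul_inv]
  ring

/-- The telescoping at the heart of the commutation relation `[E_{jN}, E_{Nj}] = E_{jj} - E_{NN}`:
two families of linear relations for a rank-one kernel add up. -/
theorem sum_kernel_eq {q : ℕ} (α β : ℕ → ℂ) (a b : ℕ → ℂ) (u : ℕ → ℕ → ℂ)
    (h1 : ∀ k l, (1 / 2 + u k l : ℂ) ≠ 0) (h2 : ∀ k l, (1 / 2 - u k l : ℂ) ≠ 0)
    (L1 : ∀ k ∈ Finset.range q, ∑ l ∈ Finset.range (q + 1),
      (α l / (1 / 2 + u k l) + β l / (1 / 2 - u k l)) = 1)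
    (L2 : ∀ l ∈ Finset.range (q + 1), ∑ k ∈ Finset.range q,
      (a k / (1 / 2 - u k l) + b k / (1 / 2 + u k l)) = 1) :
    (∑ l ∈ Finset.range (q + 1), ∑ k ∈ Finset.range q,
        a k * α l / ((1 / 2 + u k l) * (1 / 2 - u k l))) -
      (∑ l ∈ Finset.range (q + 1), ∑ k ∈ Finset.range q,
        b k * β l / ((1 / 2 - u k l) * (1 / 2 + u k l))) =
    (∑ k ∈ Finset.range q, a k - ∑ k ∈ Finset.range q, b k) +
      (∑ l ∈ Finset.range (q + 1), α l - ∑ l ∈ Finset.range (q + 1), β l) := by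
  have hA : ∀ c : ℕ → ℂ, ∑ k ∈ Finset.range q, c k =
      ∑ l ∈ Finset.range (q + 1), ∑ k ∈ Finset.range q,
        c k * (α l / (1 / 2 + u k l) + β l / (1 / 2 - u k l)) := by
    intro c
    rw [Finset.sum_comm]
    refine Finset.sum_congr rfl fun k hk => ?_
    rw [← Finset.mul_sum, L1 k hk, mul_one]
  have hB : ∀ c : ℕ → ℂ, ∑ l ∈ Finset.range (q + 1), c l =
      ∑ l ∈ Finset.range (q + 1), ∑ k ∈ Finset.range q,
        c l * (a k / (1 / 2 - u k l) + b k / (1 / 2 + u k l)) := by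
    intro c
    refine Finset.sum_congr rfl fun l hl => ?_
    rw [← Finset.mul_sum, L2 l hl, mul_one]
  rw [hA a, hA b, hB α, hB β]
  simp only [← Finset.sum_sub_distrib, ← Finset.sum_add_distrib]
  refine Finset.sum_congr rfl fun l _ => Finset.sum_congr rfl fun k _ => ?_
  have hP := h1 k l
  have hQ := h2 k l
  have hPQ : (1 / 2 + u k l) + (1 / 2 - u k l) = 1 := by ring
  generalize (1 / 2 + u k l) = P at *
  generalize (1 / 2 - u k l) = Q at *
  have e1 : (P * Q)⁻¹ = P⁻¹ + Q⁻¹ := by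
    field_simp
    linear_combination -hPQ
  rw [mul_comm Q P]
  simp only [div_eq_mul_inv, e1]
  ring

/-- The commutation relation `[E_{jN}, E_{Nj}] = E_{jj} - E_{NN}` in the Gelfand–Zetlin
realization, for its part that does not move the variables. -/
theorem pathSum_sub_neg (hre : ∀ r k, (Y r k).re = 0) {j n : ℕ} (hj : 1 ≤ j) (hjn : j ≤ n)
    (hd : ∀ r ≤ n, ∀ s < r, ∀ p < r, s ≠ p → Y r s ≠ Y r p) (a : ℕ → ℂ) :
    pathSum Y j n a - pathSum (-Y) j n (-a) =
      ((∑ m ∈ Finset.range j, Y j m) - ∑ m ∈ Finset.range (j - 1), Y (j - 1) m) -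
      ((∑ m ∈ Finset.range (n + 1), a m) - ∑ m ∈ Finset.range n, Y n m) := by
  induction n, hjn using Nat.le_induction generalizing a with
  | base =>
    obtain ⟨q, rfl⟩ : ∃ q, j = q + 1 := ⟨j - 1, by omega⟩
    have h := sum_rowTerm_sub (q := q) (w := Y q) (y := Y (q + 1)) (a := a) (hd (q + 1) le_rfl)
      (hre (q + 1))
    rw [pathSum_self, pathSum_self]
    simp only [Pi.neg_apply, Nat.add_sub_cancel]
    rw [h]
    ring
  | succ q hjq ih =>
    have ih' := fun b => ih (fun r hr => hd r (by omega)) b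
    have hre' : ∀ r k, ((-Y) r k).re = 0 := fun r k => by simp [hre]
    rw [pathSum_succ hre hjq, pathSum_succ hre' hjq]
    have n1 : ∀ k l, (1 / 2 + (Y (q + 1) l - Y q k) : ℂ) ≠ 0 := fun k l h => by
      have := congrArg Complex.re h
      simp [hre] at this
    have n2 : ∀ k l, (1 / 2 - (Y (q + 1) l - Y q k) : ℂ) ≠ 0 := fun k l h => by
      have := congrArg Complex.re h
      simp [hre] at this
    have key := sum_kernel_eq (q := q) (rowTerm q (Y q) (Y (q + 1)) a)
      (rowTerm q (-Y q) (-Y (q + 1)) (-a))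
      (fun k => (∏ m ∈ Finset.range (q + 1), (Y q k - Y (q + 1) m + 1 / 2)) * pathAmp Y j q k)
      (fun k => (∏ m ∈ Finset.range (q + 1), ((-Y) q k - (-Y) (q + 1) m + 1 / 2)) *
        pathAmp (-Y) j q k)
      (fun k l => Y (q + 1) l - Y q k) n1 n2
      (fun k hk => sum_rowTerm_div_add (hd (q + 1) le_rfl) (hre (q + 1)) (hre q)
        (Finset.mem_range.1 hk)) ?_
    · have e1 := ih' (Y (q + 1))
      have e2 := sum_rowTerm_sub (q := q) (w := Y q) (y := Y (q + 1)) (a := a) (hd (q + 1) le_rfl)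
        (hre (q + 1))
      rw [pathSum, pathSum] at e1
      simp only [Pi.neg_apply] at e1 e2 key ⊢
      have e3 : ∀ k l, (1 / 2 + (-Y (q + 1) l - -Y q k)) * (1 / 2 - (-Y (q + 1) l - -Y q k)) =
          (1 / 2 - (Y (q + 1) l - Y q k)) * (1 / 2 + (Y (q + 1) l - Y q k)) := by
        intro k l; ring
      simp only [e3]
      rw [key, e1, e2]
      ring
    · -- the coefficient of the entry `l` of row `q + 1` in the relation one level below
      intro l hl
      have e1 := ih' (Y (q + 1))
      have e2 := ih' (Function.update (Y (q + 1)) l (Y (q + 1) l - 1))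
      rw [pathSum, pathSum] at e1 e2
      have hsum : ∑ m ∈ Finset.range (q + 1), Function.update (Y (q + 1)) l (Y (q + 1) l - 1) m =
          (∑ m ∈ Finset.range (q + 1), Y (q + 1) m) - 1 := by
        rw [Finset.sum_update_of_mem hl, ← Finset.add_sum_erase _ _ hl, Finset.sdiff_singleton_eq_erase]
        ring
      have hp : ∀ k, ∏ m ∈ Finset.range (q + 1),
          (Y q k - Function.update (Y (q + 1)) l (Y (q + 1) l - 1) m + 1 / 2) =
          (∏ m ∈ Finset.range (q + 1), (Y q k - Y (q + 1) m + 1 / 2)) *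
            (1 + 1 / (1 / 2 - (Y (q + 1) l - Y q k))) := by
        intro k
        rw [← Finset.mul_prod_erase _ _ hl, ← Finset.mul_prod_erase _ (fun m => _ - Y (q + 1) m + _) hl,
          Function.update_self, Finset.prod_congr rfl fun m hm => by
            rw [Function.update_of_ne (Finset.ne_of_mem_erase hm)]]
        have := n2 k l
        have e0 : Y q k - Y (q + 1) l + 1 / 2 = 1 / 2 - (Y (q + 1) l - Y q k) := by ring
        rw [e0, mul_right_comm, mul_add, mul_one, mul_one_div_cancel this]
        ring
      have hq : ∀ k, ∏ m ∈ Finset.range (q + 1),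
          ((-Y) q k - (-Function.update (Y (q + 1)) l (Y (q + 1) l - 1)) m + 1 / 2) =
          (∏ m ∈ Finset.range (q + 1), ((-Y) q k - (-Y) (q + 1) m + 1 / 2)) *
            (1 - 1 / (1 / 2 + (Y (q + 1) l - Y q k))) := by
        intro k
        rw [← Finset.mul_prod_erase _ _ hl,
          ← Finset.mul_prod_erase _ (fun m => _ - (-Y) (q + 1) m + _) hl,
          Pi.neg_apply (Function.update _ _ _), Function.update_self,
          Finset.prod_congr rfl fun m hm => by
            rw [Pi.neg_apply (Function.update _ _ _),
              Function.update_of_ne (Finset.ne_of_mem_erase hm)]]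
        have := n1 k l
        simp only [Pi.neg_apply]
        have e0 : -Y q k - -Y (q + 1) l + 1 / 2 = 1 / 2 + (Y (q + 1) l - Y q k) := by ring
        rw [e0, mul_right_comm, mul_sub, mul_one, mul_one_div_cancel this]
        ring
      simp only [hp, hq, hsum] at e2
      simp only [Pi.neg_apply] at e1 e2 ⊢
      have e3 : ∀ k, (∏ m ∈ Finset.range (q + 1), (Y q k - Y (q + 1) m + 1 / 2)) *
          (1 + 1 / (1 / 2 - (Y (q + 1) l - Y q k))) * pathAmp Y j q k =
          (∏ m ∈ Finset.range (q + 1), (Y q k - Y (q + 1) m + 1 / 2)) * pathAmp Y j q k +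
          (∏ m ∈ Finset.range (q + 1), (Y q k - Y (q + 1) m + 1 / 2)) * pathAmp Y j q k /
            (1 / 2 - (Y (q + 1) l - Y q k)) := by
        intro k; ring
      have e4 : ∀ k, (∏ m ∈ Finset.range (q + 1), (-Y q k - -Y (q + 1) m + 1 / 2)) *
          (1 - 1 / (1 / 2 + (Y (q + 1) l - Y q k))) * pathAmp (-Y) j q k =
          (∏ m ∈ Finset.range (q + 1), (-Y q k - -Y (q + 1) m + 1 / 2)) * pathAmp (-Y) j q k -
          (∏ m ∈ Finset.range (q + 1), (-Y q k - -Y (q + 1) m + 1 / 2)) * pathAmp (-Y) j q k /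
            (1 / 2 + (Y (q + 1) l - Y q k)) := by
        intro k; ring
      simp only [e3, e4, Finset.sum_add_distrib, Finset.sum_sub_distrib] at e2
      rw [Finset.sum_add_distrib]
      linear_combination e2 - e1

/-- The path sums, added up over the bottom row of the path, no longer depend on the lower rows. -/
theorem sum_pathAmp (hre : ∀ r k, (Y r k).re = 0) (n : ℕ)
    (hd : ∀ r ≤ n, ∀ s < r, ∀ p < r, s ≠ p → Y r s ≠ Y r p) (l : ℕ) (hl : l < n) :
    ∑ j ∈ Finset.Icc 1 n, pathAmp Y j n l =
      1 / ∏ s ∈ Finset.range n, if s = l then 1 else Y n l - Y n s := by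
  induction n generalizing l with
  | zero => omega
  | succ q ih =>
    have ih' : ∀ k ∈ Finset.range q, ∑ j ∈ Finset.Icc 1 (q + 1), pathAmp Y j q k =
        1 / ∏ s ∈ Finset.range q, if s = k then 1 else Y q k - Y q s := by
      intro k hk
      rw [Finset.sum_Icc_succ_top (by omega), pathAmp_of_lt _ _ _ _ (Nat.lt_succ_self q), add_zero]
      exact ih (fun r hr => hd r (by omega)) k (Finset.mem_range.1 hk)
    simp only [pathAmp]
    rw [← Finset.sum_div, Finset.sum_add_distrib, Finset.sum_ite_eq, if_pos (by simp),
      Finset.sum_comm]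
    simp only [← Finset.mul_sum]
    rw [Finset.sum_congr rfl fun k hk => by rw [ih' k hk]]
    -- interpolate `f` at the nodes `Y q k`
    set x : ℂ := Y (q + 1) l + 1 / 2 with hx
    set f : ℂ → ℂ := fun z => ∏ s ∈ (Finset.range (q + 1)).erase l, (z - (Y (q + 1) s - 1 / 2)) with hf
    have hxw : ∀ m, x - Y q m ≠ 0 := fun m h => by
      have := congrArg Complex.re h
      simp [hx, hre] at this
    set v : ℕ → ℂ := Function.update (Y q) q x with hv
    have hvq : v q = x := Function.update_self ..
    have hvm : ∀ m < q, v m = Y q m := fun m hm => Function.update_of_ne hm.ne _ _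
    have hinj : Set.InjOn v (Finset.range (q + 1)) := by
      intro i hi j hj h
      simp only [Finset.coe_range, Set.mem_Iio] at hi hj
      rcases Nat.lt_succ_iff_lt_or_eq.1 hi with hi | rfl <;>
        rcases Nat.lt_succ_iff_lt_or_eq.1 hj with hj | rfl
      · rw [hvm i hi, hvm j hj] at h
        by_contra hne
        exact hd q (by omega) i hi j hj hne h
      · rw [hvm i hi, hvq] at h
        exact absurd h.symm (sub_ne_zero.1 (hxw i))
      · rw [hvm j hj, hvq] at h
        exact absurd h (sub_ne_zero.1 (hxw j))
      · rfl
    have hdd := (divDiff_prod ((Finset.range (q + 1)).erase l) (fun s => Y (q + 1) s - 1 / 2)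
      (Finset.range (q + 1)) v hinj).2.1 (by
        rw [Finset.card_erase_of_mem (Finset.mem_range.2 hl), Finset.card_range]; omega)
    rw [divDiff, Finset.sum_range_succ, hvq] at hdd
    have hlast : (∏ j ∈ Finset.range (q + 1), if j = q then 1 else x - v j) =
        ∏ m ∈ Finset.range q, (x - Y q m) := by
      rw [Finset.prod_range_succ, if_pos rfl, mul_one]
      refine Finset.prod_congr rfl fun m hm => ?_
      rw [Finset.mem_range] at hm
      rw [if_neg hm.ne, hvm m hm]
    have hP : (∏ m ∈ Finset.range q, (x - Y q m)) ≠ 0 := Finset.prod_ne_zero_iff.2 fun m _ => hxw m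
    have hterm : ∀ i ∈ Finset.range q,
        (∏ s ∈ (Finset.range (q + 1)).erase l, (v i - (Y (q + 1) s - 1 / 2))) /
          (∏ j ∈ Finset.range (q + 1), if j = i then 1 else v i - v j) =
        -(f (Y q i) / ((∏ j ∈ Finset.range q, if j = i then 1 else Y q i - Y q j) *
          (x - Y q i))) := by
      intro i hi
      rw [Finset.mem_range] at hi
      rw [Finset.prod_range_succ _ q, if_neg hi.ne', hvm i hi, hvq, ← div_neg]
      congr 1
      rw [← mul_neg, neg_sub]
      congr 1
      refine Finset.prod_congr rfl fun m hm => ?_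
      rw [hvm m (Finset.mem_range.1 hm)]
    rw [Finset.sum_congr rfl hterm, hlast, Finset.sum_neg_distrib] at hdd
    have hnum : (∏ m ∈ Finset.range q, (Y (q + 1) l - Y q m + 1 / 2)) +
        ∑ k ∈ Finset.range q,
        (∏ m ∈ Finset.range q, if m = k then 1 else (Y (q + 1) l - Y q m + 1 / 2)) *
        (∏ m ∈ Finset.range (q + 1), if m = l then 1 else (Y q k - Y (q + 1) m + 1 / 2)) *
        (1 / ∏ s ∈ Finset.range q, if s = k then 1 else Y q k - Y q s) = f x := by
      have e0 : ∀ m, Y (q + 1) l - Y q m + 1 / 2 = x - Y q m := fun m => by rw [hx]; ring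
      simp only [e0]
      have e1 : ∀ k ∈ Finset.range q,
          (∏ m ∈ Finset.range q, if m = k then 1 else (x - Y q m)) *
          (∏ m ∈ Finset.range (q + 1), if m = l then 1 else (Y q k - Y (q + 1) m + 1 / 2)) *
          (1 / ∏ s ∈ Finset.range q, if s = k then 1 else Y q k - Y q s) =
          (∏ m ∈ Finset.range q, (x - Y q m)) *
          (f (Y q k) / ((∏ j ∈ Finset.range q, if j = k then 1 else Y q k - Y q j) *
            (x - Y q k))) := by
        intro k hk
        rw [mul_div_prod_ite k (Finset.mem_range.1 hk) (fun m => x - Y q m) (hxw k)]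
        have e2 : (∏ m ∈ Finset.range (q + 1),
            if m = l then 1 else (Y q k - Y (q + 1) m + 1 / 2)) = f (Y q k) := by
          rw [← Finset.mul_prod_erase _ _ (Finset.mem_range.2 hl), if_pos rfl, one_mul]
          refine Finset.prod_congr rfl fun m hm => ?_
          rw [if_neg (Finset.ne_of_mem_erase hm)]
          ring
        rw [e2]
        simp only [div_eq_mul_inv, mul_inv]
        ring
      rw [Finset.sum_congr rfl e1, ← Finset.mul_sum]
      have h3 : f x / (∏ m ∈ Finset.range q, (x - Y q m)) = 1 +
          ∑ k ∈ Finset.range q, f (Y q k) / ((∏ j ∈ Finset.range q,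
            if j = k then 1 else Y q k - Y q j) * (x - Y q k)) := by
        linear_combination hdd
      rw [div_eq_iff hP] at h3
      rw [h3]
      ring
    rw [hnum]
    have hfx : f x = ∏ s ∈ Finset.range (q + 1), if s = l then 1 else
        (Y (q + 1) l - Y (q + 1) s + 1) := by
      rw [← Finset.mul_prod_erase _ _ (Finset.mem_range.2 hl), if_pos rfl, one_mul]
      refine Finset.prod_congr rfl fun m hm => ?_
      rw [if_neg (Finset.ne_of_mem_erase hm), hx]
      ring
    have hsplit : (∏ s ∈ Finset.range (q + 1), if s = l then (1 : ℂ) else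
        (Y (q + 1) l - Y (q + 1) s) * (Y (q + 1) l - Y (q + 1) s + 1)) =
        (∏ s ∈ Finset.range (q + 1), if s = l then 1 else (Y (q + 1) l - Y (q + 1) s)) * f x := by
      rw [hfx, ← Finset.prod_mul_distrib]
      refine Finset.prod_congr rfl fun m _ => ?_
      split_ifs <;> simp
    have hfx0 : f x ≠ 0 := by
      rw [hfx, Finset.prod_ne_zero_iff]
      intro s _
      split_ifs
      · exact one_ne_zero
      · intro h
        have := congrArg Complex.re h
        simp [hre] at this
    rw [hsplit, div_mul_cancel_right₀ hfx0, one_div]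

theorem sum_pathSum (hre : ∀ r k, (Y r k).re = 0) (n : ℕ)
    (hd : ∀ r ≤ n, ∀ s < r, ∀ p < r, s ≠ p → Y r s ≠ Y r p) (a : ℕ → ℂ) :
    ∑ j ∈ Finset.Icc 1 n, pathSum Y j n a =
      ((∑ l ∈ Finset.range n, Y n l - ∑ m ∈ Finset.range (n + 1), (a m - 1 / 2)) ^ 2 +
        ∑ l ∈ Finset.range n, Y n l ^ 2 - ∑ m ∈ Finset.range (n + 1), (a m - 1 / 2) ^ 2) / 2 := by
  have hinj : Set.InjOn (Y n) (Finset.range n) := by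
    intro i hi j hj h
    simp only [Finset.coe_range, Set.mem_Iio] at hi hj
    by_contra hne
    exact hd n le_rfl i hi j hj hne h
  rw [← (divDiff_prod (Finset.range (n + 1)) (fun m => a m - 1 / 2) (Finset.range n) (Y n)
    hinj).2.2.2 (by simp)]
  unfold pathSum divDiff
  rw [Finset.sum_comm]
  refine Finset.sum_congr rfl fun l hl => ?_
  rw [← Finset.mul_sum, sum_pathAmp hre n hd l (Finset.mem_range.1 hl), mul_one_div]
  simp only [← sub_add]

/-- The diagonal part of the quadratic Casimir element of `gl_{n+1}` relative to `gl_n`. -/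
theorem sum_pathSum_add_neg (hre : ∀ r k, (Y r k).re = 0) (n : ℕ)
    (hd : ∀ r ≤ n, ∀ s < r, ∀ p < r, s ≠ p → Y r s ≠ Y r p) (a : ℕ → ℂ) :
    ∑ j ∈ Finset.Icc 1 n, (pathSum Y j n a + pathSum (-Y) j n (-a)) =
      (∑ m ∈ Finset.range (n + 1), a m - ∑ l ∈ Finset.range n, Y n l) ^ 2 +
        ∑ l ∈ Finset.range n, Y n l ^ 2 - ∑ m ∈ Finset.range (n + 1), a m ^ 2 +
        n * (n + 1) / 4 := by
  rw [Finset.sum_add_distrib, sum_pathSum hre n hd, sum_pathSum (Y := -Y) (by simp [hre]) n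
    (fun r hr s hs p hp h => by simpa using hd r hr s hs p hp h)]
  have e1 : ∀ m, (a m - 1 / 2) ^ 2 = a m ^ 2 - a m + 1 / 4 := fun m => by ring
  have e2 : ∀ m, ((-a) m - 1 / 2) ^ 2 = a m ^ 2 + a m + 1 / 4 := fun m => by
    simp only [Pi.neg_apply]; ring
  have e3 : ∀ l, (-Y) n l ^ 2 = Y n l ^ 2 := fun m => by
    simp only [Pi.neg_apply]; ring
  simp only [e1, e2, e3]
  simp only [Pi.neg_apply, Finset.sum_add_distrib, Finset.sum_sub_distrib, Finset.sum_neg_distrib,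
    Finset.sum_const, Finset.card_range, nsmul_eq_mul]
  push_cast
  ring

end Generic

/-! ### Marked kernels -/

/-- The factor of the kernel for two entries in adjacent rows, as a function of the difference `w`
of the entries and the difference `ε ∈ {0, 1, -1}` of their marks. -/
def adjKernel (ε : ℝ) (w : ℂ) : ℂ :=
  if ε = 0 then Complex.Gamma (1 / 4 + w / 2) * Complex.Gamma (1 / 4 - w / 2)
  else 2 * (Complex.Gamma (1 / 4 + ε * w / 2) * Complex.Gamma (5 / 4 - ε * w / 2))

/-- The factor of the kernel for two entries in the same row. -/
def rowKernel (ε : ℝ) (w : ℂ) : ℂ :=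
  if ε = 0 then (Complex.Gamma w * Complex.Gamma (-w))⁻¹
  else (Complex.Gamma (ε * w) * Complex.Gamma (2 - ε * w))⁻¹

/-- The kernel of the array `Z` (with `N` rows) whose marked entries are those with `χ = 1`. For
`χ = 0` this is the weight of the integral representation; with marks it is the weight times a
rational function, see `kernel_eq_mul_ratio`. -/
def kernel (N : ℕ) (χ : ℕ → ℕ → ℝ) (Z : ℕ → ℕ → ℂ) : ℂ :=
  ∏ n ∈ Finset.range N,
    (∏ k ∈ Finset.range n, ∏ m ∈ Finset.range (n + 1),
      adjKernel (χ n k - χ (n + 1) m) (Z n k - Z (n + 1) m)) *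
    ∏ p ∈ Finset.range n, ∏ s ∈ Finset.range p, rowKernel (χ n s - χ n p) (Z n s - Z n p)

/-- The rational counterpart of `adjKernel`. -/
def adjRatio (ε : ℝ) (u : ℂ) : ℂ := if ε = 0 then 1 else ε * u + 1 / 2

/-- The rational counterpart of `rowKernel`. -/
def rowRatio (ε : ℝ) (u : ℂ) : ℂ := if ε = 0 then 1 else (ε * u * (ε * u + 1))⁻¹

/-- The factor of `ratio` for the rows `n` and `n + 1`. -/
def adjRatioProd (χ : ℕ → ℕ → ℝ) (Y : ℕ → ℕ → ℂ) (n : ℕ) : ℂ :=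
  ∏ k ∈ Finset.range n, ∏ m ∈ Finset.range (n + 1),
    adjRatio (χ n k - χ (n + 1) m) (Y n k - Y (n + 1) m)

/-- The factor of `ratio` for row `n`. -/
def rowRatioProd (χ : ℕ → ℕ → ℝ) (Y : ℕ → ℕ → ℂ) (n : ℕ) : ℂ :=
  ∏ p ∈ Finset.range n, ∏ s ∈ Finset.range p, rowRatio (χ n s - χ n p) (Y n s - Y n p)

/-- The rational function that distinguishes a marked kernel from the unmarked one. -/
def ratio (N : ℕ) (χ : ℕ → ℕ → ℝ) (Y : ℕ → ℕ → ℂ) : ℂ :=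
  ∏ n ∈ Finset.range N, adjRatioProd χ Y n * rowRatioProd χ Y n

/-- The possible differences of two marks. -/
def IsMarkDiff (ε : ℝ) : Prop := ε = 0 ∨ ε = 1 ∨ ε = -1

theorem isMarkDiff_sub {c d : ℝ} (hc : c = 0 ∨ c = 1) (hd : d = 0 ∨ d = 1) :
    IsMarkDiff (c - d) := by
  rcases hc with rfl | rfl <;> rcases hd with rfl | rfl <;> norm_num [IsMarkDiff]

section Factors

variable {ε : ℝ} (hε : IsMarkDiff ε) {w : ℂ}

include hε in
theorem IsMarkDiff.mul_self (h0 : ε ≠ 0) : (ε : ℂ) * ε = 1 := by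
  rcases hε with rfl | rfl | rfl
  · exact absurd rfl h0
  · norm_num
  · norm_num

include hε in
theorem gamma_mul_gamma_mark (h0 : ε ≠ 0) :
    Complex.Gamma (1 / 4 + ε * w / 2) * Complex.Gamma (1 / 4 - ε * w / 2) =
      Complex.Gamma (1 / 4 + w / 2) * Complex.Gamma (1 / 4 - w / 2) := by
  rcases hε with rfl | rfl | rfl
  · exact absurd rfl h0
  · simp
  · rw [mul_comm]
    congr 2 <;> push_cast <;> ring

include hε in
theorem gamma_mul_gamma_neg_mark (h0 : ε ≠ 0) :
    Complex.Gamma (ε * w) * Complex.Gamma (-(ε * w)) =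
      Complex.Gamma w * Complex.Gamma (-w) := by
  rcases hε with rfl | rfl | rfl
  · exact absurd rfl h0
  · simp
  · rw [mul_comm]
    congr 2 <;> push_cast <;> ring

theorem quarter_add_ne (hw : w.re = 0) (c : ℝ) : (1 / 4 + c * w / 2 : ℂ) ≠ 0 := by
  intro h
  have := congrArg Complex.re h
  simp [hw] at this

include hε in
theorem adjKernel_eq (hw : w.re = 0) :
    adjKernel ε w = adjKernel 0 w * adjRatio ε (-w) := by
  by_cases h0 : ε = 0
  · simp [adjRatio, h0]
  · rw [adjKernel, adjKernel, adjRatio, if_neg h0, if_neg h0, if_pos rfl,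
      ← gamma_mul_gamma_mark hε h0]
    have hne : (1 / 4 - ε * w / 2 : ℂ) ≠ 0 := by
      have := quarter_add_ne hw (-ε)
      convert this using 1
      push_cast; ring
    rw [show (5 / 4 - ε * w / 2 : ℂ) = (1 / 4 - ε * w / 2) + 1 by ring,
      Complex.Gamma_add_one _ hne]
    ring

include hε in
theorem adjKernel_add_eq (hw : w.re = 0) :
    adjKernel ε (w + 2 * ε) = adjKernel 0 w * adjRatio ε w := by
  by_cases h0 : ε = 0
  · simp [adjRatio, h0]
  · rw [adjKernel, adjKernel, adjRatio, if_neg h0, if_neg h0, if_pos rfl,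
      ← gamma_mul_gamma_mark hε h0]
    have h1 := hε.mul_self h0
    rw [show (1 / 4 + ε * (w + 2 * ε) / 2 : ℂ) = (1 / 4 + ε * w / 2) + 1 by linear_combination h1,
      show (5 / 4 - ε * (w + 2 * ε) / 2 : ℂ) = 1 / 4 - ε * w / 2 by linear_combination -h1,
      Complex.Gamma_add_one _ (quarter_add_ne hw ε)]
    ring

theorem inv_gamma_shift {z : ℂ} (h0 : z ≠ 0) (h1 : z ≠ 1) :
    (Complex.Gamma z * Complex.Gamma (2 - z))⁻¹ =
      (Complex.Gamma z * Complex.Gamma (-z))⁻¹ * (-z * (-z + 1))⁻¹ := by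
  rw [show (2 : ℂ) - z = (-z + 1) + 1 by ring, Complex.Gamma_add_one (-z + 1) (fun h => h1 (by
    linear_combination -h)), Complex.Gamma_add_one (-z) (neg_ne_zero.2 h0), ← mul_inv]
  congr 1
  ring

include hε in
theorem rowKernel_eq (hw : w.re = 0) (hw0 : w ≠ 0) :
    rowKernel ε w = rowKernel 0 w * rowRatio ε (-w) := by
  by_cases h0 : ε = 0
  · simp [rowRatio, h0]
  · rw [rowKernel, rowKernel, rowRatio, if_neg h0, if_neg h0, if_pos rfl,
      ← gamma_mul_gamma_neg_mark hε h0, inv_gamma_shift]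
    · simp only [mul_neg]
    · exact mul_ne_zero (Complex.ofReal_ne_zero.2 h0) hw0
    · intro h
      have := congrArg Complex.re h
      simp [hw] at this

include hε in
theorem rowKernel_add_eq (hw : w.re = 0) (hw0 : w ≠ 0) :
    rowKernel ε (w + 2 * ε) = rowKernel 0 w * rowRatio ε w := by
  by_cases h0 : ε = 0
  · simp [rowRatio, h0]
  · rw [rowKernel, rowKernel, rowRatio, if_neg h0, if_neg h0, if_pos rfl,
      ← gamma_mul_gamma_neg_mark hε h0]
    have h1 := hε.mul_self h0
    have hne : (ε * w : ℂ) ≠ 0 := mul_ne_zero (Complex.ofReal_ne_zero.2 h0) hw0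
    have hne1 : -(ε * w : ℂ) ≠ 1 := by
      intro h
      have := congrArg Complex.re h
      simp [hw] at this
    have := inv_gamma_shift (neg_ne_zero.2 hne) hne1
    rw [neg_neg] at this
    rw [show (ε * (w + 2 * ε) : ℂ) = 2 - -(ε * w) by linear_combination 2 * h1, sub_sub_cancel,
      mul_comm (Complex.Gamma (2 - _)), this, mul_comm (Complex.Gamma (-(ε * w)))]

end Factors

section KernelRatio

variable {N : ℕ} {χ : ℕ → ℕ → ℝ} {Z : ℕ → ℕ → ℂ}

/-- A marked kernel is the unmarked one times `ratio` at `-Z`. -/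
theorem kernel_eq_mul_ratio (hχ : ∀ n k, χ n k = 0 ∨ χ n k = 1) (hre : ∀ n k, (Z n k).re = 0)
    (hd : ∀ r < N, ∀ s < r, ∀ p < r, s ≠ p → Z r s ≠ Z r p) :
    kernel N χ Z = kernel N 0 Z * ratio N χ (-Z) := by
  unfold kernel ratio adjRatioProd rowRatioProd
  rw [← Finset.prod_mul_distrib]
  refine Finset.prod_congr rfl fun n hn => ?_
  rw [mul_mul_mul_comm]
  congr 1
  · rw [← Finset.prod_mul_distrib]
    refine Finset.prod_congr rfl fun k _ => ?_
    rw [← Finset.prod_mul_distrib]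
    refine Finset.prod_congr rfl fun m _ => ?_
    rw [adjKernel_eq (isMarkDiff_sub (hχ _ _) (hχ _ _)) (by simp [hre])]
    simp only [Pi.zero_apply, sub_self, Pi.neg_apply]
    congr 2
    ring
  · rw [← Finset.prod_mul_distrib]
    refine Finset.prod_congr rfl fun p hp => ?_
    rw [← Finset.prod_mul_distrib]
    refine Finset.prod_congr rfl fun s hs => ?_
    rw [Finset.mem_range] at hn hp hs
    rw [rowKernel_eq (isMarkDiff_sub (hχ _ _) (hχ _ _)) (by simp [hre])
      (sub_ne_zero.2 (hd n hn s (hs.trans hp) p hp hs.ne))]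
    simp only [Pi.zero_apply, sub_self, Pi.neg_apply]
    congr 2
    ring

/-- Moving the marked entries by `2` turns the factor `ratio (-Z)` into `ratio Z`. -/
theorem kernel_add_eq_mul_ratio (hχ : ∀ n k, χ n k = 0 ∨ χ n k = 1) (hre : ∀ n k, (Z n k).re = 0)
    (hd : ∀ r < N, ∀ s < r, ∀ p < r, s ≠ p → Z r s ≠ Z r p) :
    kernel N χ (fun n k => Z n k + 2 * χ n k) = kernel N 0 Z * ratio N χ Z := by
  unfold kernel ratio adjRatioProd rowRatioProd
  rw [← Finset.prod_mul_distrib]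
  refine Finset.prod_congr rfl fun n hn => ?_
  rw [mul_mul_mul_comm]
  have e : ∀ a b : ℂ, ∀ c d : ℝ, a + 2 * c - (b + 2 * d) = a - b + 2 * ((c - d : ℝ) : ℂ) := by
    intro a b c d
    push_cast
    ring
  congr 1
  · rw [← Finset.prod_mul_distrib]
    refine Finset.prod_congr rfl fun k _ => ?_
    rw [← Finset.prod_mul_distrib]
    refine Finset.prod_congr rfl fun m _ => ?_
    rw [e, adjKernel_add_eq (isMarkDiff_sub (hχ _ _) (hχ _ _)) (by simp [hre])]
    simp only [Pi.zero_apply, sub_self]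
  · rw [← Finset.prod_mul_distrib]
    refine Finset.prod_congr rfl fun p hp => ?_
    rw [← Finset.prod_mul_distrib]
    refine Finset.prod_congr rfl fun s hs => ?_
    rw [Finset.mem_range] at hn hp hs
    rw [e, rowKernel_add_eq (isMarkDiff_sub (hχ _ _) (hχ _ _)) (by simp [hre])
      (sub_ne_zero.2 (hd n hn s (hs.trans hp) p hp hs.ne))]
    simp only [Pi.zero_apply, sub_self]

end KernelRatio

/-! ### Path sums as sums over markings -/

section Marks

variable {χ : ℕ → ℕ → ℝ} {Y : ℕ → ℕ → ℂ}

theorem adjRatio_one (u : ℂ) : adjRatio 1 u = u + 1 / 2 := by simp [adjRatio]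

theorem adjRatio_neg_one (u : ℂ) : adjRatio (-1) u = -u + 1 / 2 := by simp [adjRatio]

theorem adjRatio_zero (u : ℂ) : adjRatio 0 u = 1 := by simp [adjRatio]

theorem rowRatioProd_unmarked {n : ℕ} (h : ∀ m, χ n m = 0) : rowRatioProd χ Y n = 1 :=
  Finset.prod_eq_one fun p _ => Finset.prod_eq_one fun s _ => by simp [h, rowRatio]

theorem adjRatioProd_unmarked {n : ℕ} (h : ∀ m, χ n m = 0) (h' : ∀ m, χ (n + 1) m = 0) :
    adjRatioProd χ Y n = 1 :=
  Finset.prod_eq_one fun p _ => Finset.prod_eq_one fun s _ => by simp [h, h', adjRatio]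

theorem rowRatioProd_marked {n l : ℕ} (hl : l < n) (h : ∀ m, χ n m = if m = l then 1 else 0) :
    rowRatioProd χ Y n = (∏ s ∈ Finset.range n, if s = l then 1 else
      (Y n l - Y n s) * (Y n l - Y n s + 1))⁻¹ := by
  have key : ∀ t, ∏ p ∈ Finset.range t, ∏ s ∈ Finset.range p,
      rowRatio (χ n s - χ n p) (Y n s - Y n p) = if l < t then (∏ s ∈ Finset.range t,
        if s = l then 1 else (Y n l - Y n s) * (Y n l - Y n s + 1))⁻¹ else 1 := by
    intro t
    induction t with
    | zero => simp
    | succ t ih =>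
      rw [Finset.prod_range_succ, ih, Finset.prod_range_succ _ t]
      simp only [h]
      rcases lt_trichotomy l t with hlt | rfl | hlt
      · rw [if_pos hlt, if_pos (show l < t + 1 by omega), if_neg hlt.ne', if_neg hlt.ne', mul_inv]
        congr 1
        rw [Finset.prod_eq_single l]
        · simp [rowRatio]
        · intro s _ hs
          simp [hs, rowRatio]
        · intro hs
          exact absurd (Finset.mem_range.2 hlt) hs
      · rw [if_neg (lt_irrefl _), if_pos (Nat.lt_succ_self _), one_mul, if_pos rfl, if_pos rfl,
          mul_one, ← Finset.prod_inv_distrib]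
        refine Finset.prod_congr rfl fun s hs => ?_
        rw [Finset.mem_range] at hs
        rw [if_neg hs.ne, if_neg hs.ne, rowRatio, if_neg (by norm_num)]
        congr 1
        push_cast
        ring
      · rw [if_neg (show ¬l < t by omega), if_neg (show ¬l < t + 1 by omega), one_mul]
        refine Finset.prod_eq_one fun s hs => ?_
        rw [Finset.mem_range] at hs
        rw [if_neg (by omega), if_neg (by omega)]
        simp [rowRatio]
  have := key n
  rwa [if_pos hl] at this

theorem adjRatioProd_marked {n k l : ℕ} (hk : k < n) (hl : l < n + 1)
    (h : ∀ m, χ n m = if m = k then 1 else 0) (h' : ∀ m, χ (n + 1) m = if m = l then 1 else 0) :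
    adjRatioProd χ Y n =
      (∏ m ∈ Finset.range n, if m = k then 1 else (Y (n + 1) l - Y n m + 1 / 2)) *
      (∏ m ∈ Finset.range (n + 1), if m = l then 1 else (Y n k - Y (n + 1) m + 1 / 2)) := by
  have hrow : ∀ i, ∏ m ∈ Finset.range (n + 1), adjRatio (χ n i - χ (n + 1) m)
      (Y n i - Y (n + 1) m) = (if i = k then 1 else (Y (n + 1) l - Y n i + 1 / 2)) *
      if i = k then (∏ m ∈ Finset.range (n + 1), if m = l then 1 else
        (Y n k - Y (n + 1) m + 1 / 2)) else 1 := by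
    intro i
    simp only [h, h']
    by_cases hi : i = k
    · subst hi
      simp only [if_true, one_mul]
      refine Finset.prod_congr rfl fun m _ => ?_
      split_ifs with hm
      · rw [sub_self, adjRatio_zero]
      · rw [sub_zero, adjRatio_one]
    · simp only [if_neg hi, mul_one]
      rw [Finset.prod_eq_single l]
      · rw [if_pos rfl, zero_sub, adjRatio_neg_one]; ring
      · intro m _ hm
        rw [if_neg hm, sub_zero, adjRatio_zero]
      · intro hs
        exact absurd (Finset.mem_range.2 hl) hs
  rw [adjRatioProd, Finset.prod_congr rfl fun i _ => hrow i, Finset.prod_mul_distrib,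
    Finset.prod_ite_eq', if_pos (Finset.mem_range.2 hk)]

theorem adjRatioProd_marked_top {n l : ℕ} (hl : l < n + 1)
    (h : ∀ m, χ n m = 0) (h' : ∀ m, χ (n + 1) m = if m = l then 1 else 0) :
    adjRatioProd χ Y n = ∏ m ∈ Finset.range n, (Y (n + 1) l - Y n m + 1 / 2) := by
  refine Finset.prod_congr rfl fun i _ => ?_
  simp only [h, h']
  rw [Finset.prod_eq_single l]
  · rw [if_pos rfl, zero_sub, adjRatio_neg_one]; ring
  · intro m _ hm
    rw [if_neg hm, sub_zero, adjRatio_zero]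
  · intro hs
    exact absurd (Finset.mem_range.2 hl) hs

theorem adjRatioProd_marked_bot {n k : ℕ} (hk : k < n)
    (h : ∀ m, χ n m = if m = k then 1 else 0) (h' : ∀ m, χ (n + 1) m = 0) :
    adjRatioProd χ Y n = ∏ m ∈ Finset.range (n + 1), (Y n k - Y (n + 1) m + 1 / 2) := by
  rw [adjRatioProd, Finset.prod_eq_single k]
  · refine Finset.prod_congr rfl fun m _ => ?_
    rw [h, h', if_pos rfl, sub_zero, adjRatio_one]
  · intro i _ hi
    refine Finset.prod_eq_one fun m _ => ?_
    rw [h, h', if_neg hi, sub_zero, adjRatio_zero]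
  · intro hs
    exact absurd (Finset.mem_range.2 hk) hs

end Marks

/-- The marking `χ` has exactly one marked entry in each of the rows `j, …, n`, and no others. -/
structure IsPathMark (j n : ℕ) (χ : ℕ → ℕ → ℝ) : Prop where
  zero_or_one : ∀ r m, χ r m = 0 ∨ χ r m = 1
  eq_zero : ∀ r m, ¬(j ≤ r ∧ r ≤ n ∧ m < r) → χ r m = 0
  sum_eq_one : ∀ r, j ≤ r → r ≤ n → ∑ m ∈ Finset.range r, χ r m = 1

theorem adjRatioProd_congr {χ χ' : ℕ → ℕ → ℝ} {Y : ℕ → ℕ → ℂ} {n : ℕ} (h : χ n = χ' n)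
    (h' : χ (n + 1) = χ' (n + 1)) : adjRatioProd χ Y n = adjRatioProd χ' Y n := by
  unfold adjRatioProd
  rw [h, h']

theorem rowRatioProd_congr {χ χ' : ℕ → ℕ → ℝ} {Y : ℕ → ℕ → ℂ} {n : ℕ} (h : χ n = χ' n) :
    rowRatioProd χ Y n = rowRatioProd χ' Y n := by
  unfold rowRatioProd
  rw [h]

theorem exists_pathAmp_eq_sum {j n : ℕ} (hj : 1 ≤ j) (hjn : j ≤ n) : ∀ l < n,
    ∃ (ι : Type) (_ : Fintype ι) (χ : ι → ℕ → ℕ → ℝ), (∀ i, IsPathMark j n (χ i)) ∧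
      (∀ i m, χ i n m = if m = l then 1 else 0) ∧
      ∀ Y : ℕ → ℕ → ℂ, pathAmp Y j n l = ∑ i, (∏ r ∈ Finset.range n, adjRatioProd (χ i) Y r) *
        ∏ r ∈ Finset.range (n + 1), rowRatioProd (χ i) Y r := by
  induction n, hjn using Nat.le_induction with
  | base =>
    intro l hl
    obtain ⟨q, rfl⟩ : ∃ q, j = q + 1 := ⟨j - 1, by omega⟩
    refine ⟨Unit, inferInstance, fun _ r m => if r = q + 1 ∧ m = l then 1 else 0,
      fun _ => ⟨fun r m => ?_, fun r m hrm => ?_, fun r h1 h2 => ?_⟩, fun _ m => ?_, fun Y => ?_⟩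
    · dsimp only
      split_ifs <;> simp
    · refine if_neg ?_
      rintro ⟨rfl, rfl⟩
      exact hrm ⟨le_rfl, le_rfl, hl⟩
    · obtain rfl : r = q + 1 := le_antisymm h2 h1
      simp [hl]
    · simp
    · simp only [Finset.univ_unique, Finset.sum_singleton]
      rw [Finset.prod_range_succ _ q, Finset.prod_range_succ _ (q + 1),
        Finset.prod_eq_one fun r hr => adjRatioProd_unmarked
          (fun m => if_neg fun h => by rw [Finset.mem_range] at hr; omega)
          (fun m => if_neg fun h => by rw [Finset.mem_range] at hr; omega),
        Finset.prod_eq_one fun r hr => rowRatioProd_unmarked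
          (fun m => if_neg fun h => by rw [Finset.mem_range] at hr; omega),
        adjRatioProd_marked_top hl (fun m => if_neg (by omega)) (fun m => by simp),
        rowRatioProd_marked hl (fun m => by simp), pathAmp, if_pos rfl,
        Finset.sum_eq_zero fun k _ => by rw [pathAmp_of_lt _ _ _ _ (Nat.lt_succ_self q), mul_zero]]
      rw [add_zero, one_mul, one_mul, div_eq_mul_inv]
  | succ q hjq ih =>
    intro l hl
    choose ι fι χ hχ htop hamp using ih
    let χ' : (Σ k : Fin q, ι k k.2) → ℕ → ℕ → ℝ := fun i =>
      Function.update (χ i.1 i.1.2 i.2) (q + 1) (fun m => if m = l then 1 else 0)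
    have hχ'lt : ∀ i, ∀ r, r ≠ q + 1 → χ' i r = χ i.1 i.1.2 i.2 r := fun i r hr =>
      Function.update_of_ne hr _ _
    have hχ'top : ∀ i, χ' i (q + 1) = fun m => if m = l then 1 else 0 := fun i =>
      Function.update_self ..
    refine ⟨Σ k : Fin q, ι k k.2, inferInstance, χ', fun i => ⟨fun r m => ?_, fun r m hrm => ?_,
      fun r h1 h2 => ?_⟩, fun i m => by rw [hχ'top], fun Y => ?_⟩
    · by_cases hr : r = q + 1
      · subst hr
        rw [hχ'top]
        dsimp only
        split_ifs <;> simp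
      · rw [hχ'lt i r hr]
        exact (hχ i.1 i.1.2 i.2).zero_or_one r m
    · by_cases hr : r = q + 1
      · subst hr
        rw [hχ'top]
        refine if_neg ?_
        rintro rfl
        exact hrm ⟨by omega, le_rfl, hl⟩
      · rw [hχ'lt i r hr]
        exact (hχ i.1 i.1.2 i.2).eq_zero r m (fun h => hrm ⟨h.1, by omega, h.2.2⟩)
    · by_cases hr : r = q + 1
      · subst hr
        rw [hχ'top]
        simp [hl]
      · rw [hχ'lt i r hr]
        exact (hχ i.1 i.1.2 i.2).sum_eq_one r h1 (by omega)
    · rw [pathAmp, if_neg (by omega), zero_add, Fintype.sum_sigma, Finset.sum_div,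
        ← Fin.sum_univ_eq_sum_range (fun k =>
          (∏ m ∈ Finset.range q, if m = k then 1 else (Y (q + 1) l - Y q m + 1 / 2)) *
          (∏ m ∈ Finset.range (q + 1), if m = l then 1 else (Y q k - Y (q + 1) m + 1 / 2)) *
          pathAmp Y j q k / ∏ s ∈ Finset.range (q + 1), if s = l then 1 else
            (Y (q + 1) l - Y (q + 1) s) * (Y (q + 1) l - Y (q + 1) s + 1)) q]
      refine Finset.sum_congr rfl fun k _ => ?_
      rw [hamp k k.2 Y, Finset.mul_sum, Finset.sum_div]
      refine Finset.sum_congr rfl fun i _ => ?_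
      rw [Finset.prod_range_succ (adjRatioProd (χ' ⟨k, i⟩) Y) q,
        Finset.prod_range_succ (rowRatioProd (χ' ⟨k, i⟩) Y) (q + 1)]
      have e1 : ∏ r ∈ Finset.range q, adjRatioProd (χ' ⟨k, i⟩) Y r =
          ∏ r ∈ Finset.range q, adjRatioProd (χ k k.2 i) Y r := by
        refine Finset.prod_congr rfl fun r hr => ?_
        rw [Finset.mem_range] at hr
        exact adjRatioProd_congr (hχ'lt ⟨k, i⟩ r (by omega)) (hχ'lt ⟨k, i⟩ (r + 1) (by omega))
      have e2 : ∏ r ∈ Finset.range (q + 1), rowRatioProd (χ' ⟨k, i⟩) Y r =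
          ∏ r ∈ Finset.range (q + 1), rowRatioProd (χ k k.2 i) Y r := by
        refine Finset.prod_congr rfl fun r hr => ?_
        rw [Finset.mem_range] at hr
        exact rowRatioProd_congr (hχ'lt ⟨k, i⟩ r (by omega))
      rw [e1, e2, rowRatioProd_marked hl (fun m => by rw [hχ'top]),
        adjRatioProd_marked k.2 hl (fun m => by rw [hχ'lt _ _ (by simp), htop])
          (fun m => by rw [hχ'top]), div_eq_mul_inv]
      ring

/-- The path sum in the rows `j, …, n` is a sum of functions `ratio` over path markings. -/
theorem exists_pathSum_eq_sum {j n N : ℕ} (hj : 1 ≤ j) (hjn : j ≤ n) (hnN : n < N) :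
    ∃ (ι : Type) (_ : Fintype ι) (χ : ι → ℕ → ℕ → ℝ), (∀ i, IsPathMark j n (χ i)) ∧
      ∀ Y : ℕ → ℕ → ℂ, pathSum Y j n (Y (n + 1)) = ∑ i, ratio N (χ i) Y := by
  choose ι fι χ hχ htop hamp using exists_pathAmp_eq_sum hj hjn
  refine ⟨Σ l : Fin n, ι l l.2, inferInstance, fun i => χ i.1 i.1.2 i.2,
    fun i => hχ i.1 i.1.2 i.2, fun Y => ?_⟩
  rw [pathSum, Fintype.sum_sigma, ← Fin.sum_univ_eq_sum_range (fun l =>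
    (∏ m ∈ Finset.range (n + 1), (Y n l - Y (n + 1) m + 1 / 2)) * pathAmp Y j n l) n]
  refine Finset.sum_congr rfl fun l _ => ?_
  rw [hamp l l.2 Y, Finset.mul_sum]
  refine Finset.sum_congr rfl fun i _ => ?_
  have hz : ∀ r, n < r → ∀ m, χ l l.2 i r m = 0 := fun r hr m =>
    (hχ l l.2 i).eq_zero r m (by omega)
  change _ = ratio N (χ l l.2 i) Y
  rw [ratio, Finset.prod_mul_distrib,
    ← Finset.prod_range_mul_prod_Ico (adjRatioProd (χ l l.2 i) Y) (show n + 1 ≤ N by omega),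
    ← Finset.prod_range_mul_prod_Ico (rowRatioProd (χ l l.2 i) Y) (show n + 1 ≤ N by omega),
    Finset.prod_eq_one (s := Finset.Ico (n + 1) N) fun r hr => by
      rw [Finset.mem_Ico] at hr
      exact adjRatioProd_unmarked (hz r (by omega)) (hz (r + 1) (by omega)),
    Finset.prod_eq_one (s := Finset.Ico (n + 1) N) fun r hr => by
      rw [Finset.mem_Ico] at hr
      exact rowRatioProd_unmarked (hz r (by omega)),
    Finset.prod_range_succ (adjRatioProd (χ l l.2 i) Y) n,
    adjRatioProd_marked_bot l.2 (htop l l.2 i) (hz (n + 1) (by omega))]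
  ring

/-! ### The kernel as a function of the integration variables -/

/-- The triangular array in the variables `γ / (iħ)`. -/
def scaledArray {N : ℕ} (ħ : ℝ) (a : Fin N → ℝ) (γ : Tri N → ℝ) (n k : ℕ) : ℂ :=
  ((entry a γ n k : ℝ) : ℂ) / (Complex.I * (ħ : ℂ))

/-- The difference of the sums of the rows `i + 1` and `i`: the eigenvalue of `E_{i+1,i+1}`. -/
def rowSumDiff (N : ℕ) (Z : ℕ → ℕ → ℂ) (i : ℕ) : ℂ :=
  ∑ j ∈ Finset.range N, (Z (i + 1) j - Z i j)

/-- The exponential factor `exp (-∑ xᵢ E_{i+1,i+1})` of the integrand. -/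
def phase {N : ℕ} (x : Fin N → ℝ) (Z : ℕ → ℕ → ℂ) : ℂ :=
  Complex.exp (-∑ i : Fin N, (x i : ℂ) * rowSumDiff N Z i)

section Entry

variable {N : ℕ} (ħ : ℝ) (a : Fin N → ℝ) (γ : Tri N → ℝ)

theorem entry_add_smul (b : Tri N → ℝ) (c : ℝ) (n k : ℕ) :
    entry a (γ + c • b) n k = entry a γ n k + c * entry 0 b n k := by
  unfold entry
  split_ifs <;> simp

theorem abs_entry_le (n k : ℕ) : |entry a γ n k| ≤ ‖γ‖ + ‖a‖ := by
  have h1 := norm_nonneg γ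
  have h2 := norm_nonneg a
  unfold entry
  split_ifs with hk hn hN
  · have := norm_le_pi_norm γ ⟨⟨n, hn⟩, ⟨k, hk⟩⟩
    rw [Real.norm_eq_abs] at this
    linarith
  · have := norm_le_pi_norm a ⟨k, lt_of_lt_of_eq hk hN⟩
    rw [Real.norm_eq_abs] at this
    linarith
  · simp; linarith
  · simp; linarith

theorem entry_eq_zero {α : Type*} [Zero α] (a : Fin N → α) (γ : Tri N → α) {n k : ℕ} (h : n ≤ k) :
    entry a γ n k = 0 := dif_neg (by omega)

theorem entry_of_lt {α : Type*} [Zero α] (a : Fin N → α) (γ : Tri N → α) {n k : ℕ} (hn : n < N)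
    (hk : k < n) : entry a γ n k = γ ⟨⟨n, hn⟩, ⟨k, hk⟩⟩ := by
  rw [entry, dif_pos hk, dif_pos hn]

theorem entry_top {α : Type*} [Zero α] (a : Fin N → α) (γ : Tri N → α) (m : Fin N) :
    entry a γ N m = a m := by
  rw [entry, dif_pos m.2, dif_neg (lt_irrefl N), dif_pos rfl]

variable {ħ}

theorem scaledArray_re (n k : ℕ) : (scaledArray ħ a γ n k).re = 0 := by
  simp [scaledArray, Complex.div_re]

theorem scaledArray_im (n k : ℕ) : (scaledArray ħ a γ n k).im = -(entry a γ n k / ħ) := by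
  rw [scaledArray, ← div_div, Complex.div_I, ← neg_mul, ← neg_div, mul_div_right_comm, neg_div,
    ← Complex.ofReal_div]
  simp [neg_div]

variable {a} {γ} in
theorem conj_scaledArray (n k : ℕ) :
    (starRingEnd ℂ) (scaledArray ħ a γ n k) = -scaledArray ħ a γ n k := by
  apply Complex.ext <;> simp [scaledArray_re]

end Entry

theorem prod_range_eq_prod_Ico_one {M : Type*} [CommMonoid M] (f : ℕ → M) (h0 : f 0 = 1) (N : ℕ) :
    ∏ n ∈ Finset.range N, f n = ∏ n ∈ Finset.Ico 1 N, f n := by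
  rcases Nat.eq_zero_or_pos N with rfl | hN
  · simp
  · rw [Finset.range_eq_Ico, Finset.prod_eq_prod_Ico_succ_bot hN, h0, one_mul]

theorem sum_range_eq_sum_Ico_one (f : ℕ → ℝ) (h0 : f 0 = 0) (N : ℕ) :
    ∑ n ∈ Finset.range N, f n = ∑ n ∈ Finset.Ico 1 N, f n := by
  rcases Nat.eq_zero_or_pos N with rfl | hN
  · simp
  · rw [Finset.range_eq_Ico, Finset.sum_eq_sum_Ico_succ_bot hN, h0, zero_add]

theorem weight_eq_kernel {N : ℕ} (ħ : ℝ) (a : Fin N → ℝ) (γ : Tri N → ℝ) :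
    (weight ħ a γ : ℂ) = kernel N 0 (scaledArray ħ a γ) := by
  rw [kernel, prod_range_eq_prod_Ico_one _ (by simp), weight, Complex.ofReal_prod]
  refine Finset.prod_congr rfl fun n _ => ?_
  have hsq : ∀ z : ℂ, ((‖Complex.Gamma z‖ ^ 2 : ℝ) : ℂ) =
      Complex.Gamma z * Complex.Gamma ((starRingEnd ℂ) z) := fun z => by
    rw [Complex.Gamma_conj, Complex.mul_conj, Complex.normSq_eq_norm_sq]
  have hsub : ∀ n k n' k', ((entry a γ n k - entry a γ n' k' : ℝ) : ℂ) / (Complex.I * ħ) =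
      scaledArray ħ a γ n k - scaledArray ħ a γ n' k' := fun n k n' k' => by
    rw [scaledArray, scaledArray, Complex.ofReal_sub, sub_div]
  rw [Complex.ofReal_div, div_eq_mul_inv]
  simp only [Complex.ofReal_prod, hsq, ← Finset.prod_inv_distrib]
  congr 1
  · refine Finset.prod_congr rfl fun k _ => Finset.prod_congr rfl fun m _ => ?_
    have e : ((entry a γ n k - entry a γ (n + 1) m : ℝ) : ℂ) / (2 * Complex.I * ħ) + 1 / 4 =
        1 / 4 + (scaledArray ħ a γ n k - scaledArray ħ a γ (n + 1) m) / 2 := by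
      rw [← hsub, add_comm, mul_assoc, div_div, mul_comm 2 (Complex.I * (ħ : ℂ))]
    rw [e, adjKernel, if_pos (by simp)]
    congr 2
    simp only [map_add, map_div₀, map_sub, conj_scaledArray, map_one, map_ofNat]
    ring
  · refine Finset.prod_congr rfl fun p _ => Finset.prod_congr rfl fun s _ => ?_
    rw [hsub, rowKernel, if_pos (by simp)]
    congr 3
    simp only [map_sub, conj_scaledArray]
    ring

theorem integrand_eq {N : ℕ} (ħ : ℝ) (a x : Fin N → ℝ) (γ : Tri N → ℝ) :
    integrand ħ a x γ = kernel N 0 (scaledArray ħ a γ) * phase x (scaledArray ħ a γ) := by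
  rw [integrand, weight_eq_kernel, phase]
  congr 2
  push_cast
  rw [Finset.mul_sum, ← Finset.sum_neg_distrib]
  refine Finset.sum_congr rfl fun i _ => ?_
  rw [rowSumDiff, Finset.mul_sum, Finset.mul_sum, ← Finset.sum_neg_distrib]
  refine Finset.sum_congr rfl fun j _ => ?_
  simp only [scaledArray, div_eq_mul_inv, mul_inv, Complex.inv_I]
  ring

/-! ### Exponential decay of the kernel -/

theorem exists_norm_adjKernel_le {δ : ℝ} (hδ : 0 < δ) :
    ∃ C : ℝ, 0 < C ∧ ∀ ε : ℝ, IsMarkDiff ε → ∀ t : ℝ, -(1 / 8) ≤ t → t ≤ 17 / 8 → ∀ w : ℂ,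
      w.re = ε * t → ‖adjKernel ε w‖ ≤ C * Real.exp (-((Real.pi / 2 - δ) * |w.im|)) := by
  obtain ⟨C, hC, h⟩ := exists_norm_gamma_le hδ
  refine ⟨2 * C ^ 2, by positivity, fun ε hε t ht1 ht2 w hw => ?_⟩
  have key : ∀ z z' : ℂ, 3 / 16 ≤ z.re → z.re ≤ 3 / 2 → 3 / 16 ≤ z'.re → z'.re ≤ 3 / 2 →
      |z.im| = |w.im| / 2 → |z'.im| = |w.im| / 2 →
      ‖Complex.Gamma z * Complex.Gamma z'‖ ≤
        C ^ 2 * Real.exp (-((Real.pi / 2 - δ) * |w.im|)) := by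
    intro z z' h1 h2 h1' h2' h3 h3'
    rw [norm_mul]
    have e : Real.exp (-((Real.pi / 2 - δ) * |w.im|)) =
        Real.exp (-((Real.pi / 2 - δ) * |z.im|)) * Real.exp (-((Real.pi / 2 - δ) * |z'.im|)) := by
      rw [← Real.exp_add, h3, h3']; congr 1; ring
    calc _ ≤ (C * Real.exp (-((Real.pi / 2 - δ) * |z.im|))) *
          (C * Real.exp (-((Real.pi / 2 - δ) * |z'.im|))) :=
        mul_le_mul (h z h1 h2) (h z' h1' h2') (norm_nonneg _) (by positivity)
      _ = _ := by rw [e]; ring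
  have hpos := Real.exp_pos (-((Real.pi / 2 - δ) * |w.im|))
  by_cases h0 : ε = 0
  · rw [adjKernel, if_pos h0]
    have hw0 : w.re = 0 := by rw [hw, h0, zero_mul]
    have hre : (1 / 4 + w / 2).re = 1 / 4 := by simp [hw0]
    have hre' : (1 / 4 - w / 2).re = 1 / 4 := by simp [hw0]
    refine (key _ _ (by rw [hre]; norm_num) (by rw [hre]; norm_num) (by rw [hre']; norm_num)
      (by rw [hre']; norm_num) ?_ ?_).trans ?_
    · simp [abs_div]
    · simp [abs_div]
    · nlinarith [mul_pos (pow_pos hC 2) hpos]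
  · rw [adjKernel, if_neg h0, norm_mul]
    have h1 : ε * ε = 1 := by exact_mod_cast hε.mul_self h0
    have habs : |ε| = 1 := by
      rcases hε with rfl | rfl | rfl
      · exact absurd rfl h0
      · simp
      · simp
    have hre0 : (ε * w : ℂ).re = t := by
      simp [hw]; rw [← mul_assoc, h1, one_mul]
    have him0 : |(ε * w : ℂ).im| = |w.im| := by simp [abs_mul, habs]
    have hre1 : (ε * w / 2 : ℂ).re = t / 2 := by rw [Complex.div_ofNat_re, hre0]
    have him1 : |(ε * w / 2 : ℂ).im| = |w.im| / 2 := by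
      rw [Complex.div_ofNat_im, abs_div, him0]; norm_num
    have hre : (1 / 4 + ε * w / 2 : ℂ).re = 1 / 4 + t / 2 := by
      rw [Complex.add_re, hre1]; norm_num
    have hre' : (5 / 4 - ε * w / 2 : ℂ).re = 5 / 4 - t / 2 := by
      rw [Complex.sub_re, hre1]; norm_num
    have := key (1 / 4 + ε * w / 2) (5 / 4 - ε * w / 2) (by rw [hre]; linarith)
      (by rw [hre]; linarith) (by rw [hre']; linarith) (by rw [hre']; linarith) ?_ ?_
    · rw [norm_mul] at this
      rw [norm_mul, Complex.norm_ofNat, mul_assoc]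
      exact mul_le_mul_of_nonneg_left this zero_le_two
    · rw [Complex.add_im, show (1 / 4 : ℂ).im = 0 by norm_num, zero_add, him1]
    · rw [Complex.sub_im, show (5 / 4 : ℂ).im = 0 by norm_num, zero_sub, abs_neg, him1]

theorem exists_norm_rowKernel_le {δ : ℝ} (hδ : 0 < δ) :
    ∃ C : ℝ, 0 < C ∧ ∀ ε : ℝ, IsMarkDiff ε → ∀ t : ℝ, ∀ w : ℂ,
      w.re = ε * t → ‖rowKernel ε w‖ ≤ C * Real.exp ((Real.pi + δ) * |w.im|) := by
  obtain ⟨C₁, hC₁, h₁⟩ := exists_norm_inv_gamma_neg_le hδ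
  obtain ⟨C₂, hC₂, h₂⟩ := exists_norm_inv_gamma_two_sub_le
  refine ⟨C₁ + C₂, by positivity, fun ε hε t w hw => ?_⟩
  have hpos := Real.exp_pos ((Real.pi + δ) * |w.im|)
  by_cases h0 : ε = 0
  · rw [rowKernel, if_pos h0]
    have := h₁ w (by rw [hw, h0, zero_mul])
    nlinarith
  · rw [rowKernel, if_neg h0]
    have habs : |ε| = 1 := by
      rcases hε with rfl | rfl | rfl
      · exact absurd rfl h0
      · simp
      · simp
    have him0 : |(ε * w : ℂ).im| = |w.im| := by simp [abs_mul, habs]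
    have := h₂ (ε * w)
    rw [him0] at this
    have hle : Real.exp (Real.pi * |w.im|) ≤ Real.exp ((Real.pi + δ) * |w.im|) := by
      apply Real.exp_le_exp.2
      have := abs_nonneg w.im
      nlinarith
    calc _ ≤ _ := this
      _ ≤ C₂ * Real.exp ((Real.pi + δ) * |w.im|) := by gcongr
      _ ≤ _ := by nlinarith

section Bound

variable {N : ℕ} {ħ : ℝ} (hħ : 0 < ħ) (a : Fin N → ℝ)

/-- The marked kernels at marked entries moved by `t` along the real axis, for `t` in a strip that
contains `[0, 2]`. Apart from a small loss `δ`, the exponent is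
`-(π / 2) (crossDist - 2 rowDist) / ħ`. -/
theorem exists_norm_kernel_le_exp_dist {δ : ℝ} (hδ : 0 < δ) (hħ : 0 < ħ) :
    ∃ C : ℝ, 0 < C ∧ ∀ χ : ℕ → ℕ → ℝ, (∀ n k, χ n k = 0 ∨ χ n k = 1) →
      ∀ t : ℝ, -(1 / 8) ≤ t → t ≤ 17 / 8 → ∀ γ : Tri N → ℝ,
      ‖kernel N χ (fun n k => scaledArray ħ a γ n k + t * χ n k)‖ ≤
        C * Real.exp (-(∑ n ∈ Finset.range N, ((Real.pi / 2 - δ) * crossDist (entry a γ) n -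
          (Real.pi + δ) * rowDist (entry a γ) n)) / ħ) := by
  obtain ⟨C₁, hC₁, h₁⟩ := exists_norm_adjKernel_le hδ
  obtain ⟨C₂, hC₂, h₂⟩ := exists_norm_rowKernel_le hδ
  refine ⟨∏ n ∈ Finset.range N, (∏ k ∈ Finset.range n, ∏ m ∈ Finset.range (n + 1), C₁) *
    ∏ p ∈ Finset.range n, ∏ s ∈ Finset.range p, C₂,
    Finset.prod_pos fun n _ => mul_pos (Finset.prod_pos fun _ _ => Finset.prod_pos fun _ _ => hC₁)
      (Finset.prod_pos fun _ _ => Finset.prod_pos fun _ _ => hC₂), fun χ hχ t ht1 ht2 γ => ?_⟩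
  have hdiff : ∀ n k n' k', (scaledArray ħ a γ n k + t * χ n k -
      (scaledArray ħ a γ n' k' + t * χ n' k')).re = (χ n k - χ n' k') * t ∧
      |(scaledArray ħ a γ n k + t * χ n k - (scaledArray ħ a γ n' k' + t * χ n' k')).im| =
        |entry a γ n k - entry a γ n' k'| / ħ := by
    intro n k n' k'
    constructor
    · simp [scaledArray_re]; ring
    · have : (scaledArray ħ a γ n k + t * χ n k - (scaledArray ħ a γ n' k' + t * χ n' k')).im =
          -((entry a γ n k - entry a γ n' k') / ħ) := by
        simp [scaledArray_im]; ring
      rw [this, abs_neg, abs_div, abs_of_pos hħ]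
  have hexp : Real.exp (-(∑ n ∈ Finset.range N, ((Real.pi / 2 - δ) * crossDist (entry a γ) n -
          (Real.pi + δ) * rowDist (entry a γ) n)) / ħ) =
      ∏ n ∈ Finset.range N, (∏ k ∈ Finset.range n, ∏ m ∈ Finset.range (n + 1),
        Real.exp (-((Real.pi / 2 - δ) * (|entry a γ n k - entry a γ (n + 1) m| / ħ)))) *
        ∏ p ∈ Finset.range n, ∏ s ∈ Finset.range p,
          Real.exp ((Real.pi + δ) * (|entry a γ n s - entry a γ n p| / ħ)) := by
    simp only [← Real.exp_sum, ← Real.exp_add]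
    congr 1
    rw [neg_div, Finset.sum_div, ← Finset.sum_neg_distrib]
    refine Finset.sum_congr rfl fun n _ => ?_
    simp only [Finset.sum_neg_distrib, ← Finset.mul_sum, ← Finset.sum_div, crossDist, rowDist]
    ring
  rw [hexp, ← Finset.prod_mul_distrib, kernel, norm_prod]
  refine Finset.prod_le_prod (fun _ _ => norm_nonneg _) fun n _ => ?_
  rw [norm_mul, mul_mul_mul_comm]
  refine mul_le_mul ?_ ?_ (norm_nonneg _) (by positivity)
  · rw [norm_prod, ← Finset.prod_mul_distrib]
    refine Finset.prod_le_prod (fun _ _ => norm_nonneg _) fun k _ => ?_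
    rw [norm_prod, ← Finset.prod_mul_distrib]
    refine Finset.prod_le_prod (fun _ _ => norm_nonneg _) fun m _ => ?_
    rw [← (hdiff n k (n + 1) m).2]
    exact h₁ _ (isMarkDiff_sub (hχ _ _) (hχ _ _)) t ht1 ht2 _ (hdiff n k (n + 1) m).1
  · rw [norm_prod, ← Finset.prod_mul_distrib]
    refine Finset.prod_le_prod (fun _ _ => norm_nonneg _) fun p _ => ?_
    rw [norm_prod, ← Finset.prod_mul_distrib]
    refine Finset.prod_le_prod (fun _ _ => norm_nonneg _) fun s _ => ?_
    rw [← (hdiff n s n p).2]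
    exact h₂ _ (isMarkDiff_sub (hχ _ _) (hχ _ _)) t _ (hdiff n s n p).1

/-- `abs_le_sum_energy` for the sup norm of the free entries. -/
theorem norm_le_sum_energy (γ : Tri N → ℝ) :
    2 * (‖γ‖ - ‖a‖) ≤ ∑ n ∈ Finset.range N, (crossDist (entry a γ) n - 2 * rowDist (entry a γ) n) := by
  rw [sum_range_eq_sum_Ico_one _ (by simp [crossDist, rowDist])]
  set T := ∑ n ∈ Finset.Ico 1 N, (crossDist (entry a γ) n - 2 * rowDist (entry a γ) n) with hT
  have hA : ∀ m < N, |entry a γ N m| ≤ ‖a‖ := fun m hm => by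
    rw [entry_top a γ ⟨m, hm⟩]
    exact norm_le_pi_norm a ⟨m, hm⟩
  have hT0 : 0 ≤ T / 2 + ‖a‖ := by
    rcases Nat.eq_zero_or_pos N with h | h
    · have : T = 0 := by
        rw [hT, Finset.Ico_eq_empty (by omega), Finset.sum_empty]
      rw [this]
      have := norm_nonneg a
      linarith
    · have h1 := abs_le_sum_energy (entry a γ) N ‖a‖ hA h le_rfl h
      have h2 := abs_nonneg (entry a γ N 0)
      linarith
  have : ‖γ‖ ≤ T / 2 + ‖a‖ := by
    rw [pi_norm_le_iff_of_nonneg hT0]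
    rintro ⟨n, k⟩
    have h1 := abs_le_sum_energy (entry a γ) N ‖a‖ hA (r := n) (k := k)
      (by have := k.2; omega) n.2.le k.2
    rw [entry_of_lt a γ n.2 k.2] at h1
    rw [Real.norm_eq_abs]
    linarith
  linarith

theorem exists_sum_dist_le (N : ℕ) : ∃ K : ℝ, 0 ≤ K ∧ ∀ (a : Fin N → ℝ) (γ : Tri N → ℝ),
    ∑ n ∈ Finset.range N, (crossDist (entry a γ) n + rowDist (entry a γ) n) ≤
      K * (‖γ‖ + ‖a‖) := by
  refine ⟨∑ n ∈ Finset.range N, ((∑ k ∈ Finset.range n, ∑ m ∈ Finset.range (n + 1), (2 : ℝ)) +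
    ∑ p ∈ Finset.range n, ∑ s ∈ Finset.range p, (2 : ℝ)),
    Finset.sum_nonneg fun n _ => add_nonneg (Finset.sum_nonneg fun _ _ => Finset.sum_nonneg
      fun _ _ => zero_le_two) (Finset.sum_nonneg fun _ _ => Finset.sum_nonneg fun _ _ => zero_le_two),
    fun a γ => ?_⟩
  have h : ∀ n k n' k', |entry a γ n k - entry a γ n' k'| ≤ 2 * (‖γ‖ + ‖a‖) := fun n k n' k' => by
    have h1 := abs_entry_le a γ n k
    have h2 := abs_entry_le a γ n' k'
    have h3 := abs_sub (entry a γ n k) (entry a γ n' k')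
    linarith
  rw [Finset.sum_mul]
  refine Finset.sum_le_sum fun n _ => ?_
  rw [add_mul]
  refine add_le_add ?_ ?_
  · rw [crossDist, Finset.sum_mul]
    refine Finset.sum_le_sum fun k _ => ?_
    rw [Finset.sum_mul]
    exact Finset.sum_le_sum fun m _ => h _ _ _ _
  · rw [rowDist, Finset.sum_mul]
    refine Finset.sum_le_sum fun k _ => ?_
    rw [Finset.sum_mul]
    exact Finset.sum_le_sum fun m _ => h _ _ _ _

include hħ in
/-- Exponential decay of the marked kernels, uniform in the strip. -/
theorem exists_norm_kernel_le :
    ∃ C c : ℝ, 0 < C ∧ 0 < c ∧ ∀ χ : ℕ → ℕ → ℝ, (∀ n k, χ n k = 0 ∨ χ n k = 1) →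
      ∀ t : ℝ, -(1 / 8) ≤ t → t ≤ 17 / 8 → ∀ γ : Tri N → ℝ,
      ‖kernel N χ (fun n k => scaledArray ħ a γ n k + t * χ n k)‖ ≤ C * Real.exp (-(c * ‖γ‖)) := by
  obtain ⟨K, hK, hKb⟩ := exists_sum_dist_le N
  have hp := Real.pi_pos
  -- `δ` is so small that the loss `δ K ‖γ‖` costs half of the gain `π ‖γ‖`
  set δ : ℝ := Real.pi / (2 * (K + 1)) with hδ
  have hδ0 : 0 < δ := by positivity
  have hδK : δ * K ≤ Real.pi / 2 := by
    rw [hδ, div_mul_eq_mul_div, div_le_div_iff₀ (by positivity) (by norm_num)]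
    nlinarith
  obtain ⟨C, hC, h⟩ := exists_norm_kernel_le_exp_dist (ħ := ħ) a hδ0 hħ
  refine ⟨C * Real.exp (3 * Real.pi / 2 * ‖a‖ / ħ), Real.pi / 2 / ħ, by positivity, by positivity,
    fun χ hχ t ht1 ht2 γ => (h χ hχ t ht1 ht2 γ).trans ?_⟩
  rw [mul_assoc, ← Real.exp_add]
  gcongr
  have h1 := norm_le_sum_energy a γ
  have h2 := hKb a γ
  have h3 : ∑ n ∈ Finset.range N, ((Real.pi / 2 - δ) * crossDist (entry a γ) n -
          (Real.pi + δ) * rowDist (entry a γ) n) =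
      Real.pi / 2 * (∑ n ∈ Finset.range N,
        (crossDist (entry a γ) n - 2 * rowDist (entry a γ) n)) -
      δ * ∑ n ∈ Finset.range N, (crossDist (entry a γ) n + rowDist (entry a γ) n) := by
    rw [Finset.mul_sum, Finset.mul_sum, ← Finset.sum_sub_distrib]
    refine Finset.sum_congr rfl fun n _ => ?_
    ring
  have h4 : δ * (∑ n ∈ Finset.range N, (crossDist (entry a γ) n + rowDist (entry a γ) n)) ≤
      Real.pi / 2 * (‖γ‖ + ‖a‖) := by
    calc _ ≤ δ * (K * (‖γ‖ + ‖a‖)) := by gcongr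
      _ = δ * K * (‖γ‖ + ‖a‖) := by ring
      _ ≤ _ := by gcongr
  have h5 : Real.pi / 2 * ‖γ‖ - 3 * Real.pi / 2 * ‖a‖ ≤
      ∑ n ∈ Finset.range N, ((Real.pi / 2 - δ) * crossDist (entry a γ) n -
          (Real.pi + δ) * rowDist (entry a γ) n) := by
    rw [h3]
    have := mul_le_mul_of_nonneg_left h1 (show 0 ≤ Real.pi / 2 by positivity)
    linarith
  have h6 : Real.pi / 2 / ħ * ‖γ‖ = Real.pi / 2 * ‖γ‖ / ħ := by ring
  rw [h6, ← sub_eq_add_neg, ← sub_div]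
  exact div_le_div_of_nonneg_right (by linarith) hħ.le

end Bound

theorem integrable_exp_neg_mul_norm {E : Type*} [NormedAddCommGroup E] [NormedSpace ℝ E]
    [FiniteDimensional ℝ E] [MeasurableSpace E] [BorelSpace E] (μ : MeasureTheory.Measure E)
    [μ.IsAddHaarMeasure] {c : ℝ} (hc : 0 < c) :
    MeasureTheory.Integrable (fun v : E => Real.exp (-(c * ‖v‖))) μ := by
  set r : ℕ := Module.finrank ℝ E + 1 with hr
  have h := MeasureTheory.Integrable.const_mul (integrable_one_add_norm (E := E) (μ := μ) (r := r)
    (by rw [hr]; push_cast; linarith)) (Real.exp c * (Nat.factorial r : ℝ) / c ^ r)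
  refine h.mono' (by fun_prop) (Filter.Eventually.of_forall fun v => ?_)
  rw [Real.norm_eq_abs, abs_of_pos (Real.exp_pos _), Real.rpow_neg (by positivity),
    Real.rpow_natCast]
  have h1 := Real.pow_div_factorial_le_exp (c * (1 + ‖v‖)) (by positivity) r
  rw [div_le_iff₀ (by positivity), mul_pow] at h1
  have e : Real.exp (-(c * ‖v‖)) = Real.exp c / Real.exp (c * (1 + ‖v‖)) := by
    rw [← Real.exp_sub]; congr 1; ring
  rw [e, ← div_eq_mul_inv, div_div, div_le_div_iff₀ (by positivity) (by positivity)]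
  have := Real.exp_pos c
  nlinarith [mul_le_mul_of_nonneg_left h1 this.le]

/-! ### Regularity of the kernel -/

section Regularity

/-- The strip has to contain `[0, 2]` and to stay away from the poles of the marked factors, at
real parts `-1 / 2` and `5 / 2`. -/
theorem differentiableAt_adjKernel {ε t : ℝ} (hε : IsMarkDiff ε) (ht1 : -(1 / 8) < t)
    (ht2 : t < 17 / 8) {w : ℂ} (hw : w.re = ε * t) : DifferentiableAt ℂ (adjKernel ε) w := by
  have hG : ∀ f : ℂ → ℂ, DifferentiableAt ℂ f w → 0 < (f w).re →
      DifferentiableAt ℂ (fun z => Complex.Gamma (f z)) w := by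
    intro f hf hre
    refine DifferentiableAt.comp w (Complex.differentiableAt_Gamma _ fun m h => ?_) hf
    rw [h] at hre
    simp at hre
    linarith [Nat.cast_nonneg (α := ℝ) m]
  by_cases h0 : ε = 0
  · have hw0 : w.re = 0 := by rw [hw, h0, zero_mul]
    have : adjKernel ε = fun w => Complex.Gamma (1 / 4 + w / 2) * Complex.Gamma (1 / 4 - w / 2) := by
      funext w; rw [adjKernel, if_pos h0]
    rw [this]
    exact (hG _ (by fun_prop) (by simp [hw0])).mul (hG _ (by fun_prop) (by simp [hw0]))
  · have h1 : ε * ε = 1 := by exact_mod_cast hε.mul_self h0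
    have hre0 : (ε * w / 2 : ℂ).re = t / 2 := by
      rw [Complex.div_ofNat_re]
      congr 1
      simp [hw]; rw [← mul_assoc, h1, one_mul]
    have : adjKernel ε = fun w => 2 * (Complex.Gamma (1 / 4 + ε * w / 2) *
        Complex.Gamma (5 / 4 - ε * w / 2)) := by
      funext w; rw [adjKernel, if_neg h0]
    rw [this]
    have hc1 : (1 / 4 : ℂ).re = 1 / 4 := by norm_num
    have hc2 : (5 / 4 : ℂ).re = 5 / 4 := by norm_num
    refine ((hG _ (by fun_prop) ?_).mul (hG _ (by fun_prop) ?_)).const_mul 2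
    · rw [Complex.add_re, hre0, hc1]; linarith
    · rw [Complex.sub_re, hre0, hc2]; linarith

theorem differentiable_rowKernel (ε : ℝ) : Differentiable ℂ (rowKernel ε) := by
  have hG := Complex.differentiable_one_div_Gamma
  by_cases h0 : ε = 0
  · have : rowKernel ε = fun w => (Complex.Gamma w)⁻¹ * (Complex.Gamma (-w))⁻¹ := by
      funext w; rw [rowKernel, if_pos h0, mul_inv]
    rw [this]
    exact hG.mul (hG.comp (by fun_prop))
  · have : rowKernel ε = fun w => (Complex.Gamma (ε * w))⁻¹ * (Complex.Gamma (2 - ε * w))⁻¹ := by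
      funext w; rw [rowKernel, if_neg h0, mul_inv]
    rw [this]
    exact (hG.comp (f := fun w : ℂ => ε * w) (by fun_prop)).mul
      (hG.comp (f := fun w : ℂ => 2 - ε * w) (by fun_prop))

variable {N : ℕ} (ħ : ℝ) (a x : Fin N → ℝ) (χ : ℕ → ℕ → ℝ)

theorem continuous_scaledArray (n k : ℕ) :
    Continuous fun γ : Tri N → ℝ => scaledArray ħ a γ n k := by
  have : Continuous fun γ : Tri N → ℝ => entry a γ n k := by
    unfold entry
    split_ifs <;> fun_prop
  unfold scaledArray
  fun_prop

/-- The array with entries `Z n k` and marked entries moved by `θ`. -/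
def markShift (θ : ℂ) (Z : ℕ → ℕ → ℂ) : ℕ → ℕ → ℂ := fun n k => Z n k + θ * χ n k

variable {ħ a χ} in
theorem markShift_sub_re (θ : ℂ) (γ : Tri N → ℝ) (n k n' k' : ℕ) :
    (markShift χ θ (scaledArray ħ a γ) n k - markShift χ θ (scaledArray ħ a γ) n' k').re =
      (χ n k - χ n' k') * θ.re := by
  simp [markShift, scaledArray_re]; ring

theorem continuous_kernel (hχ : ∀ n k, χ n k = 0 ∨ χ n k = 1) {θ : ℂ} (h1 : -(1 / 8) < θ.re)
    (h2 : θ.re < 17 / 8) :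
    Continuous fun γ : Tri N → ℝ => kernel N χ (markShift χ θ (scaledArray ħ a γ)) := by
  have hc : ∀ n k, Continuous fun γ : Tri N → ℝ => markShift χ θ (scaledArray ħ a γ) n k :=
    fun n k => (continuous_scaledArray ħ a n k).add continuous_const
  unfold kernel
  refine continuous_finsetProd _ fun n _ => Continuous.mul ?_ ?_
  · refine continuous_finsetProd _ fun k _ => continuous_finsetProd _ fun m _ => ?_
    rw [continuous_iff_continuousAt]
    intro γ
    exact ContinuousAt.comp (f := fun γ : Tri N → ℝ => markShift χ θ (scaledArray ħ a γ) n k -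
        markShift χ θ (scaledArray ħ a γ) (n + 1) m)
      (differentiableAt_adjKernel (isMarkDiff_sub (hχ _ _) (hχ _ _)) h1 h2
        (markShift_sub_re θ γ n k (n + 1) m)).continuousAt ((hc _ _).sub (hc _ _)).continuousAt
  · refine continuous_finsetProd _ fun k _ => continuous_finsetProd _ fun m _ => ?_
    exact (differentiable_rowKernel _).continuous.comp ((hc _ _).sub (hc _ _))

theorem differentiableAt_kernel (hχ : ∀ n k, χ n k = 0 ∨ χ n k = 1) {θ : ℂ}
    (h1 : -(1 / 8) < θ.re) (h2 : θ.re < 17 / 8) (γ : Tri N → ℝ) :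
    DifferentiableAt ℂ (fun θ => kernel N χ (markShift χ θ (scaledArray ħ a γ))) θ := by
  have hc : ∀ n k, Differentiable ℂ fun θ : ℂ => markShift χ θ (scaledArray ħ a γ) n k :=
    fun n k => by unfold markShift; fun_prop
  unfold kernel
  refine DifferentiableAt.fun_finsetProd fun n _ => DifferentiableAt.mul ?_ ?_
  · refine DifferentiableAt.fun_finsetProd fun k _ => DifferentiableAt.fun_finsetProd fun m _ => ?_
    exact DifferentiableAt.comp (f := fun θ : ℂ => markShift χ θ (scaledArray ħ a γ) n k -
        markShift χ θ (scaledArray ħ a γ) (n + 1) m) θ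
      (differentiableAt_adjKernel (isMarkDiff_sub (hχ _ _) (hχ _ _)) h1 h2
        (markShift_sub_re θ γ n k (n + 1) m)) (((hc _ _).sub (hc _ _)) θ)
  · refine DifferentiableAt.fun_finsetProd fun k _ => DifferentiableAt.fun_finsetProd fun m _ => ?_
    exact ((differentiable_rowKernel _).comp ((hc _ _).sub (hc _ _))) θ

theorem rowSumDiff_markShift (θ : ℂ) (Z : ℕ → ℕ → ℂ) (i : ℕ) :
    rowSumDiff N (markShift χ θ Z) i =
      rowSumDiff N Z i + θ * rowSumDiff N (fun n k => (χ n k : ℂ)) i := by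
  simp only [rowSumDiff, markShift, Finset.mul_sum, ← Finset.sum_add_distrib]
  refine Finset.sum_congr rfl fun j _ => ?_
  ring

theorem phase_markShift (θ : ℂ) (Z : ℕ → ℕ → ℂ) :
    phase x (markShift χ θ Z) = phase x Z *
      Complex.exp (-(θ * ∑ i : Fin N, (x i : ℂ) * rowSumDiff N (fun n k => (χ n k : ℂ)) i)) := by
  rw [phase, phase, ← Complex.exp_add]
  congr 1
  simp only [rowSumDiff_markShift, mul_add, Finset.sum_add_distrib, Finset.mul_sum]
  rw [neg_add]
  congr 2
  refine Finset.sum_congr rfl fun j _ => ?_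
  ring

theorem continuous_rowSumDiff (i : ℕ) :
    Continuous fun γ : Tri N → ℝ => rowSumDiff N (scaledArray ħ a γ) i :=
  continuous_finsetSum _ fun _ _ =>
    (continuous_scaledArray ħ a _ _).sub (continuous_scaledArray ħ a _ _)

theorem continuous_phase : Continuous fun γ : Tri N → ℝ => phase x (scaledArray ħ a γ) := by
  have := continuous_rowSumDiff ħ a
  unfold phase
  fun_prop

theorem rowSumDiff_re (γ : Tri N → ℝ) (i : ℕ) : (rowSumDiff N (scaledArray ħ a γ) i).re = 0 := by
  simp [rowSumDiff, scaledArray_re]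

theorem norm_phase (γ : Tri N → ℝ) : ‖phase x (scaledArray ħ a γ)‖ = 1 := by
  rw [phase, Complex.norm_exp]
  simp [rowSumDiff_re]

end Regularity

/-! ### The contour shift -/

section Shift

variable {N : ℕ} {ħ : ℝ} (hħ : 0 < ħ) (a x : Fin N → ℝ) {χ : ℕ → ℕ → ℝ}

include hħ in
theorem exists_norm_kernel_mul_phase_le (hχ : ∀ n k, χ n k = 0 ∨ χ n k = 1) :
    ∃ C c : ℝ, 0 < C ∧ 0 < c ∧ ∀ t : ℝ, -(1 / 8) ≤ t → t ≤ 17 / 8 → ∀ γ : Tri N → ℝ,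
      ‖kernel N χ (markShift χ t (scaledArray ħ a γ)) *
        phase x (markShift χ t (scaledArray ħ a γ))‖ ≤ C * Real.exp (-(c * ‖γ‖)) := by
  obtain ⟨C, c, hC, hc, h⟩ := exists_norm_kernel_le hħ a
  set s : ℂ := ∑ i : Fin N, (x i : ℂ) * rowSumDiff N (fun n k => (χ n k : ℂ)) i with hs
  refine ⟨C * Real.exp (17 / 8 * ‖s‖), c, by positivity, hc, fun t h1 h2 γ => ?_⟩
  rw [phase_markShift, norm_mul, norm_mul, norm_phase, one_mul, ← hs, mul_right_comm]
  refine mul_le_mul (h χ hχ t h1 h2 γ) ?_ (norm_nonneg _) (by positivity)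
  refine (Complex.norm_exp_le_exp_norm _).trans (Real.exp_le_exp.2 ?_)
  rw [norm_neg, norm_mul, Complex.norm_real, Real.norm_eq_abs]
  gcongr
  exact abs_le.2 ⟨by linarith, h2⟩

include hħ in
theorem integrable_kernel_mul_phase (hχ : ∀ n k, χ n k = 0 ∨ χ n k = 1) {t : ℝ}
    (h1 : -(1 / 8) < t) (h2 : t < 17 / 8) :
    MeasureTheory.Integrable fun γ : Tri N → ℝ =>
      kernel N χ (markShift χ t (scaledArray ħ a γ)) *
        phase x (markShift χ t (scaledArray ħ a γ)) := by
  obtain ⟨C, c, hC, hc, h⟩ := exists_norm_kernel_mul_phase_le hħ a x hχ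
  refine ((integrable_exp_neg_mul_norm MeasureTheory.volume hc).const_mul C).mono' ?_
    (Filter.Eventually.of_forall fun γ => h t h1.le h2.le γ)
  refine Continuous.aestronglyMeasurable ?_
  simp only [phase_markShift]
  exact (continuous_kernel ħ a χ hχ (by simpa using h1) (by simpa using h2)).mul
    ((continuous_phase ħ a x).mul continuous_const)

include hħ in
theorem scaledArray_translate (b : Tri N → ℝ) (hb : ∀ n k, χ n k = entry 0 b n k) (s : ℝ)
    (θ : ℂ) (γ : Tri N → ℝ) :
    markShift χ (θ + s * Complex.I) (scaledArray ħ a γ) =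
      markShift χ θ (scaledArray ħ a (γ + (-(s * ħ)) • b)) := by
  funext n k
  have hħ' : (ħ : ℂ) ≠ 0 := Complex.ofReal_ne_zero.2 hħ.ne'
  simp only [markShift, scaledArray, entry_add_smul, hb]
  push_cast
  field_simp
  linear_combination (s : ℂ) * ((entry (0 : Fin N → ℝ) b n k : ℝ) : ℂ) * ħ * Complex.I_sq

include hħ in
/-- Moving the marked variables by `2`, in the units of `scaledArray`, does not change the
integral of the marked kernel: the marked kernel has no poles in between. -/
theorem integral_kernel_shift (hχ : ∀ n k, χ n k = 0 ∨ χ n k = 1) (b : Tri N → ℝ)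
    (hb : ∀ n k, χ n k = entry 0 b n k) :
    ∫ γ : Tri N → ℝ, kernel N χ (scaledArray ħ a γ) * phase x (scaledArray ħ a γ) =
      ∫ γ : Tri N → ℝ, kernel N χ (markShift χ 2 (scaledArray ħ a γ)) *
        phase x (markShift χ 2 (scaledArray ħ a γ)) := by
  have h0 : ∀ Z, markShift χ 0 Z = Z := fun Z => by funext n k; simp [markShift]
  have key := integral_eq_of_translation (MeasureTheory.volume : MeasureTheory.Measure (Tri N → ℝ))
    (l := -(1 / 8)) (r := 17 / 8) (fun γ θ => kernel N χ (markShift χ θ (scaledArray ħ a γ)) *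
      phase x (markShift χ θ (scaledArray ħ a γ))) ?_ ?_ ?_ ?_ (θ₁ := 0) (θ₂ := 2)
      (by norm_num) (by norm_num) (by norm_num) (by norm_num)
  · simpa only [h0] using key
  · intro γ θ h1 h2
    refine (differentiableAt_kernel ħ a χ hχ h1 h2 γ).mul ?_
    simp only [phase_markShift]
    fun_prop
  · intro θ h1 h2
    refine Continuous.aestronglyMeasurable ?_
    simp only [phase_markShift]
    exact (continuous_kernel ħ a χ hχ h1 h2).mul ((continuous_phase ħ a x).mul continuous_const)
  · intro η
    obtain ⟨C, c, hC, hc, h⟩ := exists_norm_kernel_mul_phase_le hħ a x hχ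
    refine ⟨fun γ => C * Real.exp (c * (|η| * ħ * ‖b‖)) * Real.exp (-(c * ‖γ‖)),
      (integrable_exp_neg_mul_norm MeasureTheory.volume hc).const_mul _, fun γ θ h1 h2 h3 => ?_⟩
    have e : markShift χ θ (scaledArray ħ a γ) =
        markShift χ (θ.re : ℂ) (scaledArray ħ a (γ + (-(θ.im * ħ)) • b)) := by
      rw [← scaledArray_translate hħ a b hb, Complex.re_add_im]
    rw [e]
    refine (h θ.re h1.le h2.le _).trans ?_
    dsimp only
    rw [mul_assoc, ← Real.exp_add]
    gcongr
    have h4 : ‖γ‖ ≤ ‖γ + (-(θ.im * ħ)) • b‖ + |η| * ħ * ‖b‖ := by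
      have h5 : ‖(-(θ.im * ħ)) • b‖ ≤ |η| * ħ * ‖b‖ := by
        rw [norm_smul, norm_neg, norm_mul, Real.norm_eq_abs, Real.norm_eq_abs, abs_of_pos hħ]
        exact mul_le_mul_of_nonneg_right (mul_le_mul_of_nonneg_right
          (h3.trans (le_abs_self η)) hħ.le) (norm_nonneg b)
      have h6 := norm_sub_le (γ + (-(θ.im * ħ)) • b) ((-(θ.im * ħ)) • b)
      rw [add_sub_cancel_right] at h6
      linarith
    nlinarith
  · intro s
    refine ⟨(-(s * ħ)) • b, fun γ θ => ?_⟩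
    simp only [scaledArray_translate hħ a b hb]

/-- Almost all arrays have pairwise distinct entries in each row. -/
theorem ae_scaledArray_ne (hħ : ħ ≠ 0) :
    ∀ᵐ γ : Tri N → ℝ, ∀ r < N, ∀ s < r, ∀ p < r, s ≠ p →
      scaledArray ħ a γ r s ≠ scaledArray ħ a γ r p := by
  have key : ∀ i j : Tri N, i ≠ j → ∀ᵐ γ : Tri N → ℝ, γ i ≠ γ j := by
    intro i j hij
    have h := MeasureTheory.Measure.addHaar_submodule
      (MeasureTheory.volume : MeasureTheory.Measure (Tri N → ℝ))
      (LinearMap.eqLocus (LinearMap.proj i : (Tri N → ℝ) →ₗ[ℝ] ℝ) (LinearMap.proj j))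
      (fun htop => ?_)
    · refine MeasureTheory.measure_mono_null (fun γ hγ => ?_) h
      simpa using hγ
    · have : Pi.single i (1 : ℝ) ∈
          LinearMap.eqLocus (LinearMap.proj i : (Tri N → ℝ) →ₗ[ℝ] ℝ) (LinearMap.proj j) := by
        rw [htop]; trivial
      simp [hij.symm] at this
  have : ∀ᵐ γ : Tri N → ℝ, ∀ i j : Tri N, i ≠ j → γ i ≠ γ j := by
    simp only [MeasureTheory.ae_all_iff]
    exact key
  filter_upwards [this] with γ hγ r hr s hs p hp hsp h
  rw [scaledArray, scaledArray, entry_of_lt _ _ hr hs, entry_of_lt _ _ hr hp, div_left_inj'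
    (mul_ne_zero Complex.I_ne_zero (Complex.ofReal_ne_zero.2 hħ)), Complex.ofReal_inj] at h
  refine hγ _ _ (fun h' => hsp ?_) h
  simpa using h'

end Shift

section PathMark

variable {N : ℕ} {ħ : ℝ} (hħ : 0 < ħ) (a x : Fin N → ℝ) {χ : ℕ → ℕ → ℝ}

theorem IsPathMark.eq_entry {j n : ℕ} (h : IsPathMark j n χ) (hn : n < N) (r m : ℕ) :
    χ r m = entry (0 : Fin N → ℝ) (fun i => χ i.1 i.2) r m := by
  by_cases hr : r < N
  · by_cases hm : m < r
    · rw [entry_of_lt _ _ hr hm]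
    · rw [entry_eq_zero _ _ (by omega), h.eq_zero _ _ (by omega)]
  · rw [h.eq_zero _ _ (by omega), entry]
    simp [hr]

theorem IsPathMark.sum_range {j n : ℕ} (h : IsPathMark j n χ) (hn : n < N) (r : ℕ) :
    ∑ m ∈ Finset.range N, (χ r m : ℂ) = if j ≤ r ∧ r ≤ n then 1 else 0 := by
  split_ifs with hr
  · rw [← Finset.sum_subset (Finset.range_subset_range.2 (show r ≤ N by omega))
      (fun m _ hm => by rw [h.eq_zero r m (by rw [Finset.mem_range] at hm; omega), Complex.ofReal_zero])]
    exact_mod_cast h.sum_eq_one r hr.1 hr.2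
  · exact Finset.sum_eq_zero fun m _ => by rw [h.eq_zero r m (by omega), Complex.ofReal_zero]

theorem IsPathMark.sum_mul_rowSumDiff {i n : Fin N} (hin : i < n) (h : IsPathMark (i + 1) n χ) :
    ∑ k : Fin N, (x k : ℂ) * rowSumDiff N (fun n k => (χ n k : ℂ)) k = x i - x n := by
  have hin' : (i : ℕ) < n := hin
  have hr : ∀ k : Fin N, rowSumDiff N (fun n k => (χ n k : ℂ)) k =
      (if k = i then 1 else 0) - if k = n then 1 else 0 := by
    intro k
    rw [rowSumDiff, Finset.sum_sub_distrib, h.sum_range n.2, h.sum_range n.2]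
    simp only [Fin.ext_iff]
    split_ifs <;> first | omega | norm_num
  simp only [hr, mul_sub, Finset.sum_sub_distrib, mul_ite, mul_one, mul_zero, Finset.sum_ite_eq',
    Finset.mem_univ, if_true]

include hħ in
/-- The contour shift for a path marking, in terms of the unmarked kernel. -/
theorem integral_ratio {i n : Fin N} (hin : i < n) (h : IsPathMark (i + 1) n χ) :
    MeasureTheory.Integrable (fun γ : Tri N → ℝ => kernel N 0 (scaledArray ħ a γ) *
      ratio N χ (-scaledArray ħ a γ) * phase x (scaledArray ħ a γ)) ∧
    MeasureTheory.Integrable (fun γ : Tri N → ℝ => kernel N 0 (scaledArray ħ a γ) *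
      ratio N χ (scaledArray ħ a γ) * phase x (scaledArray ħ a γ)) ∧
    ∫ γ : Tri N → ℝ, kernel N 0 (scaledArray ħ a γ) *
      ratio N χ (-scaledArray ħ a γ) * phase x (scaledArray ħ a γ) =
    Complex.exp (-(2 * (x i - x n))) * ∫ γ : Tri N → ℝ, kernel N 0 (scaledArray ħ a γ) *
      ratio N χ (scaledArray ħ a γ) * phase x (scaledArray ħ a γ) := by
  have hne : Complex.exp (-(2 * (x i - x n))) ≠ 0 := Complex.exp_ne_zero _
  have h0 : ∀ Z, markShift χ (0 : ℝ) Z = Z := fun Z => by funext n k; simp [markShift]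
  have hχ := h.zero_or_one
  have e1 : (fun γ : Tri N → ℝ => kernel N χ (scaledArray ħ a γ) * phase x (scaledArray ħ a γ))
      =ᵐ[MeasureTheory.volume] fun γ => kernel N 0 (scaledArray ħ a γ) *
        ratio N χ (-scaledArray ħ a γ) * phase x (scaledArray ħ a γ) := by
    filter_upwards [ae_scaledArray_ne a hħ.ne'] with γ hγ
    rw [kernel_eq_mul_ratio hχ (scaledArray_re a γ) hγ]
  have e2 : (fun γ : Tri N → ℝ => kernel N χ (markShift χ 2 (scaledArray ħ a γ)) *
        phase x (markShift χ 2 (scaledArray ħ a γ)))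
      =ᵐ[MeasureTheory.volume] fun γ => Complex.exp (-(2 * (x i - x n))) *
        (kernel N 0 (scaledArray ħ a γ) *
        ratio N χ (scaledArray ħ a γ) * phase x (scaledArray ħ a γ)) := by
    filter_upwards [ae_scaledArray_ne a hħ.ne'] with γ hγ
    have := kernel_add_eq_mul_ratio hχ (scaledArray_re a γ) hγ
    rw [phase_markShift, h.sum_mul_rowSumDiff x hin,
      show markShift χ 2 (scaledArray ħ a γ) = fun n k => scaledArray ħ a γ n k + 2 * χ n k from rfl,
      this]
    ring
  have i1 := integrable_kernel_mul_phase hħ a x hχ (t := 0) (by norm_num) (by norm_num)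
  have i2 := integrable_kernel_mul_phase hħ a x hχ (t := 2) (by norm_num) (by norm_num)
  simp only [h0] at i1
  rw [Complex.ofReal_ofNat] at i2
  refine ⟨i1.congr e1, ?_, ?_⟩
  · have := (i2.congr e2).const_mul (Complex.exp (-(2 * (x i - x n))))⁻¹
    simpa only [inv_mul_cancel_left₀ hne] using this
  · rw [← MeasureTheory.integral_congr_ae e1, integral_kernel_shift hħ a x hχ _ (h.eq_entry n.2),
      MeasureTheory.integral_congr_ae e2, MeasureTheory.integral_const_mul]

include hħ in
/-- The relation between the integrals with path sums at `Z` and at `-Z` that results from the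
contour shift. -/
theorem integral_pathSum {i n : Fin N} (hin : i < n) :
    MeasureTheory.Integrable (fun γ : Tri N → ℝ => kernel N 0 (scaledArray ħ a γ) *
      pathSum (-scaledArray ħ a γ) (i + 1) n (-scaledArray ħ a γ (n + 1)) *
        phase x (scaledArray ħ a γ)) ∧
    MeasureTheory.Integrable (fun γ : Tri N → ℝ => kernel N 0 (scaledArray ħ a γ) *
      pathSum (scaledArray ħ a γ) (i + 1) n (scaledArray ħ a γ (n + 1)) *
        phase x (scaledArray ħ a γ)) ∧
    ∫ γ : Tri N → ℝ, kernel N 0 (scaledArray ħ a γ) *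
      pathSum (-scaledArray ħ a γ) (i + 1) n (-scaledArray ħ a γ (n + 1)) *
        phase x (scaledArray ħ a γ) =
    Complex.exp (-(2 * (x i - x n))) * ∫ γ : Tri N → ℝ, kernel N 0 (scaledArray ħ a γ) *
      pathSum (scaledArray ħ a γ) (i + 1) n (scaledArray ħ a γ (n + 1)) *
        phase x (scaledArray ħ a γ) := by
  obtain ⟨ι, _, χ, hχ, hsum⟩ := exists_pathSum_eq_sum (j := i + 1) (n := n) (by omega)
    (show (i : ℕ) + 1 ≤ n from hin) n.2
  have hneg : ∀ Y : ℕ → ℕ → ℂ, pathSum (-Y) (i + 1) n (-Y (n + 1)) = ∑ l, ratio N (χ l) (-Y) :=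
    fun Y => hsum (-Y)
  simp only [hneg, hsum, Finset.mul_sum, Finset.sum_mul]
  have H := fun l => integral_ratio hħ a x hin (hχ l)
  refine ⟨MeasureTheory.integrable_finsetSum _ fun l _ => (H l).1,
    MeasureTheory.integrable_finsetSum _ fun l _ => (H l).2.1, ?_⟩
  rw [MeasureTheory.integral_finsetSum _ fun l _ => (H l).1,
    MeasureTheory.integral_finsetSum _ fun l _ => (H l).2.1, Finset.mul_sum]
  exact Finset.sum_congr rfl fun l _ => (H l).2.2

end PathMark

/-! ### Differentiation under the integral sign -/

section Moments

variable {N : ℕ} (ħ : ℝ) (a : Fin N → ℝ)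

/-- Continuous functions on the space of arrays that decay exponentially. -/
structure IsExpDecaying (w : (Tri N → ℝ) → ℂ) : Prop where
  continuous : Continuous w
  exists_norm_le : ∃ C c : ℝ, 0 < C ∧ 0 < c ∧ ∀ γ, ‖w γ‖ ≤ C * Real.exp (-(c * ‖γ‖))

/-- The integral of `w` against the exponential factor. -/
def transform (w : (Tri N → ℝ) → ℂ) (x : Fin N → ℝ) : ℂ :=
  ∫ γ, w γ * phase x (scaledArray ħ a γ)

variable {w w' : (Tri N → ℝ) → ℂ}

theorem IsExpDecaying.integrable (hw : IsExpDecaying w) : MeasureTheory.Integrable w := by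
  obtain ⟨C, c, hC, hc, h⟩ := hw.exists_norm_le
  exact ((integrable_exp_neg_mul_norm MeasureTheory.volume hc).const_mul C).mono'
    hw.continuous.aestronglyMeasurable (Filter.Eventually.of_forall h)

theorem IsExpDecaying.integrable_mul_phase (hw : IsExpDecaying w) (x : Fin N → ℝ) :
    MeasureTheory.Integrable fun γ => w γ * phase x (scaledArray ħ a γ) := by
  refine hw.integrable.mono (hw.continuous.mul (continuous_phase ħ a x)).aestronglyMeasurable
    (Filter.Eventually.of_forall fun γ => ?_)
  rw [norm_mul, norm_phase, mul_one]

/-- The class is stable under multiplication by functions of linear growth. -/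
theorem IsExpDecaying.mul (hw : IsExpDecaying w) {f : (Tri N → ℝ) → ℂ} (hf : Continuous f)
    {K : ℝ} (hK : ∀ γ, ‖f γ‖ ≤ K * (1 + ‖γ‖)) : IsExpDecaying fun γ => w γ * f γ := by
  obtain ⟨C, c, hC, hc, h⟩ := hw.exists_norm_le
  refine ⟨hw.continuous.mul hf, C * (|K| + 1) * (1 + 2 / c), c / 2, by positivity, by positivity,
    fun γ => ?_⟩
  have h1 : 1 + ‖γ‖ ≤ (1 + 2 / c) * Real.exp (c / 2 * ‖γ‖) := by
    have h2 := Real.add_one_le_exp (c / 2 * ‖γ‖)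
    have h3 : 1 ≤ Real.exp (c / 2 * ‖γ‖) := Real.one_le_exp (by positivity)
    have h4 : ‖γ‖ = 2 / c * (c / 2 * ‖γ‖) := by field_simp
    have h5 : 2 / c * (c / 2 * ‖γ‖) ≤ 2 / c * Real.exp (c / 2 * ‖γ‖) := by
      gcongr
      linarith
    linarith
  have h6 : Real.exp (-(c * ‖γ‖)) * Real.exp (c / 2 * ‖γ‖) = Real.exp (-(c / 2 * ‖γ‖)) := by
    rw [← Real.exp_add]; congr 1; ring
  have h7 : K ≤ |K| + 1 := by linarith [le_abs_self K]
  rw [norm_mul]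
  calc ‖w γ‖ * ‖f γ‖ ≤ (C * Real.exp (-(c * ‖γ‖))) * ((|K| + 1) * (1 + ‖γ‖)) := by
        refine mul_le_mul (h γ) ((hK γ).trans ?_) (norm_nonneg _) (by positivity)
        gcongr
    _ ≤ (C * Real.exp (-(c * ‖γ‖))) *
        ((|K| + 1) * ((1 + 2 / c) * Real.exp (c / 2 * ‖γ‖))) := by gcongr
    _ = _ := by rw [← h6]; ring

theorem exists_norm_scaledArray_le : ∃ K : ℝ, ∀ n k, ∀ γ : Tri N → ℝ,
    ‖scaledArray ħ a γ n k‖ ≤ K * (1 + ‖γ‖) := by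
  refine ⟨(1 + ‖a‖) / |ħ|, fun n k γ => ?_⟩
  rw [scaledArray, norm_div, norm_mul, Complex.norm_I, one_mul, Complex.norm_real,
    Complex.norm_real, Real.norm_eq_abs, Real.norm_eq_abs, div_mul_eq_mul_div]
  refine div_le_div_of_nonneg_right ((abs_entry_le a γ n k).trans ?_) (abs_nonneg _)
  nlinarith [norm_nonneg a, norm_nonneg γ]

theorem exists_norm_rowSumDiff_le : ∃ K : ℝ, ∀ i, ∀ γ : Tri N → ℝ,
    ‖rowSumDiff N (scaledArray ħ a γ) i‖ ≤ K * (1 + ‖γ‖) := by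
  obtain ⟨K, hK⟩ := exists_norm_scaledArray_le ħ a
  refine ⟨N * (2 * K), fun i γ => (norm_sum_le _ _).trans ?_⟩
  refine (Finset.sum_le_card_nsmul (Finset.range N) _ (2 * K * (1 + ‖γ‖)) fun j _ => ?_).trans_eq
    (by rw [Finset.card_range, nsmul_eq_mul]; ring)
  have := norm_sub_le (scaledArray ħ a γ (i + 1) j) (scaledArray ħ a γ i j)
  linarith [hK (i + 1) j γ, hK i j γ]

theorem IsExpDecaying.mul_rowSumDiff (hw : IsExpDecaying w) (i : ℕ) :
    IsExpDecaying fun γ => w γ * rowSumDiff N (scaledArray ħ a γ) i :=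
  let ⟨_, hK⟩ := exists_norm_rowSumDiff_le ħ a
  hw.mul (continuous_rowSumDiff ħ a i) (hK i)

/-- The derivative of the exponent of the exponential factor. -/
def phaseDeriv (γ : Tri N → ℝ) : (Fin N → ℝ) →L[ℝ] ℂ :=
  -∑ i : Fin N, rowSumDiff N (scaledArray ħ a γ) i •
    (Complex.ofRealCLM.comp (ContinuousLinearMap.proj (R := ℝ) i))

theorem phaseDeriv_apply (γ : Tri N → ℝ) (x : Fin N → ℝ) :
    phaseDeriv ħ a γ x = -∑ i : Fin N, (x i : ℂ) * rowSumDiff N (scaledArray ħ a γ) i := by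
  simp [phaseDeriv, mul_comm]

theorem continuous_phaseDeriv : Continuous (phaseDeriv ħ a) := by
  unfold phaseDeriv
  refine Continuous.neg (continuous_finsetSum _ fun i _ => ?_)
  exact Continuous.smul (continuous_rowSumDiff ħ a i) continuous_const

theorem exists_norm_phaseDeriv_le : ∃ K : ℝ, ∀ γ : Tri N → ℝ,
    ‖phaseDeriv ħ a γ‖ ≤ K * (1 + ‖γ‖) := by
  obtain ⟨K, hK⟩ := exists_norm_rowSumDiff_le ħ a
  refine ⟨∑ i : Fin N, K * ‖Complex.ofRealCLM.comp
    (ContinuousLinearMap.proj (R := ℝ) (φ := fun _ : Fin N => ℝ) i)‖, fun γ => ?_⟩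
  rw [phaseDeriv, norm_neg, Finset.sum_mul]
  refine (norm_sum_le _ _).trans (Finset.sum_le_sum fun i _ => ?_)
  rw [norm_smul, mul_right_comm]
  exact mul_le_mul_of_nonneg_right (hK i γ) (norm_nonneg _)

theorem hasFDerivAt_phase (γ : Tri N → ℝ) (x : Fin N → ℝ) :
    HasFDerivAt (fun x => phase x (scaledArray ħ a γ))
      (phase x (scaledArray ħ a γ) • phaseDeriv ħ a γ) x := by
  have : (fun x => phase x (scaledArray ħ a γ)) = fun x => Complex.exp (phaseDeriv ħ a γ x) := by
    funext x
    rw [phase, phaseDeriv_apply]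
  rw [this, phase, ← phaseDeriv_apply]
  exact (phaseDeriv ħ a γ).hasFDerivAt.cexp

theorem IsExpDecaying.hasFDerivAt_transform (hw : IsExpDecaying w) (x : Fin N → ℝ) :
    HasFDerivAt (transform ħ a w)
      (∫ γ, (w γ * phase x (scaledArray ħ a γ)) • phaseDeriv ħ a γ) x := by
  obtain ⟨K, hK⟩ := exists_norm_phaseDeriv_le ħ a
  have hi : MeasureTheory.Integrable fun γ => ‖w γ‖ * ‖phaseDeriv ħ a γ‖ := by
    have := (hw.mul (f := fun γ => (‖phaseDeriv ħ a γ‖ : ℂ)) (K := K)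
      (Complex.continuous_ofReal.comp (continuous_phaseDeriv ħ a).norm)
      (fun γ => by simpa using hK γ)).integrable.norm
    simpa using this
  refine hasFDerivAt_integral_of_dominated_of_fderiv_le (𝕜 := ℝ) (s := Set.univ)
    (bound := fun γ => ‖w γ‖ * ‖phaseDeriv ħ a γ‖)
    (F := fun x γ => w γ * phase x (scaledArray ħ a γ))
    (F' := fun x γ => (w γ * phase x (scaledArray ħ a γ)) • phaseDeriv ħ a γ)
    Filter.univ_mem ?_ ?_ ?_ ?_ hi ?_
  · exact Filter.Eventually.of_forall fun x => (hw.integrable_mul_phase ħ a x).aestronglyMeasurable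
  · exact hw.integrable_mul_phase ħ a x
  · exact ((hw.continuous.mul (continuous_phase ħ a x)).smul
      (continuous_phaseDeriv ħ a)).aestronglyMeasurable
  · refine Filter.Eventually.of_forall fun γ x _ => ?_
    rw [norm_smul, norm_mul, norm_phase, mul_one]
  · refine Filter.Eventually.of_forall fun γ x _ => ?_
    rw [mul_smul]
    exact (hasFDerivAt_phase ħ a γ x).const_mul (w γ)

theorem IsExpDecaying.fderiv_transform (hw : IsExpDecaying w) (x y : Fin N → ℝ) :
    fderiv ℝ (transform ħ a w) x y =
      ∑ i, (y i : ℂ) * -transform ħ a (fun γ => w γ * rowSumDiff N (scaledArray ħ a γ) i) x := by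
  have hi : MeasureTheory.Integrable
      fun γ => (w γ * phase x (scaledArray ħ a γ)) • phaseDeriv ħ a γ := by
    obtain ⟨K, hK⟩ := exists_norm_phaseDeriv_le ħ a
    have := (hw.mul (f := fun γ => (‖phaseDeriv ħ a γ‖ : ℂ)) (K := K)
      (Complex.continuous_ofReal.comp (continuous_phaseDeriv ħ a).norm)
      (fun γ => by simpa using hK γ)).integrable
    refine this.mono ((hw.continuous.mul (continuous_phase ħ a x)).smul
      (continuous_phaseDeriv ħ a)).aestronglyMeasurable (Filter.Eventually.of_forall fun γ => ?_)
    rw [norm_smul, norm_mul, norm_phase, mul_one]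
    simp
  rw [(hw.hasFDerivAt_transform ħ a x).fderiv, ContinuousLinearMap.integral_apply hi]
  have hj : ∀ i : Fin N, MeasureTheory.Integrable fun γ => (y i : ℂ) *
      -(w γ * rowSumDiff N (scaledArray ħ a γ) i * phase x (scaledArray ħ a γ)) := fun i =>
    ((hw.mul_rowSumDiff ħ a i).integrable_mul_phase ħ a x).neg.const_mul _
  simp only [transform, ← MeasureTheory.integral_neg, ← MeasureTheory.integral_const_mul]
  rw [← MeasureTheory.integral_finsetSum _ fun i _ => hj i]
  refine MeasureTheory.integral_congr_ae (Filter.Eventually.of_forall fun γ => ?_)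
  simp only [smul_apply, phaseDeriv_apply, smul_eq_mul, mul_neg,
    Finset.mul_sum, ← Finset.sum_neg_distrib]
  refine Finset.sum_congr rfl fun i _ => ?_
  ring

theorem IsExpDecaying.partialDeriv_transform (hw : IsExpDecaying w) (n : Fin N) :
    partialDeriv n (transform ħ a w) =
      fun x => -transform ħ a (fun γ => w γ * rowSumDiff N (scaledArray ħ a γ) n) x := by
  funext x
  rw [partialDeriv, hw.fderiv_transform, Finset.sum_eq_single n]
  · simp
  · intro i _ hi
    simp [hi]
  · simp

theorem contDiff_transform_nat (m : ℕ) : ∀ {w : (Tri N → ℝ) → ℂ}, IsExpDecaying w →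
    ContDiff ℝ m (transform ħ a w) := by
  induction m with
  | zero =>
    intro w hw
    exact contDiff_zero.2 (continuous_iff_continuousAt.2 fun x =>
      (hw.hasFDerivAt_transform ħ a x).continuousAt)
  | succ m ih =>
    intro w hw
    push_cast
    rw [contDiff_succ_iff_fderiv_apply]
    refine ⟨fun x => (hw.hasFDerivAt_transform ħ a x).differentiableAt, fun h => ?_, fun y => ?_⟩
    · exact absurd h (by exact_mod_cast WithTop.natCast_ne_top _)
    · simp only [hw.fderiv_transform]
      exact ContDiff.sum fun i _ => contDiff_const.mul (ih (hw.mul_rowSumDiff ħ a i)).neg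

theorem IsExpDecaying.contDiff_transform (hw : IsExpDecaying w) :
    ContDiff ℝ ∞ (transform ħ a w) :=
  contDiff_infty.2 fun m => contDiff_transform_nat ħ a m hw

theorem isExpDecaying_kernel (hħ : 0 < ħ) :
    IsExpDecaying fun γ => kernel N 0 (scaledArray ħ a γ) := by
  have h0 : ∀ n k, (0 : ℕ → ℕ → ℝ) n k = 0 ∨ (0 : ℕ → ℕ → ℝ) n k = 1 := fun _ _ => Or.inl rfl
  have hs : ∀ γ : Tri N → ℝ, markShift 0 0 (scaledArray ħ a γ) = scaledArray ħ a γ := fun γ => by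
    funext n k; simp [markShift]
  refine ⟨?_, ?_⟩
  · have := continuous_kernel ħ a 0 h0 (θ := 0) (by norm_num) (by norm_num)
    simpa only [hs] using this
  · obtain ⟨C, c, hC, hc, h⟩ := exists_norm_kernel_le hħ a
    refine ⟨C, c, hC, hc, fun γ => ?_⟩
    have := h 0 h0 0 (by norm_num) (by norm_num) γ
    simpa using this

theorem integral_integrand (x : Fin N → ℝ) :
    ∫ γ, integrand ħ a x γ = transform ħ a (fun γ => kernel N 0 (scaledArray ħ a γ)) x := by
  simp only [integrand_eq, transform]

theorem integrable_integrand (hħ : 0 < ħ) (x : Fin N → ℝ) :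
    MeasureTheory.Integrable (integrand ħ a x) :=
  ((isExpDecaying_kernel ħ a hħ).integrable_mul_phase ħ a x).congr
    (Filter.Eventually.of_forall fun γ => (integrand_eq ħ a x γ).symm)

end Moments

/-! ### Differential equations for the integral -/

/-- The hyperbolic cotangent; by the conventions for division, `coth 0 = 0`. -/
def coth (t : ℝ) : ℝ := Real.cosh t / Real.sinh t

theorem sum_Iio_comm {N : ℕ} {M : Type*} [AddCommGroup M] (f : Fin N → Fin N → M)
    (hf : ∀ m n, f m n = f n m) :
    (∑ n, ∑ m ∈ Finset.Iio n, f m n) + (∑ n, ∑ m ∈ Finset.Iio n, f m n) =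
      (∑ n, ∑ m, f m n) - ∑ n, f n n := by
  have h1 : ∀ n : Fin N, ∑ m, f m n =
      (∑ m ∈ Finset.Iio n, f m n) + f n n + ∑ m ∈ Finset.Ioi n, f m n := by
    intro n
    have h2 : Finset.Iio n ∪ {n} ∪ Finset.Ioi n = Finset.univ := by
      ext m
      simp only [Finset.mem_union, Finset.mem_Iio, Finset.mem_singleton, Finset.mem_Ioi,
        Finset.mem_univ, iff_true]
      rcases lt_trichotomy m n with h | h | h <;> simp [h]
    rw [← h2, Finset.sum_union, Finset.sum_union, Finset.sum_singleton]
    · simp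
    · rw [Finset.disjoint_left]
      intro m hm hm'
      simp only [Finset.mem_union, Finset.mem_Iio, Finset.mem_singleton, Finset.mem_Ioi] at hm hm'
      rcases hm with h | rfl
      · exact lt_asymm h hm'
      · exact lt_irrefl _ hm'
  have h3 : ∑ n : Fin N, ∑ m ∈ Finset.Ioi n, f m n = ∑ n : Fin N, ∑ m ∈ Finset.Iio n, f m n := by
    rw [Finset.sum_comm' (t' := Finset.univ) (s' := fun m => Finset.Iio m) (by simp)]
    exact Finset.sum_congr rfl fun m _ => Finset.sum_congr rfl fun n _ => hf _ _
  simp only [h1, Finset.sum_add_distrib, h3]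
  abel

section PDE

variable {N : ℕ} {ħ : ℝ} (hħ : 0 < ħ) (a x : Fin N → ℝ)

theorem rowSumDiff_eq (γ : Tri N → ℝ) {i : ℕ} (hi : i < N) :
    rowSumDiff N (scaledArray ħ a γ) i = (∑ m ∈ Finset.range (i + 1), scaledArray ħ a γ (i + 1) m) -
      ∑ m ∈ Finset.range i, scaledArray ħ a γ i m := by
  have h : ∀ n ≤ N, ∑ m ∈ Finset.range n, scaledArray ħ a γ n m =
      ∑ m ∈ Finset.range N, scaledArray ħ a γ n m := fun n hn =>
    Finset.sum_subset (Finset.range_subset_range.2 hn) fun m _ hm => by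
      rw [scaledArray, entry_eq_zero _ _ (by rw [Finset.mem_range] at hm; omega)]
      simp
  rw [rowSumDiff, Finset.sum_sub_distrib, h _ (by omega), h _ hi.le]

theorem scaledArray_top (γ : Tri N → ℝ) (m : Fin N) :
    scaledArray ħ a γ N m = a m / (Complex.I * ħ) := by
  rw [scaledArray, entry_top]

theorem sum_rowSumDiff (γ : Tri N → ℝ) :
    ∑ i : Fin N, rowSumDiff N (scaledArray ħ a γ) i = (∑ m, (a m : ℂ)) / (Complex.I * ħ) := by
  have h0 : ∀ m, scaledArray ħ a γ 0 m = 0 := fun m => by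
    rw [scaledArray, entry_eq_zero _ _ (Nat.zero_le m)]; simp
  simp only [rowSumDiff]
  rw [Finset.sum_comm, Finset.sum_div, ← Fin.sum_univ_eq_sum_range (fun j =>
    ∑ i : Fin N, (scaledArray ħ a γ (i + 1) j - scaledArray ħ a γ i j)) N]
  refine Finset.sum_congr rfl fun j _ => ?_
  rw [Fin.sum_univ_eq_sum_range (fun i => scaledArray ħ a γ (i + 1) j - scaledArray ħ a γ i j) N,
    Finset.sum_range_sub (fun i => scaledArray ħ a γ i j) N, h0, sub_zero, scaledArray_top]

theorem IsExpDecaying.sum_transform {w : (Tri N → ℝ) → ℂ} (hw : IsExpDecaying w) :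
    ∑ i : Fin N, transform ħ a (fun γ => w γ * rowSumDiff N (scaledArray ħ a γ) i) x =
      (∑ m, (a m : ℂ)) / (Complex.I * ħ) * transform ħ a w x := by
  simp only [transform]
  have hi := fun i : Fin N => (hw.mul_rowSumDiff ħ a i).integrable_mul_phase ħ a x
  rw [← MeasureTheory.integral_finsetSum _ fun i _ => hi i, ← MeasureTheory.integral_const_mul]
  refine MeasureTheory.integral_congr_ae (Filter.Eventually.of_forall fun γ => ?_)
  dsimp only
  rw [← sum_rowSumDiff a γ, ← Finset.sum_mul, ← Finset.mul_sum]
  ring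

theorem IsExpDecaying.partialDeriv_partialDeriv_transform {w : (Tri N → ℝ) → ℂ}
    (hw : IsExpDecaying w) (m n : Fin N) :
    partialDeriv n (partialDeriv m (transform ħ a w)) = transform ħ a (fun γ =>
      w γ * rowSumDiff N (scaledArray ħ a γ) m * rowSumDiff N (scaledArray ħ a γ) n) := by
  have h := (hw.mul_rowSumDiff ħ a m).partialDeriv_transform ħ a n
  rw [hw.partialDeriv_transform]
  funext x
  have h' := congrFun h x
  rw [partialDeriv] at h' ⊢
  rw [fderiv_fun_neg, neg_apply, h', neg_neg]

include hħ in
/-- The contour shift for the path sums in the rows `i + 1, …, n`, as a statement on derivatives of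
the integral. -/
theorem coth_mul_partialDeriv_sub {i n : Fin N} (hin : i < n) (hx : x i ≠ x n) :
    (coth (x i - x n) : ℂ) *
      (partialDeriv i (transform ħ a fun γ => kernel N 0 (scaledArray ħ a γ)) x -
        partialDeriv n (transform ħ a fun γ => kernel N 0 (scaledArray ħ a γ)) x) =
    -∫ γ : Tri N → ℝ, kernel N 0 (scaledArray ħ a γ) *
      (pathSum (scaledArray ħ a γ) (i + 1) n (scaledArray ħ a γ (n + 1)) +
        pathSum (-scaledArray ħ a γ) (i + 1) n (-scaledArray ħ a γ (n + 1))) *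
        phase x (scaledArray ħ a γ) := by
  obtain ⟨h1, h2, h3⟩ := integral_pathSum hħ a x hin
  have hk := isExpDecaying_kernel ħ a hħ
  set P := ∫ γ : Tri N → ℝ, kernel N 0 (scaledArray ħ a γ) *
      pathSum (scaledArray ħ a γ) (i + 1) n (scaledArray ħ a γ (n + 1)) *
        phase x (scaledArray ħ a γ) with hP
  have hadd : ∫ γ : Tri N → ℝ, kernel N 0 (scaledArray ħ a γ) *
      (pathSum (scaledArray ħ a γ) (i + 1) n (scaledArray ħ a γ (n + 1)) +
        pathSum (-scaledArray ħ a γ) (i + 1) n (-scaledArray ħ a γ (n + 1))) *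
        phase x (scaledArray ħ a γ) = P + Complex.exp (-(2 * (x i - x n))) * P := by
    rw [← h3, hP, ← MeasureTheory.integral_add h2 h1]
    refine MeasureTheory.integral_congr_ae (Filter.Eventually.of_forall fun γ => ?_)
    dsimp only
    ring
  have hsub : partialDeriv i (transform ħ a fun γ => kernel N 0 (scaledArray ħ a γ)) x -
        partialDeriv n (transform ħ a fun γ => kernel N 0 (scaledArray ħ a γ)) x =
      -(P - Complex.exp (-(2 * (x i - x n))) * P) := by
    rw [← h3, hP, ← MeasureTheory.integral_sub h2 h1, hk.partialDeriv_transform,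
      hk.partialDeriv_transform]
    dsimp only
    rw [sub_neg_eq_add, neg_add_eq_sub, ← neg_sub, transform, transform,
      ← MeasureTheory.integral_sub ((hk.mul_rowSumDiff ħ a i).integrable_mul_phase ħ a x)
        ((hk.mul_rowSumDiff ħ a n).integrable_mul_phase ħ a x)]
    congr 1
    refine MeasureTheory.integral_congr_ae ?_
    filter_upwards [ae_scaledArray_ne a hħ.ne'] with γ hγ
    have := pathSum_sub_neg (scaledArray_re a γ) (j := i + 1) (n := n) (by omega)
      (show (i : ℕ) + 1 ≤ n from hin) (fun r hr => hγ r (lt_of_le_of_lt hr n.2))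
      (scaledArray ħ a γ (n + 1))
    rw [Nat.add_sub_cancel, ← rowSumDiff_eq a γ i.2, ← rowSumDiff_eq a γ n.2] at this
    linear_combination (-(kernel N 0 (scaledArray ħ a γ) * phase x (scaledArray ħ a γ))) * this
  rw [hadd, hsub]
  have hd : Real.sinh (x i - x n) ≠ 0 := fun h => hx (by
    rw [Real.sinh_eq_zero] at h; linarith)
  have hd' : (Real.sinh (x i - x n) : ℂ) ≠ 0 := Complex.ofReal_ne_zero.2 hd
  have huv : Complex.exp (x i - x n) * Complex.exp (-(x i - x n)) = 1 := by
    rw [← Complex.exp_add]; simp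
  have hvv : Complex.exp (-(2 * (x i - x n))) = Complex.exp (-(x i - x n)) ^ 2 := by
    rw [← Complex.exp_nat_mul]; congr 1; push_cast; ring
  rw [coth, Complex.ofReal_div, div_mul_eq_mul_div, div_eq_iff hd', hvv]
  push_cast
  rw [Complex.cosh, Complex.sinh]
  linear_combination P * Complex.exp (-(x i - x n)) * huv

theorem sum_Iio_eq_sum_Icc {M : Type*} [AddCommMonoid M] (n : Fin N) (f : ℕ → M) :
    ∑ i ∈ Finset.Iio n, f (i + 1) = ∑ j ∈ Finset.Icc 1 (n : ℕ), f j := by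
  refine Finset.sum_bij (fun i _ => (i : ℕ) + 1) ?_ ?_ ?_ ?_
  · intro i hi
    rw [Finset.mem_Iio, Fin.lt_def] at hi
    rw [Finset.mem_Icc]
    omega
  · intro i _ j _ h
    exact Fin.ext (by simpa using h)
  · intro j hj
    rw [Finset.mem_Icc] at hj
    refine ⟨⟨j - 1, by have := n.2; omega⟩, ?_, ?_⟩
    · rw [Finset.mem_Iio, Fin.lt_def]
      dsimp only
      omega
    · dsimp only
      omega
  · intro i _
    rfl

/-- The quadratic Casimir element of `gl_N`: the relative terms for `gl_{n+1}` and `gl_n` telescope,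
and only the top row is left. -/
theorem sum_Iio_pathSum (γ : Tri N → ℝ) (hγ : ∀ r < N, ∀ s < r, ∀ p < r, s ≠ p →
      scaledArray ħ a γ r s ≠ scaledArray ħ a γ r p) :
    ∑ n : Fin N, ∑ i ∈ Finset.Iio n,
      (pathSum (scaledArray ħ a γ) (i + 1) n (scaledArray ħ a γ (n + 1)) +
        pathSum (-scaledArray ħ a γ) (i + 1) n (-scaledArray ħ a γ (n + 1))) =
    (∑ n : Fin N, rowSumDiff N (scaledArray ħ a γ) n ^ 2) +
      (∑ m, (a m : ℂ) ^ 2) / (ħ : ℂ) ^ 2 + ∑ n ∈ Finset.range N, (n : ℂ) * (n + 1) / 4 := by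
  have h1 : ∀ n : Fin N, ∑ i ∈ Finset.Iio n,
      (pathSum (scaledArray ħ a γ) (i + 1) n (scaledArray ħ a γ (n + 1)) +
        pathSum (-scaledArray ħ a γ) (i + 1) n (-scaledArray ħ a γ (n + 1))) =
      rowSumDiff N (scaledArray ħ a γ) n ^ 2 +
        ((∑ l ∈ Finset.range n, scaledArray ħ a γ n l ^ 2) -
        ∑ l ∈ Finset.range (n + 1), scaledArray ħ a γ (n + 1) l ^ 2) + (n : ℂ) * (n + 1) / 4 := by
    intro n
    rw [sum_Iio_eq_sum_Icc n (fun j => pathSum (scaledArray ħ a γ) j n (scaledArray ħ a γ (n + 1)) +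
      pathSum (-scaledArray ħ a γ) j n (-scaledArray ħ a γ (n + 1))),
      sum_pathSum_add_neg (scaledArray_re a γ) n (fun r hr => hγ r (lt_of_le_of_lt hr n.2)),
      rowSumDiff_eq a γ n.2]
    ring
  have h2 : ∑ l ∈ Finset.range N, scaledArray ħ a γ N l ^ 2 =
      -((∑ m, (a m : ℂ) ^ 2) / (ħ : ℂ) ^ 2) := by
    rw [← Fin.sum_univ_eq_sum_range (fun l => scaledArray ħ a γ N l ^ 2) N, Finset.sum_div,
      ← Finset.sum_neg_distrib]
    refine Finset.sum_congr rfl fun m _ => ?_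
    rw [scaledArray_top, div_pow, mul_pow, Complex.I_sq]
    ring
  simp only [h1, Finset.sum_add_distrib]
  rw [Fin.sum_univ_eq_sum_range (fun n => (∑ l ∈ Finset.range n, scaledArray ħ a γ n l ^ 2) -
        ∑ l ∈ Finset.range (n + 1), scaledArray ħ a γ (n + 1) l ^ 2) N,
    Finset.sum_range_sub' (fun n => ∑ l ∈ Finset.range n, scaledArray ħ a γ n l ^ 2) N, h2,
    Fin.sum_univ_eq_sum_range (fun n => (n : ℂ) * (n + 1) / 4) N]
  simp

include hħ in
/-- The second-order differential equation for the integral, before the conjugation with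
`sinhFactor`. -/
theorem sum_coth_mul_partialDeriv (hx : x ∈ regularSet N) :
    ∑ n : Fin N, ∑ i ∈ Finset.Iio n, (coth (x i - x n) : ℂ) *
      (partialDeriv i (transform ħ a fun γ => kernel N 0 (scaledArray ħ a γ)) x -
        partialDeriv n (transform ħ a fun γ => kernel N 0 (scaledArray ħ a γ)) x) =
    -((∑ n : Fin N, partialDeriv n (partialDeriv n
        (transform ħ a fun γ => kernel N 0 (scaledArray ħ a γ))) x) +
      ((∑ m, (a m : ℂ) ^ 2) / (ħ : ℂ) ^ 2 + ∑ n ∈ Finset.range N, (n : ℂ) * (n + 1) / 4) *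
        transform ħ a (fun γ => kernel N 0 (scaledArray ħ a γ)) x) := by
  have hk := isExpDecaying_kernel ħ a hħ
  have hint : ∀ n : Fin N, ∀ i ∈ Finset.Iio n, MeasureTheory.Integrable fun γ : Tri N → ℝ =>
      kernel N 0 (scaledArray ħ a γ) *
      (pathSum (scaledArray ħ a γ) (i + 1) n (scaledArray ħ a γ (n + 1)) +
        pathSum (-scaledArray ħ a γ) (i + 1) n (-scaledArray ħ a γ (n + 1))) *
        phase x (scaledArray ħ a γ) := by
    intro n i hi
    obtain ⟨h1, h2, -⟩ := integral_pathSum hħ a x (Finset.mem_Iio.1 hi)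
    refine (h2.add h1).congr (Filter.Eventually.of_forall fun γ => ?_)
    simp only [Pi.add_apply]
    ring
  have h1 : ∀ n : Fin N, ∑ i ∈ Finset.Iio n, (coth (x i - x n) : ℂ) *
      (partialDeriv i (transform ħ a fun γ => kernel N 0 (scaledArray ħ a γ)) x -
        partialDeriv n (transform ħ a fun γ => kernel N 0 (scaledArray ħ a γ)) x) =
      -∫ γ : Tri N → ℝ, ∑ i ∈ Finset.Iio n, kernel N 0 (scaledArray ħ a γ) *
      (pathSum (scaledArray ħ a γ) (i + 1) n (scaledArray ħ a γ (n + 1)) +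
        pathSum (-scaledArray ħ a γ) (i + 1) n (-scaledArray ħ a γ (n + 1))) *
        phase x (scaledArray ħ a γ) := by
    intro n
    rw [MeasureTheory.integral_finsetSum _ (hint n), ← Finset.sum_neg_distrib]
    refine Finset.sum_congr rfl fun i hi => ?_
    have hin := Finset.mem_Iio.1 hi
    exact coth_mul_partialDeriv_sub hħ a x hin fun h => hin.ne (hx h)
  simp only [h1]
  rw [Finset.sum_neg_distrib, ← MeasureTheory.integral_finsetSum _ fun n _ =>
    MeasureTheory.integrable_finsetSum _ (hint n)]
  congr 1
  have hk2 := fun n : Fin N =>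
    ((hk.mul_rowSumDiff ħ a n).mul_rowSumDiff ħ a n).integrable_mul_phase ħ a x
  simp only [hk.partialDeriv_partialDeriv_transform, transform]
  rw [← MeasureTheory.integral_const_mul, ← MeasureTheory.integral_finsetSum _ fun n _ => hk2 n,
    ← MeasureTheory.integral_add (MeasureTheory.integrable_finsetSum _ fun n _ => hk2 n)
      ((hk.integrable_mul_phase ħ a x).const_mul _)]
  refine MeasureTheory.integral_congr_ae ?_
  filter_upwards [ae_scaledArray_ne a hħ.ne'] with γ hγ
  have := sum_Iio_pathSum a γ hγ
  simp only [mul_assoc, ← Finset.mul_sum]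
  simp only [← mul_assoc, ← Finset.sum_mul]
  simp only [← Finset.mul_sum, mul_assoc] at *
  rw [this]
  simp only [pow_two]
  ring

end PDE

/-! ### The prefactor -/

theorem isOpen_regularSet (N : ℕ) : IsOpen (regularSet N) := by
  have : regularSet N = ⋂ i : Fin N, ⋂ j : Fin N, {x | i ≠ j → x i ≠ x j} := by
    ext x
    simp only [regularSet, Set.mem_ofPred_eq, Set.mem_iInter]
    exact ⟨fun h i j hij h' => hij (h h'), fun h i j h' => by
      by_contra hij
      exact h i j hij h'⟩
  rw [this]
  refine isOpen_iInter_of_finite fun i => isOpen_iInter_of_finite fun j => ?_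
  by_cases hij : i = j
  · simp [hij]
  · simp only [ne_eq, hij, not_false_iff, forall_true_left]
    exact isOpen_ne_fun (continuous_apply i) (continuous_apply j)

section Prefactor

variable {N : ℕ} {x : Fin N → ℝ}

theorem sinh_sub_ne_zero (hx : x ∈ regularSet N) {i j : Fin N} (hij : i ≠ j) :
    Real.sinh (x i - x j) ≠ 0 := fun h => hij (hx (by rw [Real.sinh_eq_zero] at h; linarith))

theorem ofReal_cpow_half {t : ℝ} (ht : t ≠ 0) :
    (t : ℂ) ^ (1 / 2 : ℂ) = (if 0 < t then 1 else Complex.I) *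
      Complex.exp ((1 / 2 * Real.log t : ℝ) : ℂ) := by
  rcases lt_or_gt_of_ne ht with h | h
  · rw [if_neg h.not_gt, Complex.ofReal_cpow_of_nonpos h.le, ← Complex.ofReal_neg,
      Complex.cpow_def_of_ne_zero (by exact_mod_cast (neg_pos.2 h).ne'), ← Complex.ofReal_log
      (neg_pos.2 h).le, Real.log_neg_eq_log, mul_comm]
    congr 1
    · rw [show (Real.pi : ℂ) * Complex.I * (1 / 2) = Real.pi / 2 * Complex.I by ring,
        Complex.exp_pi_div_two_mul_I]
    · congr 1
      push_cast
      ring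
  · rw [if_pos h, one_mul, Complex.cpow_def_of_ne_zero (by exact_mod_cast h.ne'),
      ← Complex.ofReal_log h.le]
    congr 1
    push_cast
    ring

/-- The logarithm of `∏ |sinh (xⱼ - xₖ)|`. -/
def logSinh (x : Fin N → ℝ) : ℝ :=
  ∑ k, ∑ j ∈ Finset.Iio k, Real.log (Real.sinh (x j - x k))

/-- On the configuration space the prefactor is locally a nonzero constant times the exponential of
a smooth function; the constant collects the square roots of the signs. -/
theorem exists_sinhFactor_eq (hx : x ∈ regularSet N) : ∃ c : ℂ, c ≠ 0 ∧
    sinhFactor =ᶠ[nhds x] fun y => c * Complex.exp ((1 / 2 * logSinh y : ℝ) : ℂ) := by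
  set σ : ℝ → ℂ := fun t => if 0 < t then 1 else Complex.I with hσ
  refine ⟨∏ k, ∏ j ∈ Finset.Iio k, σ (Real.sinh (x j - x k)), ?_, ?_⟩
  · refine Finset.prod_ne_zero_iff.2 fun k _ => Finset.prod_ne_zero_iff.2 fun j _ => ?_
    simp only [hσ]
    split_ifs
    · exact one_ne_zero
    · exact Complex.I_ne_zero
  · have hev : ∀ k j : Fin N, j ≠ k → ∀ᶠ y : Fin N → ℝ in nhds x,
        σ (Real.sinh (y j - y k)) = σ (Real.sinh (x j - x k)) := by
      intro k j hjk
      have hc : ContinuousAt (fun y : Fin N → ℝ => Real.sinh (y j - y k)) x := by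
        have := Real.continuous_sinh
        fun_prop
      rcases lt_or_gt_of_ne (sinh_sub_ne_zero hx hjk) with h | h
      · filter_upwards [hc.eventually_lt_const h] with y hy
        simp [hσ, h.not_gt, hy.not_gt]
      · filter_upwards [hc.eventually_const_lt h] with y hy
        simp [hσ, h, hy]
    have hev' : ∀ᶠ y : Fin N → ℝ in nhds x, ∀ k j : Fin N, j ≠ k →
        σ (Real.sinh (y j - y k)) = σ (Real.sinh (x j - x k)) := by
      simp only [Filter.eventually_all]
      exact hev
    filter_upwards [hev', (isOpen_regularSet N).mem_nhds hx] with y hy hyr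
    rw [sinhFactor, logSinh, Finset.mul_sum, Complex.ofReal_sum, Complex.exp_sum,
      ← Finset.prod_mul_distrib]
    refine Finset.prod_congr rfl fun k _ => ?_
    rw [Finset.mul_sum, Complex.ofReal_sum, Complex.exp_sum, ← Finset.prod_mul_distrib]
    refine Finset.prod_congr rfl fun j hj => ?_
    have hjk := (Finset.mem_Iio.1 hj).ne
    rw [ofReal_cpow_half (sinh_sub_ne_zero hyr hjk), ← hy k j hjk]

theorem contDiffAt_logSinh (hx : x ∈ regularSet N) : ContDiffAt ℝ ∞ logSinh x := by
  unfold logSinh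
  refine ContDiffAt.sum fun k _ => ContDiffAt.sum fun j hj => ?_
  refine ContDiffAt.log ?_ (sinh_sub_ne_zero hx (Finset.mem_Iio.1 hj).ne)
  exact (Real.contDiff_sinh.comp ((contDiff_apply ℝ ℝ j).sub (contDiff_apply ℝ ℝ k))).contDiffAt

theorem contDiffAt_sinhFactor (hx : x ∈ regularSet N) : ContDiffAt ℝ ∞ sinhFactor x := by
  obtain ⟨c, -, hc⟩ := exists_sinhFactor_eq hx
  refine ContDiffAt.congr_of_eventuallyEq ?_ hc
  refine contDiffAt_const.mul (ContDiffAt.cexp ?_)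
  exact (Complex.ofRealCLM.contDiff.contDiffAt).comp x
    (contDiffAt_const.mul (contDiffAt_logSinh hx))

theorem sinhFactor_ne_zero (hx : x ∈ regularSet N) : sinhFactor x ≠ 0 := by
  obtain ⟨c, hc0, hc⟩ := exists_sinhFactor_eq hx
  rw [hc.self_of_nhds]
  exact mul_ne_zero hc0 (Complex.exp_ne_zero _)

theorem coth_neg (t : ℝ) : coth (-t) = -coth t := by
  rw [coth, coth, Real.cosh_neg, Real.sinh_neg, div_neg]

/-- The sum of `coth (xₘ - xₖ)` over `k ≠ m`; the term `k = m` is `coth 0 = 0`. -/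
def cothSum (m : Fin N) (x : Fin N → ℝ) : ℂ := ∑ k, (coth (x m - x k) : ℂ)

theorem hasFDerivAt_apply_sub_apply (x : Fin N → ℝ) (j k : Fin N) :
    HasFDerivAt (fun y : Fin N → ℝ => y j - y k)
      ((ContinuousLinearMap.proj j : (Fin N → ℝ) →L[ℝ] ℝ) - ContinuousLinearMap.proj k) x :=
  ((ContinuousLinearMap.proj j : (Fin N → ℝ) →L[ℝ] ℝ) - ContinuousLinearMap.proj k).hasFDerivAt

theorem hasFDerivAt_logSinh (hx : x ∈ regularSet N) :
    HasFDerivAt logSinh (∑ k : Fin N, ∑ j ∈ Finset.Iio k, coth (x j - x k) •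
      ((ContinuousLinearMap.proj j : (Fin N → ℝ) →L[ℝ] ℝ) - ContinuousLinearMap.proj k)) x := by
  unfold logSinh
  refine HasFDerivAt.fun_sum fun k _ => HasFDerivAt.fun_sum fun j hj => ?_
  have h := sinh_sub_ne_zero hx (Finset.mem_Iio.1 hj).ne
  have h1 : HasDerivAt (fun t => Real.log (Real.sinh t)) (coth (x j - x k)) (x j - x k) :=
    (Real.hasDerivAt_sinh _).log h
  exact h1.comp_hasFDerivAt x (hasFDerivAt_apply_sub_apply x j k)

/-- The logarithmic derivative of the prefactor. -/
theorem partialDeriv_sinhFactor (hx : x ∈ regularSet N) (m : Fin N) :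
    partialDeriv m sinhFactor x = 1 / 2 * cothSum m x * sinhFactor x := by
  obtain ⟨c, -, hc⟩ := exists_sinhFactor_eq hx
  have h1 := (Complex.ofRealCLM.hasFDerivAt.comp x ((hasFDerivAt_logSinh hx).const_mul (1 / 2))).cexp
  have h2 := h1.const_mul c
  rw [partialDeriv, hc.fderiv_eq, hc.self_of_nhds]
  have h3 := h2.fderiv
  simp only [Function.comp_def, Complex.ofRealCLM_apply] at h3
  rw [h3]
  have h4 : ∑ k : Fin N, ∑ j ∈ Finset.Iio k, coth (x j - x k) *
      ((Pi.single m 1 : Fin N → ℝ) j - (Pi.single m 1 : Fin N → ℝ) k) =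
      ∑ k, coth (x m - x k) := by
    have h5 := sum_Iio_comm (fun j k : Fin N => coth (x j - x k) *
      ((Pi.single m 1 : Fin N → ℝ) j - (Pi.single m 1 : Fin N → ℝ) k)) (fun j k => by
        rw [← neg_sub (x k), coth_neg]; ring)
    have h6 : ∀ j : Fin N, coth (x j - x m) = -coth (x m - x j) := fun j => by
      rw [← neg_sub, coth_neg]
    simp only [sub_self, mul_zero, Finset.sum_const_zero, sub_zero, mul_sub, Pi.single_apply,
      mul_ite, mul_one, Finset.sum_sub_distrib, Finset.sum_ite_eq', Finset.mem_univ,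
      if_true] at h5
    simp only [mul_sub, Pi.single_apply, mul_ite, mul_one, mul_zero, Finset.sum_sub_distrib]
    rw [Finset.sum_comm (s := Finset.univ) (t := Finset.univ)] at h5
    simp only [Finset.sum_ite_eq', Finset.mem_univ, if_true, h6, Finset.sum_neg_distrib,
      Finset.sum_ite_irrel, Finset.sum_const_zero] at h5 ⊢
    linarith
  simp only [ContinuousLinearMap.comp_apply, smul_apply, sum_apply, sub_apply,
    ContinuousLinearMap.proj_apply, smul_eq_mul, Complex.ofRealCLM_apply, h4, cothSum]
  push_cast
  ring

theorem hasFDerivAt_coth_sub (hx : x ∈ regularSet N) (m k : Fin N) :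
    HasFDerivAt (fun y : Fin N → ℝ => coth (y m - y k)) ((-(1 / Real.sinh (x m - x k) ^ 2)) •
      ((ContinuousLinearMap.proj m : (Fin N → ℝ) →L[ℝ] ℝ) - ContinuousLinearMap.proj k)) x := by
  by_cases hmk : m = k
  · subst hmk
    simp only [sub_self, smul_zero]
    exact hasFDerivAt_const _ _
  · have h := sinh_sub_ne_zero hx hmk
    have h1 : HasDerivAt coth (-(1 / Real.sinh (x m - x k) ^ 2)) (x m - x k) := by
      have := (Real.hasDerivAt_cosh (x m - x k)).div (Real.hasDerivAt_sinh (x m - x k)) h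
      convert! this using 1
      rw [neg_div', ← Real.cosh_sq_sub_sinh_sq (x m - x k)]
      congr 1
      ring
    exact h1.comp_hasFDerivAt x (hasFDerivAt_apply_sub_apply x m k)

theorem hasFDerivAt_cothSum (hx : x ∈ regularSet N) (m : Fin N) :
    HasFDerivAt (cothSum m) (∑ k : Fin N, Complex.ofRealCLM.comp
      ((-(1 / Real.sinh (x m - x k) ^ 2)) •
      ((ContinuousLinearMap.proj m : (Fin N → ℝ) →L[ℝ] ℝ) - ContinuousLinearMap.proj k))) x := by
  unfold cothSum
  refine HasFDerivAt.fun_sum fun k _ => ?_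
  exact Complex.ofRealCLM.hasFDerivAt.comp x (hasFDerivAt_coth_sub hx m k)

theorem partialDeriv_cothSum (hx : x ∈ regularSet N) {m n : Fin N} (hmn : m ≠ n) :
    partialDeriv n (cothSum m) x = ((1 / Real.sinh (x m - x n) ^ 2 : ℝ) : ℂ) := by
  rw [partialDeriv, (hasFDerivAt_cothSum hx m).fderiv]
  simp only [ContinuousLinearMap.comp_apply, smul_apply, sum_apply, sub_apply,
    ContinuousLinearMap.proj_apply, smul_eq_mul, Complex.ofRealCLM_apply, Pi.single_apply,
    if_neg hmn, zero_sub]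
  rw [Finset.sum_eq_single n]
  · simp
  · intro k _ hk
    simp [hk]
  · simp

theorem sum_cothSum : ∑ m, cothSum m x = 0 := by
  have h : ∑ m, cothSum m x = -∑ m, cothSum m x := by
    conv_lhs => unfold cothSum
    rw [Finset.sum_comm, ← Finset.sum_neg_distrib]
    refine Finset.sum_congr rfl fun m _ => ?_
    rw [cothSum, ← Finset.sum_neg_distrib]
    refine Finset.sum_congr rfl fun k _ => ?_
    rw [← neg_sub, coth_neg]
    push_cast
    rfl
  exact self_eq_neg.1 h

theorem coth_sq (hx : x ∈ regularSet N) (m k : Fin N) :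
    coth (x m - x k) ^ 2 = (if m = k then 0 else 1) + 1 / Real.sinh (x m - x k) ^ 2 := by
  split_ifs with h
  · simp [h, coth]
  · have := sinh_sub_ne_zero hx h
    rw [coth, div_pow, Real.cosh_sq]
    field_simp

/-- The addition theorem of `coth`, in the form
`coth u coth v + coth v coth w + coth w coth u = 1 + …` with corrections for coinciding
arguments that come from `coth 0 = 0`. -/
theorem coth_triple (hx : x ∈ regularSet N) (m k l : Fin N) :
    coth (x m - x k) * coth (x m - x l) + coth (x k - x m) * coth (x k - x l) +
      coth (x l - x m) * coth (x l - x k) =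
    (1 - (if m = k then 1 else 0) - (if k = l then 1 else 0) - (if m = l then 1 else 0) +
      2 * if m = k then if k = l then 1 else 0 else 0) +
      ((if k = l then coth (x m - x k) ^ 2 else 0) + (if m = k then coth (x l - x m) ^ 2 else 0) +
        if m = l then coth (x k - x m) ^ 2 else 0) := by
  have h0 : coth 0 = 0 := by simp [coth]
  have hn : ∀ i j : Fin N, coth (x i - x j) = -coth (x j - x i) := fun i j => by
    rw [← neg_sub, coth_neg]
  by_cases h1 : m = k
  · subst h1
    by_cases h2 : m = l
    · subst h2; norm_num [h0]
    · simp only [h2, if_true, if_false, sub_self, h0]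
      ring
  · by_cases h2 : k = l
    · subst h2
      simp only [h1, if_true, if_false, sub_self, h0]
      ring
    · by_cases h3 : m = l
      · subst h3
        simp only [h1, h2, if_true, if_false, sub_self, h0]
        ring
      · simp only [h1, h2, h3, if_false]
        have e1 := sinh_sub_ne_zero hx h1
        have e2 := sinh_sub_ne_zero hx h2
        have e3 := sinh_sub_ne_zero hx h3
        rw [hn k m, hn l m, hn l k]
        have es : Real.sinh (x m - x l) = Real.sinh (x m - x k) * Real.cosh (x k - x l) +
            Real.cosh (x m - x k) * Real.sinh (x k - x l) := by
          rw [← Real.sinh_add]; congr 1; ring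
        have ec : Real.cosh (x m - x l) = Real.cosh (x m - x k) * Real.cosh (x k - x l) +
            Real.sinh (x m - x k) * Real.sinh (x k - x l) := by
          rw [← Real.cosh_add]; congr 1; ring
        simp only [coth]
        have e3' := e3
        rw [es] at e3'
        rw [es, ec]
        field_simp
        ring

/-- By `coth_triple`, the mixed terms of the squares contribute only a constant. -/
theorem sum_cothSum_sq (hx : x ∈ regularSet N) :
    ∑ m, cothSum m x ^ 2 = (N : ℂ) * (N - 1) * (N - 2) / 3 + (N : ℂ) ^ 2 - N +
      ∑ m, ∑ k, ((1 / Real.sinh (x m - x k) ^ 2 : ℝ) : ℂ) := by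
  have hT : ∑ m : Fin N, (∑ k, coth (x m - x k)) ^ 2 = (N : ℝ) * (N - 1) * (N - 2) / 3 +
      (N : ℝ) ^ 2 - N + ∑ m, ∑ k, 1 / Real.sinh (x m - x k) ^ 2 := by
    set T := ∑ m : Fin N, ∑ k : Fin N, ∑ l : Fin N, coth (x m - x k) * coth (x m - x l) with hTdef
    have e1 : ∑ m : Fin N, (∑ k, coth (x m - x k)) ^ 2 = T := by
      refine Finset.sum_congr rfl fun m _ => ?_
      rw [pow_two, Finset.sum_mul_sum]
    have e2 : ∑ m : Fin N, ∑ k : Fin N, ∑ l : Fin N, coth (x k - x m) * coth (x k - x l) = T := by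
      rw [Finset.sum_comm]
    have e3 : ∑ m : Fin N, ∑ k : Fin N, ∑ l : Fin N, coth (x l - x m) * coth (x l - x k) = T := by
      rw [Finset.sum_congr rfl fun m _ => Finset.sum_comm, Finset.sum_comm]
    have hsq : ∑ m : Fin N, ∑ k, coth (x m - x k) ^ 2 =
        (N : ℝ) ^ 2 - N + ∑ m, ∑ k, 1 / Real.sinh (x m - x k) ^ 2 := by
      have e : ∀ m k : Fin N, (if m = k then (0 : ℝ) else 1) = 1 - if m = k then 1 else 0 :=
        fun m k => by split_ifs <;> norm_num
      simp only [coth_sq hx, Finset.sum_add_distrib, e, Finset.sum_sub_distrib, Finset.sum_const,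
        Finset.card_univ, Fintype.card_fin, nsmul_eq_mul, mul_one, Finset.sum_ite_eq,
        Finset.mem_univ, if_true]
      ring
    have h3 : T + T + T = ((N : ℝ) ^ 3 - 3 * N ^ 2 + 2 * N) +
        3 * ∑ m : Fin N, ∑ k, coth (x m - x k) ^ 2 := by
      have h4 : T + T + T = ∑ m : Fin N, ∑ k : Fin N, ∑ l : Fin N,
          (coth (x m - x k) * coth (x m - x l) + coth (x k - x m) * coth (x k - x l) +
            coth (x l - x m) * coth (x l - x k)) := by
        simp only [Finset.sum_add_distrib, e2, e3, hTdef]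
      have h5 : ∀ m k : Fin N, ∑ l : Fin N, (coth (x m - x k) * coth (x m - x l) +
          coth (x k - x m) * coth (x k - x l) + coth (x l - x m) * coth (x l - x k)) =
          N - 2 + (if m = k then 2 - (N : ℝ) else 0) + coth (x m - x k) ^ 2 +
            coth (x k - x m) ^ 2 + if m = k then ∑ l, coth (x l - x m) ^ 2 else 0 := by
        intro m k
        simp only [coth_triple hx]
        by_cases hmk : m = k
        · simp [hmk, Finset.sum_add_distrib, Finset.sum_sub_distrib]
          ring
        · simp [hmk, Finset.sum_add_distrib, Finset.sum_sub_distrib]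
          ring
      rw [h4]
      simp only [h5, Finset.sum_add_distrib, Finset.sum_ite_eq, Finset.mem_univ, if_true,
        Finset.sum_const, Finset.card_univ, Fintype.card_fin, nsmul_eq_mul]
      rw [Finset.sum_comm (f := fun m k : Fin N => coth (x k - x m) ^ 2)]
      ring
    rw [e1]
    rw [hsq] at h3
    linarith
  unfold cothSum
  have := congrArg (fun t : ℝ => (t : ℂ)) hT
  push_cast at this ⊢
  exact this

end Prefactor

/-! ### The wave function -/

section PartialDeriv

variable {N : ℕ} {f g : (Fin N → ℝ) → ℂ} {x : Fin N → ℝ} (n : Fin N)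

theorem partialDeriv_mul (hf : DifferentiableAt ℝ f x) (hg : DifferentiableAt ℝ g x) :
    partialDeriv n (fun y => f y * g y) x =
      partialDeriv n f x * g x + f x * partialDeriv n g x := by
  rw [partialDeriv, fderiv_fun_mul hf hg]
  simp [partialDeriv]
  ring

theorem partialDeriv_add (hf : DifferentiableAt ℝ f x) (hg : DifferentiableAt ℝ g x) :
    partialDeriv n (fun y => f y + g y) x = partialDeriv n f x + partialDeriv n g x := by
  rw [partialDeriv, fderiv_fun_add hf hg]
  simp [partialDeriv]

theorem partialDeriv_const_mul (hf : DifferentiableAt ℝ f x) (c : ℂ) :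
    partialDeriv n (fun y => c * f y) x = c * partialDeriv n f x := by
  rw [partialDeriv, fderiv_const_mul hf]
  simp [partialDeriv]

theorem partialDeriv_congr (h : f =ᶠ[nhds x] g) : partialDeriv n f x = partialDeriv n g x := by
  rw [partialDeriv, h.fderiv_eq, partialDeriv]

end PartialDeriv

section Product

variable {N : ℕ} {J : (Fin N → ℝ) → ℂ} (hJ : ContDiff ℝ ∞ J) {x : Fin N → ℝ}

theorem differentiable_partialDeriv (hJ : ContDiff ℝ ∞ J) (m : Fin N) :
    Differentiable ℝ (partialDeriv m J) := by
  have : ContDiff ℝ 1 (fderiv ℝ J) := hJ.fderiv_right (by norm_cast)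
  exact (this.differentiable one_ne_zero).clm_apply (differentiable_const _)

include hJ in
theorem partialDeriv_sinhFactor_mul (hx : x ∈ regularSet N) (m : Fin N) :
    partialDeriv m (fun y => sinhFactor y * J y) x =
      sinhFactor x * (1 / 2 * (cothSum m x * J x) + partialDeriv m J x) := by
  rw [partialDeriv_mul m ((contDiffAt_sinhFactor hx).differentiableAt (by simp))
    (hJ.differentiable (by simp) x), partialDeriv_sinhFactor hx]
  ring

include hJ in
theorem differentiableAt_sinhFactor_mul_add (hx : x ∈ regularSet N) (m : Fin N) : DifferentiableAt ℝ
    (fun y => sinhFactor y * (1 / 2 * (cothSum m y * J y) + partialDeriv m J y)) x := by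
  have h1 := (contDiffAt_sinhFactor hx).differentiableAt (by simp)
  have h2 := (hasFDerivAt_cothSum hx m).differentiableAt
  have h3 := hJ.differentiable (by simp) x
  have h4 := differentiable_partialDeriv hJ m x
  fun_prop

include hJ in
theorem partialDeriv_partialDeriv_sinhFactor_mul (hx : x ∈ regularSet N) {m n : Fin N}
    (hmn : m ≠ n) :
    DifferentiableAt ℝ (partialDeriv m (fun y => sinhFactor y * J y)) x ∧
    partialDeriv n (partialDeriv m (fun y => sinhFactor y * J y)) x =
      sinhFactor x * (1 / 4 * cothSum m x * cothSum n x * J x +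
        1 / 2 * ((1 / Real.sinh (x m - x n) ^ 2 : ℝ) : ℂ) * J x +
        1 / 2 * cothSum m x * partialDeriv n J x + 1 / 2 * cothSum n x * partialDeriv m J x +
        partialDeriv n (partialDeriv m J) x) := by
  have hev : partialDeriv m (fun y => sinhFactor y * J y) =ᶠ[nhds x]
      fun y => sinhFactor y * (1 / 2 * (cothSum m y * J y) + partialDeriv m J y) := by
    filter_upwards [(isOpen_regularSet N).mem_nhds hx] with y hy
    exact partialDeriv_sinhFactor_mul hJ hy m
  refine ⟨(differentiableAt_sinhFactor_mul_add hJ hx m).congr_of_eventuallyEq hev, ?_⟩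
  have h1 := (contDiffAt_sinhFactor hx).differentiableAt (𝕜 := ℝ) (by simp)
  have h2 := (hasFDerivAt_cothSum hx m).differentiableAt
  have h3 := hJ.differentiable (by simp) x
  have h4 := differentiable_partialDeriv hJ m x
  rw [partialDeriv_congr n hev, partialDeriv_mul n h1 (by fun_prop),
    partialDeriv_add n (by fun_prop) h4, partialDeriv_const_mul n (h2.fun_mul h3),
    partialDeriv_mul n h2 h3, partialDeriv_sinhFactor hx, partialDeriv_cothSum hx hmn]
  ring

end Product

section Eigenfunction

variable {N : ℕ} {ħ : ℝ} (hħ : 0 < ħ) (a : Fin N → ℝ) {x : Fin N → ℝ}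

theorem waveFunction_eq : waveFunction ħ a = fun x => sinhFactor x *
    transform ħ a (fun γ => kernel N 0 (scaledArray ħ a γ)) x := by
  funext x
  rw [waveFunction, integral_integrand]

include hħ in
theorem hamiltonian₁_waveFunction (hx : x ∈ regularSet N) :
    hamiltonian₁ ħ (waveFunction ħ a) x = ((∑ n, a n : ℝ) : ℂ) * waveFunction ħ a x := by
  have hk := isExpDecaying_kernel ħ a hħ
  have hJ := hk.contDiff_transform ħ a
  have hħ' : (ħ : ℂ) ≠ 0 := Complex.ofReal_ne_zero.2 hħ.ne'
  have h1 := hk.sum_transform (ħ := ħ) a x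
  have h2 : ∑ n, partialDeriv n (transform ħ a fun γ => kernel N 0 (scaledArray ħ a γ)) x =
      -((∑ m, (a m : ℂ)) / (Complex.I * ħ) *
        transform ħ a (fun γ => kernel N 0 (scaledArray ħ a γ)) x) := by
    rw [← h1, ← Finset.sum_neg_distrib]
    simp only [hk.partialDeriv_transform]
  rw [hamiltonian₁, waveFunction_eq]
  simp only [momentum, partialDeriv_sinhFactor_mul hJ hx, ← Finset.mul_sum,
    Finset.sum_add_distrib, ← Finset.sum_mul, sum_cothSum, h2]
  push_cast
  field_simp
  ring

/-- The algebra behind the second differential equation: `c`, `G`, `H` stand for the sums of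
hyperbolic cotangents and for the first and second derivatives of the integral `J`. -/
theorem sum_Iio_hamiltonian {ħ' σ₁ σ₂ κ J : ℂ} (hħ : ħ' ≠ 0) (c G : Fin N → ℂ)
    (s H : Fin N → Fin N → ℂ) (hs : ∀ m n, s m n = s n m) (hs0 : ∀ n, s n n = 0)
    (hH : ∀ m n, H m n = H n m) (hc : ∑ m, c m = 0)
    (hc2 : ∑ m, c m ^ 2 = (N : ℂ) * (N - 1) * (N - 2) / 3 + (N : ℂ) ^ 2 - N + ∑ m, ∑ n, s m n)
    (hκ : κ = (N : ℂ) * (N - 1) * (N + 1) / 12)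
    (hH1 : ∑ m, ∑ n, H m n = -(σ₁ ^ 2 / ħ' ^ 2) * J)
    (hH2 : ∑ m, c m * G m = -((∑ n, H n n) + (σ₂ / ħ' ^ 2 + κ) * J)) :
    ∑ n, ∑ m ∈ Finset.Iio n, -ħ' ^ 2 * (1 / 4 * c m * c n * J + 1 / 4 * s m n * J +
      1 / 2 * c m * G n + 1 / 2 * c n * G m + H m n) = (σ₁ ^ 2 - σ₂) / 2 * J := by
  have h := sum_Iio_comm (fun m n : Fin N => -ħ' ^ 2 * (1 / 4 * c m * c n * J + 1 / 4 * s m n * J +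
      1 / 2 * c m * G n + 1 / 2 * c n * G m + H m n)) (fun m n => by
    rw [hs, hH]; ring)
  have e1 : ∑ n, ∑ m, -ħ' ^ 2 * (1 / 4 * c m * c n * J + 1 / 4 * s m n * J +
      1 / 2 * c m * G n + 1 / 2 * c n * G m + H m n) =
      -ħ' ^ 2 * (1 / 4 * (∑ m, ∑ n, s m n) * J + ∑ m, ∑ n, H m n) := by
    have t1 : ∀ n, ∑ m, 1 / 4 * c m * c n * J = 0 := fun n => by
      rw [← Finset.sum_mul, ← Finset.sum_mul, ← Finset.mul_sum, hc]; ring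
    have t2 : ∀ n, ∑ m, 1 / 2 * c m * G n = 0 := fun n => by
      rw [← Finset.sum_mul, ← Finset.mul_sum, hc]; ring
    have t3 : ∑ n, ∑ m, 1 / 2 * c n * G m = 0 := by
      rw [Finset.sum_comm]
      refine Finset.sum_eq_zero fun n _ => ?_
      rw [← Finset.sum_mul, ← Finset.mul_sum, hc]; ring
    simp only [← Finset.mul_sum, Finset.sum_add_distrib] at t1 t2 t3 ⊢
    simp only [t1, t2, t3, Finset.sum_const_zero]
    rw [Finset.sum_comm (f := fun m n => s m n), Finset.sum_comm (f := fun m n => H m n)]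
    simp only [← Finset.sum_mul, ← Finset.mul_sum]
    ring
  have e2 : ∑ n, -ħ' ^ 2 * (1 / 4 * c n * c n * J + 1 / 4 * s n n * J +
      1 / 2 * c n * G n + 1 / 2 * c n * G n + H n n) =
      -ħ' ^ 2 * (1 / 4 * (∑ m, c m ^ 2) * J + (∑ m, c m * G m) + ∑ n, H n n) := by
    rw [Finset.mul_sum, Finset.sum_mul, ← Finset.sum_add_distrib, ← Finset.sum_add_distrib,
      Finset.mul_sum]
    refine Finset.sum_congr rfl fun n _ => ?_
    rw [hs0]
    ring
  rw [e1, e2, hH1, hc2, hH2, hκ] at h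
  have h' : (σ₁ ^ 2 - σ₂) * J = -ħ' ^ 2 * (1 / 4 * (∑ m, ∑ n, s m n) * J +
      -(σ₁ ^ 2 / ħ' ^ 2) * J) - -ħ' ^ 2 * (1 / 4 * ((N : ℂ) * (N - 1) * (N - 2) / 3 +
      (N : ℂ) ^ 2 - N + ∑ m, ∑ n, s m n) * J + -((∑ n, H n n) +
      (σ₂ / ħ' ^ 2 + (N : ℂ) * (N - 1) * (N + 1) / 12) * J) + ∑ n, H n n) := by
    field_simp
    ring
  rw [← h'] at h
  linear_combination h / 2

theorem sum_range_mul_succ (N : ℕ) :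
    ∑ n ∈ Finset.range N, (n : ℂ) * (n + 1) / 4 = (N : ℂ) * (N - 1) * (N + 1) / 12 := by
  induction N with
  | zero => simp
  | succ N ih =>
    rw [Finset.sum_range_succ, ih]
    push_cast
    ring

include hħ in
theorem hamiltonian₂_waveFunction (hx : x ∈ regularSet N) :
    hamiltonian₂ ħ (waveFunction ħ a) x =
      ((∑ n, ∑ m ∈ Finset.Iio n, a m * a n : ℝ) : ℂ) * waveFunction ħ a x := by
  have hk := isExpDecaying_kernel ħ a hħ
  have hJ := hk.contDiff_transform ħ a
  have hħ' : (ħ : ℂ) ≠ 0 := Complex.ofReal_ne_zero.2 hħ.ne'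
  have hpde := sum_coth_mul_partialDeriv hħ a x hx
  set J := transform ħ a fun γ => kernel N 0 (scaledArray ħ a γ) with hJdef
  have hsymm : ∀ m n : Fin N, partialDeriv n (partialDeriv m J) x =
      partialDeriv m (partialDeriv n J) x := fun m n => by
    rw [hJdef, hk.partialDeriv_partialDeriv_transform, hk.partialDeriv_partialDeriv_transform]
    congr 1
    funext γ
    ring
  have hH1 : ∑ m, ∑ n, partialDeriv n (partialDeriv m J) x =
      -((∑ m, (a m : ℂ)) ^ 2 / (ħ : ℂ) ^ 2) * J x := by
    have h1 := fun m : Fin N => (hk.mul_rowSumDiff ħ a m).sum_transform (ħ := ħ) a x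
    have h2 := hk.sum_transform (ħ := ħ) a x
    simp only [hJdef, hk.partialDeriv_partialDeriv_transform, h1, ← Finset.mul_sum, h2]
    rw [← mul_assoc, div_mul_div_comm, mul_mul_mul_comm, Complex.I_mul_I]
    congr 1
    field_simp
  have hH2 : ∑ n : Fin N, ∑ i ∈ Finset.Iio n, (coth (x i - x n) : ℂ) *
      (partialDeriv i J x - partialDeriv n J x) = ∑ m, cothSum m x * partialDeriv m J x := by
    have hn : ∀ i j : Fin N, coth (x i - x j) = -coth (x j - x i) := fun i j => by
      rw [← neg_sub, coth_neg]
    have h := sum_Iio_comm (fun i n : Fin N => (coth (x i - x n) : ℂ) *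
      (partialDeriv i J x - partialDeriv n J x)) (fun i n => by
        rw [hn n i]; push_cast; ring)
    have h1 : ∑ n : Fin N, ∑ i : Fin N, (coth (x i - x n) : ℂ) *
        (partialDeriv i J x - partialDeriv n J x) =
        (∑ m, cothSum m x * partialDeriv m J x) + ∑ m, cothSum m x * partialDeriv m J x := by
      simp only [mul_sub, Finset.sum_sub_distrib]
      rw [Finset.sum_comm]
      simp only [cothSum, Finset.sum_mul, sub_eq_add_neg, ← Finset.sum_neg_distrib]
      congr 1
      refine Finset.sum_congr rfl fun n _ => Finset.sum_congr rfl fun i _ => ?_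
      rw [← sub_eq_add_neg, ← sub_eq_add_neg, hn i n]
      push_cast
      ring
    simp only [h1, sub_self, mul_zero, Finset.sum_const_zero, sub_zero] at h
    linear_combination h / 2
  rw [hH2] at hpde
  have hfin := sum_Iio_hamiltonian (κ := ∑ n ∈ Finset.range N, (n : ℂ) * (n + 1) / 4)
    hħ' (fun m => cothSum m x) (fun m => partialDeriv m J x)
    (fun m n => ((1 / Real.sinh (x m - x n) ^ 2 : ℝ) : ℂ))
    (fun m n => partialDeriv n (partialDeriv m J) x)
    (fun m n => by rw [← neg_sub, Real.sinh_neg, neg_sq]) (fun n => by simp)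
    hsymm sum_cothSum (sum_cothSum_sq hx) (sum_range_mul_succ N) hH1 hpde
  have hσ : ((∑ n, ∑ m ∈ Finset.Iio n, a m * a n : ℝ) : ℂ) =
      ((∑ m, (a m : ℂ)) ^ 2 - ∑ m, (a m : ℂ) ^ 2) / 2 := by
    have h := sum_Iio_comm (fun m n : Fin N => (a m : ℂ) * a n) (fun m n => mul_comm _ _)
    have h1 : ∑ n, ∑ m, (a m : ℂ) * a n = (∑ m, (a m : ℂ)) ^ 2 := by
      rw [pow_two, Finset.sum_mul_sum, Finset.sum_comm]
    rw [h1] at h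
    push_cast
    simp only [pow_two] at h ⊢
    linear_combination h / 2
  rw [hσ, waveFunction_eq, hamiltonian₂, ← hJdef, mul_left_comm, ← hfin, Finset.mul_sum]
  refine Finset.sum_congr rfl fun n _ => ?_
  rw [Finset.mul_sum]
  refine Finset.sum_congr rfl fun m hm => ?_
  have hmn := (Finset.mem_Iio.1 hm).ne
  obtain ⟨h1, h2⟩ := partialDeriv_partialDeriv_sinhFactor_mul hJ hx hmn
  unfold momentum
  rw [partialDeriv_const_mul n h1, h2]
  push_cast
  linear_combination (sinhFactor x * (1 / 4 * cothSum m x * cothSum n x * J x +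
        1 / 2 * (1 / Complex.sinh (x m - x n) ^ 2) * J x +
        1 / 2 * cothSum m x * partialDeriv n J x + 1 / 2 * cothSum n x * partialDeriv m J x +
        partialDeriv n (partialDeriv m J) x)) * ħ ^ 2 * Complex.I_sq

theorem weight_nonneg (γ : Tri N → ℝ) : 0 ≤ weight ħ a γ :=
  Finset.prod_nonneg fun _ _ => div_nonneg
    (Finset.prod_nonneg fun _ _ => Finset.prod_nonneg fun _ _ => by positivity)
    (Finset.prod_nonneg fun _ _ => Finset.prod_nonneg fun _ _ => by positivity)

theorem weight_ne_zero (γ : Tri N → ℝ) (hγ : ∀ r < N, ∀ s < r, ∀ p < r, s ≠ p →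
      scaledArray ħ a γ r s ≠ scaledArray ħ a γ r p) : weight ħ a γ ≠ 0 := by
  refine Finset.prod_ne_zero_iff.2 fun n hn => div_ne_zero
    (Finset.prod_ne_zero_iff.2 fun k _ => Finset.prod_ne_zero_iff.2 fun m _ => ?_)
    (Finset.prod_ne_zero_iff.2 fun p hp => Finset.prod_ne_zero_iff.2 fun s hs => ?_)
  · refine pow_ne_zero 2 (norm_ne_zero_iff.2 (Complex.Gamma_ne_zero_of_re_pos ?_))
    rw [Complex.add_re, mul_assoc, mul_comm (2 : ℂ), ← div_div, Complex.div_ofNat_re]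
    have := scaledArray_re (ħ := ħ) a γ n k
    have h2 := scaledArray_re (ħ := ħ) a γ (n + 1) m
    rw [scaledArray] at this h2
    rw [Complex.ofReal_sub, sub_div, Complex.sub_re, this, h2]
    norm_num
  · refine pow_ne_zero 2 (norm_ne_zero_iff.2 (Complex.Gamma_ne_zero fun m h => ?_))
    rw [Finset.mem_range] at hp hs
    rw [Finset.mem_Ico] at hn
    rw [Complex.ofReal_sub, sub_div] at h
    change scaledArray ħ a γ n s - scaledArray ħ a γ n p = _ at h
    have hre := congrArg Complex.re h
    rw [Complex.sub_re, scaledArray_re, scaledArray_re] at hre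
    simp at hre
    refine hγ n hn.2 s (hs.trans hp) p hp hs.ne (sub_eq_zero.1 ?_)
    rw [h, hre]
    simp

include hħ in
/-- At `x = 0` the integrand is nonnegative, and positive almost everywhere. -/
theorem transform_kernel_zero_ne_zero :
    transform ħ a (fun γ => kernel N 0 (scaledArray ħ a γ)) 0 ≠ 0 := by
  have hk := isExpDecaying_kernel ħ a hħ
  have e : transform ħ a (fun γ => kernel N 0 (scaledArray ħ a γ)) 0 =
      ((∫ γ, weight ħ a γ : ℝ) : ℂ) := by
    rw [transform, ← integral_complex_ofReal]
    refine MeasureTheory.integral_congr_ae (Filter.Eventually.of_forall fun γ => ?_)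
    simp [phase, weight_eq_kernel]
  rw [e, Complex.ofReal_ne_zero]
  have hi : MeasureTheory.Integrable fun γ => weight ħ a γ := by
    have := hk.integrable.re
    refine this.congr (Filter.Eventually.of_forall fun γ => ?_)
    simp [← weight_eq_kernel]
  intro h
  rw [MeasureTheory.integral_eq_zero_iff_of_nonneg (fun γ => weight_nonneg a γ) hi] at h
  obtain ⟨γ, h1, h2⟩ := (h.and (ae_scaledArray_ne a hħ.ne')).exists
  exact weight_ne_zero a γ h2 h1

include hħ in
theorem isEigenfunction_waveFunction : IsEigenfunction ħ a (waveFunction ħ a) where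
  smooth := by
    have hJ := (isExpDecaying_kernel ħ a hħ).contDiff_transform ħ a
    rw [waveFunction_eq]
    intro x hx
    exact ((contDiffAt_sinhFactor hx).mul hJ.contDiffAt).contDiffWithinAt
  eq₁ x hx := hamiltonian₁_waveFunction hħ a hx
  eq₂ x hx := hamiltonian₂_waveFunction hħ a hx
  ne_zero := by
    have hJ := (isExpDecaying_kernel ħ a hħ).contDiff_transform ħ a
    -- the integral is nonzero at the origin, hence at nearby points of the chamber
    have hc : Continuous fun ε : ℝ => transform ħ a (fun γ => kernel N 0 (scaledArray ħ a γ))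
        (fun i : Fin N => ε * -(i : ℝ)) := hJ.continuous.comp (by fun_prop)
    have h0 : ∀ᶠ ε : ℝ in nhds 0, transform ħ a (fun γ => kernel N 0 (scaledArray ħ a γ))
        (fun i : Fin N => ε * -(i : ℝ)) ≠ 0 := by
      refine hc.continuousAt.eventually_ne ?_
      simp only [zero_mul]
      exact transform_kernel_zero_ne_zero hħ a
    obtain ⟨ε, hε, hpos⟩ := ((h0.filter_mono nhdsWithin_le_nhds).and
      (self_mem_nhdsWithin (s := Set.Ioi (0 : ℝ)))).exists
    have hanti : StrictAnti fun i : Fin N => ε * -(i : ℝ) := fun i j hij => by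
      have : (i : ℝ) < j := by exact_mod_cast hij
      exact mul_lt_mul_of_pos_left (neg_lt_neg this) hpos
    refine ⟨_, hanti, ?_⟩
    rw [waveFunction_eq]
    exact mul_ne_zero (sinhFactor_ne_zero hanti.injective) hε

end Eigenfunction

/-! ### The Whittaker vector -/

section Vec

variable {N : ℕ} {ħ : ℝ}

theorem entry_shift (a : Fin N → ℂ) (γ : Tri N → ℂ) (n : Fin N) (j : Fin (n : ℕ)) (c : ℂ)
    (r k : ℕ) :
    entry a (shift n j c γ) r k = entry a γ r k + if r = n ∧ k = j then c else 0 := by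
  by_cases hr : r < N
  · by_cases hk : k < r
    · rw [entry_of_lt _ _ hr hk, entry_of_lt _ _ hr hk, shift]
      by_cases h : r = n ∧ k = j
      · obtain ⟨rfl, rfl⟩ := h
        simp
      · rw [if_neg h, add_zero, Function.update_of_ne]
        intro h'
        apply h
        obtain ⟨n, hn⟩ := n
        simp only [Sigma.mk.injEq, Fin.mk.injEq] at h'
        obtain ⟨rfl, h2⟩ := h'
        rw [heq_eq_eq] at h2
        exact ⟨rfl, congrArg Fin.val h2⟩
    · rw [entry_eq_zero _ _ (by omega), entry_eq_zero _ _ (by omega), if_neg, add_zero]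
      rintro ⟨rfl, rfl⟩
      exact hk j.2
  · have hne : r ≠ n := fun h => hr (h ▸ n.2)
    rw [if_neg fun h => hne h.1, add_zero, entry, entry]
    simp [hr]

/-- The function `z ↦ (2ħ)ᶻ Γ(z)`, a rescaled Gamma function. -/
def scaledGamma (ħ : ℝ) (z : ℂ) : ℂ := ((2 * ħ : ℝ) : ℂ) ^ z * Complex.Gamma z

theorem scaledGamma_add_one (hħ : 0 < ħ) {z : ℂ} (hz : z ≠ 0) :
    scaledGamma ħ (z + 1) = 2 * ħ * z * scaledGamma ħ z := by
  have h : ((2 * ħ : ℝ) : ℂ) ≠ 0 := Complex.ofReal_ne_zero.2 (by positivity)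
  rw [scaledGamma, scaledGamma, Complex.cpow_add _ _ h, Complex.cpow_one, Complex.Gamma_add_one _ hz]
  push_cast
  ring

/-- The argument of the Gamma function that belongs to two entries `u`, `t` in adjacent rows. -/
def gammaArg (ħ : ℝ) (u t : ℂ) : ℂ := (u - t) / (2 * Complex.I * (ħ : ℂ)) + 1 / 4

/-- The effect of moving the lower entry `u` by `±iħ`: the two results differ by a linear factor. -/
theorem scaledGamma_shift_left (hħ : 0 < ħ) {u t : ℂ}
    (h : (u - t) / (Complex.I * (ħ : ℂ)) + 1 / 2 ≠ 1) :
    -Complex.I * (u - t - Complex.I * ħ / 2) *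
        scaledGamma ħ (gammaArg ħ (u + -(Complex.I * ħ)) t) =
      scaledGamma ħ (gammaArg ħ (u + Complex.I * ħ) t) := by
  have hħ' : (ħ : ℂ) ≠ 0 := Complex.ofReal_ne_zero.2 hħ.ne'
  have hI := Complex.I_ne_zero
  have e : gammaArg ħ (u + Complex.I * ħ) t = gammaArg ħ (u + -(Complex.I * ħ)) t + 1 := by
    rw [gammaArg, gammaArg]
    field_simp
    ring
  have e2 : 2 * gammaArg ħ (u + -(Complex.I * ħ)) t =
      (u - t) / (Complex.I * (ħ : ℂ)) + 1 / 2 - 1 := by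
    rw [gammaArg]
    field_simp
    ring
  have h0 : gammaArg ħ (u + -(Complex.I * ħ)) t ≠ 0 := fun h0 => h (by
    rw [h0] at e2
    linear_combination -e2)
  rw [e, scaledGamma_add_one hħ h0]
  congr 1
  rw [mul_right_comm, e2]
  field_simp
  linear_combination (Complex.I * ħ - 2 * (u - t)) * Complex.I_sq

theorem scaledGamma_shift_right (hħ : 0 < ħ) {u t : ℂ}
    (h : (u - t) / (Complex.I * (ħ : ℂ)) + 1 / 2 ≠ 1) :
    scaledGamma ħ (gammaArg ħ u (t + -(Complex.I * ħ))) =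
      Complex.I * (t - u + Complex.I * ħ / 2) *
        scaledGamma ħ (gammaArg ħ u (t + Complex.I * ħ)) := by
  have e1 : gammaArg ħ u (t + -(Complex.I * ħ)) = gammaArg ħ (u + Complex.I * ħ) t := by
    rw [gammaArg, gammaArg]; congr 2; ring
  have e2 : gammaArg ħ u (t + Complex.I * ħ) = gammaArg ħ (u + -(Complex.I * ħ)) t := by
    rw [gammaArg, gammaArg]; congr 2; ring
  rw [e1, e2, ← scaledGamma_shift_left hħ h]
  ring

/-- The product of Gamma functions in `vec`. -/
def gammaProd (ħ : ℝ) (a : Fin N → ℂ) (γ : Tri N → ℂ) : ℂ :=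
  ∏ n ∈ Finset.range N, ∏ k ∈ Finset.range n, ∏ m ∈ Finset.range (n + 1),
    scaledGamma ħ (gammaArg ħ (entry a γ n k) (entry a γ (n + 1) m))

/-- The sum in the exponent of `vec`. -/
def rhoSum (a : Fin N → ℂ) (γ : Tri N → ℂ) : ℂ :=
  ∑ n ∈ Finset.Ico 1 N, ((n : ℂ) - 1) * ∑ j ∈ Finset.range n, entry a γ n j

theorem vec_eq (a : Fin N → ℂ) (γ : Tri N → ℂ) :
    vec ħ a γ = Complex.exp (-((Real.pi / (2 * ħ) : ℝ) : ℂ) * rhoSum a γ) * gammaProd ħ a γ := by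
  rw [gammaProd, prod_range_eq_prod_Ico_one _ (by simp)]
  rfl

theorem rhoSum_shift (a : Fin N → ℂ) (γ : Tri N → ℂ) (n : Fin N) (hn : 1 ≤ (n : ℕ))
    (j : Fin (n : ℕ)) (c : ℂ) : rhoSum a (shift n j c γ) = rhoSum a γ + ((n : ℂ) - 1) * c := by
  simp only [rhoSum, entry_shift, Finset.sum_add_distrib, mul_add]
  congr 1
  rw [Finset.sum_eq_single (n : ℕ)]
  · simp
  · intro r _ hr
    simp [hr]
  · intro h
    exact absurd (Finset.mem_Ico.2 ⟨hn, n.2⟩) h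

/-- The two operators move `γ ⟨n, j⟩` in opposite directions. By the functional equation of the
Gamma function the results agree up to the polynomials in their coefficients and powers of `i`. -/
theorem gammaProd_shift (hħ : 0 < ħ) (a : Fin N → ℂ) {γ : Tri N → ℂ} (hγ : γ ∈ genericSet ħ a)
    (n : Fin N) (j : Fin (n : ℕ)) :
    (-Complex.I) ^ ((n : ℕ) + 1) * (∏ r ∈ Finset.range ((n : ℕ) + 1),
        (γ ⟨n, j⟩ - entry a γ ((n : ℕ) + 1) r - Complex.I * (ħ : ℂ) / 2)) *
        gammaProd ħ a (shift n j (-(Complex.I * (ħ : ℂ))) γ) =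
      Complex.I ^ ((n : ℕ) - 1) * (∏ r ∈ Finset.range ((n : ℕ) - 1),
        (γ ⟨n, j⟩ - entry a γ ((n : ℕ) - 1) r + Complex.I * (ħ : ℂ) / 2)) *
        gammaProd ħ a (shift n j (Complex.I * (ħ : ℂ)) γ) := by
  have hn0 : 0 < (n : ℕ) := lt_of_le_of_lt (Nat.zero_le _) j.2
  have hy : γ ⟨n, j⟩ = entry a γ n j := (entry_of_lt a γ n.2 j.2).symm
  set A : ℕ → ℕ → ℕ → ℂ := fun r k m => if r = n ∧ k = j then
    -Complex.I * (entry a γ n j - entry a γ (r + 1) m - Complex.I * ħ / 2) else 1 with hA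
  set B : ℕ → ℕ → ℕ → ℂ := fun r k m => if r + 1 = n ∧ m = j then
    Complex.I * (entry a γ n j - entry a γ r k + Complex.I * ħ / 2) else 1 with hB
  have hAprod : ∏ r ∈ Finset.range N, ∏ k ∈ Finset.range r, ∏ m ∈ Finset.range (r + 1), A r k m =
      (-Complex.I) ^ ((n : ℕ) + 1) * ∏ r ∈ Finset.range ((n : ℕ) + 1),
        (γ ⟨n, j⟩ - entry a γ ((n : ℕ) + 1) r - Complex.I * (ħ : ℂ) / 2) := by
    have hcard : (-Complex.I) ^ ((n : ℕ) + 1) =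
        ∏ r ∈ Finset.range ((n : ℕ) + 1), -Complex.I := by simp
    rw [Finset.prod_eq_single (n : ℕ), Finset.prod_eq_single (j : ℕ), hy, hcard,
      ← Finset.prod_mul_distrib]
    · exact Finset.prod_congr rfl fun m _ => if_pos ⟨rfl, rfl⟩
    · intro k _ hk
      exact Finset.prod_eq_one fun m _ => if_neg fun h => hk h.2
    · intro h
      exact absurd (Finset.mem_range.2 j.2) h
    · intro r _ hr
      exact Finset.prod_eq_one fun k _ => Finset.prod_eq_one fun m _ => if_neg fun h => hr h.1
    · intro h
      exact absurd (Finset.mem_range.2 n.2) h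
  have hBprod : ∏ r ∈ Finset.range N, ∏ k ∈ Finset.range r, ∏ m ∈ Finset.range (r + 1), B r k m =
      Complex.I ^ ((n : ℕ) - 1) * ∏ r ∈ Finset.range ((n : ℕ) - 1),
        (γ ⟨n, j⟩ - entry a γ ((n : ℕ) - 1) r + Complex.I * (ħ : ℂ) / 2) := by
    have hcard : Complex.I ^ ((n : ℕ) - 1) = ∏ r ∈ Finset.range ((n : ℕ) - 1), Complex.I := by simp
    rw [Finset.prod_eq_single ((n : ℕ) - 1), hy, hcard, ← Finset.prod_mul_distrib]
    · refine Finset.prod_congr rfl fun k _ => ?_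
      rw [Finset.prod_eq_single (j : ℕ)]
      · exact if_pos ⟨by omega, rfl⟩
      · intro m _ hm
        exact if_neg fun h => hm h.2
      · intro h
        exact absurd (Finset.mem_range.2 (by have := j.2; omega)) h
    · intro r _ hr
      exact Finset.prod_eq_one fun k _ => Finset.prod_eq_one fun m _ =>
        if_neg fun h => hr (by omega)
    · intro h
      exact absurd (Finset.mem_range.2 (by have := n.2; omega)) h
  rw [← hAprod, ← hBprod, gammaProd, gammaProd]
  simp only [← Finset.prod_mul_distrib]
  refine Finset.prod_congr rfl fun r hr => Finset.prod_congr rfl fun k hk =>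
    Finset.prod_congr rfl fun m hm => ?_
  have hgen : (entry a γ r k - entry a γ (r + 1) m) / (Complex.I * (ħ : ℂ)) + 1 / 2 ≠ 1 := by
    rw [Finset.mem_range] at hr hk
    have := hγ.2 r (Finset.mem_Ico.2 ⟨by omega, hr⟩) k (Finset.mem_range.2 hk) m hm 1
    rwa [Int.cast_one] at this
  simp only [entry_shift, hA, hB]
  by_cases h1 : r = n ∧ k = j
  · obtain ⟨rfl, rfl⟩ := h1
    simp only [and_self, if_true, Nat.succ_ne_self, false_and, if_false, add_zero, one_mul]
    exact scaledGamma_shift_left hħ hgen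
  · by_cases h2 : r + 1 = n ∧ m = j
    · obtain ⟨h2, rfl⟩ := h2
      rw [if_neg h1, if_neg h1, if_neg h1, if_pos ⟨h2, rfl⟩, if_pos ⟨h2, rfl⟩, if_pos ⟨h2, rfl⟩,
        add_zero, one_mul, scaledGamma_shift_right hħ hgen, h2]
    · simp only [if_neg h1, if_neg h2, add_zero, one_mul]

/-- The operators `E_{n,n+1}` and `E_{n+1,n}` agree on `vec` term by term. -/
theorem raising_vec_sub_lowering_vec (hħ : 0 < ħ) (a : Fin N → ℂ) (n : Fin N) (hn : 1 ≤ (n : ℕ))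
    {γ : Tri N → ℂ} (hγ : γ ∈ genericSet ħ a) :
    raising ħ a n (vec ħ a) γ - lowering ħ a n (vec ħ a) γ = 0 := by
  rw [sub_eq_zero, raising, lowering, neg_mul, ← mul_neg, ← Finset.sum_neg_distrib]
  congr 1
  refine Finset.sum_congr rfl fun j _ => ?_
  rw [div_mul_eq_mul_div, div_mul_eq_mul_div, ← neg_div]
  congr 1
  have hħ' : (ħ : ℂ) ≠ 0 := Complex.ofReal_ne_zero.2 hħ.ne'
  have hexp : ∀ s : ℂ, Complex.exp (-((Real.pi / (2 * ħ) : ℝ) : ℂ) *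
      (rhoSum a γ + ((n : ℂ) - 1) * (s * (Complex.I * ħ)))) =
      Complex.exp (-((Real.pi / (2 * ħ) : ℝ) : ℂ) * rhoSum a γ) *
        Complex.exp (-s * (Real.pi / 2 * Complex.I)) ^ ((n : ℕ) - 1) := by
    intro s
    rw [← Complex.exp_nat_mul, ← Complex.exp_add, Nat.cast_sub hn]
    congr 1
    push_cast
    field_simp
    ring
  have h1 := hexp (-1)
  have h2 := hexp 1
  rw [neg_neg, one_mul, Complex.exp_pi_div_two_mul_I, neg_one_mul] at h1
  rw [one_mul, neg_one_mul, Complex.exp_neg, Complex.exp_pi_div_two_mul_I, Complex.inv_I] at h2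
  rw [vec_eq, vec_eq, rhoSum_shift a γ n hn, rhoSum_shift a γ n hn, h1, h2]
  have key := gammaProd_shift hħ a hγ n j
  obtain ⟨q, hq⟩ : ∃ q, (n : ℕ) = q + 1 := ⟨n - 1, by omega⟩
  set X := gammaProd ħ a (shift n j (-(Complex.I * (ħ : ℂ))) γ)
  set Y := gammaProd ħ a (shift n j (Complex.I * (ħ : ℂ)) γ)
  set E := Complex.exp (-((Real.pi / (2 * ħ) : ℝ) : ℂ) * rhoSum a γ)
  set P := ∏ r ∈ Finset.range ((n : ℕ) + 1),
        (γ ⟨n, j⟩ - entry a γ ((n : ℕ) + 1) r - Complex.I * (ħ : ℂ) / 2)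
  set Q := ∏ r ∈ Finset.range ((n : ℕ) - 1),
        (γ ⟨n, j⟩ - entry a γ ((n : ℕ) - 1) r + Complex.I * (ħ : ℂ) / 2)
  rw [hq, Nat.add_sub_cancel] at key ⊢
  have hI : (-Complex.I) ^ q * Complex.I ^ q = 1 := by
    rw [← mul_pow, neg_mul, Complex.I_mul_I, neg_neg, one_pow]
  have hI2 : (-Complex.I) ^ (q + 1 + 1) = -(-Complex.I) ^ q := by
    rw [pow_succ, pow_succ, mul_assoc, neg_mul_neg, Complex.I_mul_I]; ring
  rw [hI2] at key
  -- multiply the relation of the products by `Iᵠ` twice, resp. once, and use `(-I)ᵠ Iᵠ = 1`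
  have k1 : Complex.I ^ q * (P * X) = -(Complex.I ^ q * Complex.I ^ q * Complex.I ^ q * (Q * Y)) := by
    linear_combination (-(Complex.I ^ q * Complex.I ^ q)) * key - Complex.I ^ q * P * X * hI
  have k2 : Complex.I ^ q * Complex.I ^ q * Complex.I ^ q = (-Complex.I) ^ q := by
    have h4 : Complex.I ^ q * Complex.I ^ q * (Complex.I ^ q * Complex.I ^ q) = 1 := by
      rw [← mul_pow, ← mul_pow, Complex.I_mul_I]; norm_num
    linear_combination (-Complex.I) ^ q * h4 - Complex.I ^ q * Complex.I ^ q * Complex.I ^ q * hI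
  rw [k2] at k1
  linear_combination (-E) * k1

end Vec

/-! ### The matrix element -/

section Pairing

variable {N : ℕ} {ħ : ℝ} (hħ : 0 < ħ) (a : Fin N → ℝ) (γ : Tri N → ℝ)

theorem entry_ofReal (n k : ℕ) :
    entry (fun i => (a i : ℂ)) (fun t => (γ t : ℂ)) n k = ((entry a γ n k : ℝ) : ℂ) := by
  unfold entry
  split_ifs <;> simp

theorem cartan_eq (k : Fin N) :
    cartan ħ (fun i => (a i : ℂ)) k (fun t => (γ t : ℂ)) = rowSumDiff N (scaledArray ħ a γ) k := by
  rw [cartan, rowSumDiff_eq a γ k.2, mul_sub, Finset.mul_sum, Finset.mul_sum]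
  simp only [entry_ofReal, scaledArray]
  congr 1 <;> exact Finset.sum_congr rfl fun _ _ => by ring

include hħ in
/-- The density of the pairing in terms of Gamma functions, by the reflection formula. -/
theorem mul_exp_sub_exp (s p : ℝ) :
    (s - p) * (Real.exp (2 * Real.pi * p / ħ) - Real.exp (2 * Real.pi * s / ħ)) =
      -(2 * Real.pi * ħ) * Real.exp (Real.pi / ħ * (s + p)) *
        (‖Complex.Gamma (((s - p : ℝ) : ℂ) / (Complex.I * (ħ : ℂ)))‖ ^ 2)⁻¹ := by
  have hp := Real.pi_pos
  set w : ℂ := ((s - p : ℝ) : ℂ) / (Complex.I * (ħ : ℂ)) with hw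
  have hwI : w = -(((s - p) / ħ : ℝ) * Complex.I) := by
    rw [hw, ← div_div, Complex.div_I]
    push_cast
    ring
  have hconj : (starRingEnd ℂ) w = -w := by
    rw [hwI]
    simp
  have hG : ((‖Complex.Gamma w‖ ^ 2)⁻¹ : ℝ) =
      (s - p) / ħ * Real.sinh (Real.pi * ((s - p) / ħ)) / Real.pi := by
    have h1 : (((‖Complex.Gamma w‖ ^ 2)⁻¹ : ℝ) : ℂ) = -(w * Complex.sin (Real.pi * w) / Real.pi) := by
      rw [← inv_gamma_mul_gamma_neg, ← hconj, Complex.Gamma_conj, Complex.mul_conj,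
        Complex.normSq_eq_norm_sq]
      push_cast
      rfl
    have h2 : Complex.sin (Real.pi * w) = -((Real.sinh (Real.pi * ((s - p) / ħ)) : ℝ) * Complex.I) := by
      rw [hwI, mul_neg, ← mul_assoc, ← Complex.ofReal_mul, Complex.sin_neg, Complex.sin_mul_I,
        Complex.ofReal_sinh]
    apply Complex.ofReal_injective
    rw [h1, h2, hwI]
    push_cast
    linear_combination (-(((s : ℂ) - p) / ħ * Complex.sinh (Real.pi * ((s - p) / ħ)) / Real.pi)) *
      Complex.I_sq
  rw [hG, Real.sinh_eq]
  have e1 : Real.exp (2 * Real.pi * p / ħ) =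
      Real.exp (Real.pi / ħ * (s + p)) * Real.exp (-(Real.pi * ((s - p) / ħ))) := by
    rw [← Real.exp_add]; congr 1; ring
  have e2 : Real.exp (2 * Real.pi * s / ħ) =
      Real.exp (Real.pi / ħ * (s + p)) * Real.exp (Real.pi * ((s - p) / ħ)) := by
    rw [← Real.exp_add]; congr 1; ring
  rw [e1, e2]
  field_simp
  ring

theorem sum_sum_range_add (e : ℕ → ℝ) (n : ℕ) :
    ∑ p ∈ Finset.range n, ∑ s ∈ Finset.range p, (e s + e p) =
      ((n : ℝ) - 1) * ∑ j ∈ Finset.range n, e j := by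
  induction n with
  | zero => simp
  | succ n ih =>
    rw [Finset.sum_range_succ, ih, Finset.sum_add_distrib, Finset.sum_range_succ]
    simp
    ring

theorem prod_range_prod_range_const (c : ℝ) (n : ℕ) :
    ∏ p ∈ Finset.range n, ∏ _s ∈ Finset.range p, c = c ^ n.choose 2 := by
  induction n with
  | zero => simp
  | succ n ih =>
    rw [Finset.prod_range_succ, ih, Nat.choose_succ_succ' n 1, Nat.choose_one_right]
    simp [pow_add, mul_comm]

theorem prod_range_pow_choose_two (c : ℝ) (n : ℕ) :
    ∏ p ∈ Finset.range n, c ^ p.choose 2 = c ^ n.choose 3 := by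
  induction n with
  | zero => simp
  | succ n ih => rw [Finset.prod_range_succ, ih, Nat.choose_succ_succ' n 2, pow_add, mul_comm]

theorem prod_range_pow_choose_two_succ (c : ℝ) (n : ℕ) :
    ∏ p ∈ Finset.range n, c ^ (p + 1).choose 2 = c ^ (n + 1).choose 3 := by
  have := prod_range_pow_choose_two c (n + 1)
  rw [Finset.prod_range_succ'] at this
  simpa using this

include hħ in
theorem norm_scaledGamma_sq (n k m : ℕ) :
    ‖scaledGamma ħ (gammaArg ħ ((entry a γ n k : ℝ) : ℂ) ((entry a γ (n + 1) m : ℝ) : ℂ))‖ ^ 2 =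
      Real.sqrt (2 * ħ) * ‖Complex.Gamma (((entry a γ n k - entry a γ (n + 1) m : ℝ) : ℂ) /
        (2 * Complex.I * (ħ : ℂ)) + 1 / 4)‖ ^ 2 := by
  have h : (0 : ℝ) < 2 * ħ := by positivity
  rw [gammaArg, ← Complex.ofReal_sub, scaledGamma, norm_mul, mul_pow,
    Complex.norm_cpow_eq_rpow_re_of_pos h]
  congr 1
  have hre : (((entry a γ n k - entry a γ (n + 1) m : ℝ) : ℂ) / (2 * Complex.I * (ħ : ℂ)) +
      1 / 4).re = 1 / 4 := by
    rw [Complex.add_re, mul_assoc, mul_comm (2 : ℂ), ← div_div, Complex.div_ofNat_re]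
    have := scaledArray_re (ħ := ħ) a γ n k
    have h2 := scaledArray_re (ħ := ħ) a γ (n + 1) m
    rw [scaledArray] at this h2
    rw [Complex.ofReal_sub, sub_div, Complex.sub_re, this, h2]
    norm_num
  rw [hre, Real.sqrt_eq_rpow, ← Real.rpow_natCast, ← Real.rpow_mul h.le]
  norm_num

/-- The exponential factor of `vec`, spread over the pairs of entries in the same row. -/
theorem norm_vec_sq :
    ‖vec ħ (fun i => (a i : ℂ)) (fun t => (γ t : ℂ))‖ ^ 2 = ∏ n ∈ Finset.range N,
      (∏ p ∈ Finset.range n, ∏ s ∈ Finset.range p,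
        (Real.exp (Real.pi / ħ * (entry a γ n s + entry a γ n p)))⁻¹) *
      ∏ k ∈ Finset.range n, ∏ m ∈ Finset.range (n + 1),
        ‖scaledGamma ħ (gammaArg ħ ((entry a γ n k : ℝ) : ℂ) ((entry a γ (n + 1) m : ℝ) : ℂ))‖ ^ 2 := by
  rw [vec_eq, norm_mul, mul_pow, Finset.prod_mul_distrib]
  congr 1
  · have e : rhoSum (fun i => (a i : ℂ)) (fun t => (γ t : ℂ)) =
        ((∑ n ∈ Finset.range N, ((n : ℝ) - 1) * ∑ j ∈ Finset.range n, entry a γ n j : ℝ) : ℂ) := by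
      rw [sum_range_eq_sum_Ico_one _ (by simp), rhoSum]
      simp only [entry_ofReal]
      push_cast
      rfl
    simp only [← Real.exp_neg, ← Real.exp_sum, Finset.sum_neg_distrib, ← Finset.mul_sum,
      sum_sum_range_add]
    rw [e, Complex.norm_exp, ← Real.exp_nat_mul]
    congr 1
    rw [← Complex.ofReal_neg, ← Complex.ofReal_mul, Complex.ofReal_re]
    push_cast
    ring
  · rw [gammaProd]
    simp only [entry_ofReal, norm_prod, Finset.prod_pow]

include hħ in
/-- The exponentials in the density cancel those of `vec`, and the reciprocal Gamma functions of the
density are the denominator of the weight. -/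
theorem mu₀_mul_norm_vec_sq :
    mu₀ ħ a γ * ‖vec ħ (fun i => (a i : ℂ)) (fun t => (γ t : ℂ))‖ ^ 2 =
      (-(2 * Real.pi * ħ)) ^ N.choose 3 * (2 * ħ) ^ (N + 1).choose 3 * weight ħ a γ := by
  have hmu : mu₀ ħ a γ = ∏ n ∈ Finset.range N, ∏ p ∈ Finset.range n, ∏ s ∈ Finset.range p,
      (-(2 * Real.pi * ħ) * Real.exp (Real.pi / ħ * (entry a γ n s + entry a γ n p)) *
        (‖Complex.Gamma (((entry a γ n s - entry a γ n p : ℝ) : ℂ) / (Complex.I * (ħ : ℂ)))‖ ^ 2)⁻¹) := by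
    rw [mu₀]
    refine (Finset.prod_subset (fun n hn => ?_) fun n _ hn => ?_).trans
      (Finset.prod_congr rfl fun n _ => Finset.prod_congr rfl fun p _ =>
        Finset.prod_congr rfl fun s _ => mul_exp_sub_exp hħ _ _)
    · exact Finset.mem_range.2 (Finset.mem_Ico.1 hn).2
    · -- rows with fewer than two entries do not contribute
      rename_i hnN
      have hn2 : n < 2 := by
        by_contra h
        exact hn (Finset.mem_Ico.2 ⟨by omega, Finset.mem_range.1 hnN⟩)
      refine Finset.prod_eq_one fun p hp => Finset.prod_eq_one fun s hs => ?_
      rw [Finset.mem_range] at hp hs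
      omega
  rw [hmu, norm_vec_sq, weight, ← prod_range_eq_prod_Ico_one _ (by simp),
    ← prod_range_pow_choose_two, ← prod_range_pow_choose_two_succ, ← Finset.prod_mul_distrib,
    ← Finset.prod_mul_distrib, ← Finset.prod_mul_distrib]
  refine Finset.prod_congr rfl fun n _ => ?_
  have hsq : (2 * ħ) ^ (n + 1).choose 2 =
      ∏ k ∈ Finset.range n, ∏ m ∈ Finset.range (n + 1), Real.sqrt (2 * ħ) := by
    have h2 : 2 * (n + 1).choose 2 = (n + 1) * n := by
      rw [Nat.choose_two_right, Nat.add_sub_cancel]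
      exact Nat.two_mul_div_two_of_even (by rw [mul_comm]; exact Nat.even_mul_succ_self n)
    simp only [Finset.prod_const, Finset.card_range]
    rw [← pow_mul, ← h2, pow_mul, Real.sq_sqrt (by positivity)]
  rw [hsq, ← prod_range_prod_range_const, div_eq_mul_inv]
  simp only [norm_scaledGamma_sq hħ, Finset.prod_mul_distrib, Finset.prod_inv_distrib]
  have hne : ∏ p ∈ Finset.range n, ∏ s ∈ Finset.range p,
      Real.exp (Real.pi / ħ * (entry a γ n s + entry a γ n p)) ≠ 0 :=
    Finset.prod_ne_zero_iff.2 fun p _ => Finset.prod_ne_zero_iff.2 fun s _ => (Real.exp_pos _).ne'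
  generalize ∏ k ∈ Finset.range n, ∏ m ∈ Finset.range (n + 1),
    ‖Complex.Gamma (((entry a γ n k - entry a γ (n + 1) m : ℝ) : ℂ) /
      (2 * Complex.I * (ħ : ℂ)) + 1 / 4)‖ ^ 2 = G
  field_simp

include hħ in
theorem pairingIntegrand_eq (x : Fin N → ℝ) :
    pairingIntegrand ħ a (vec ħ fun i => (a i : ℂ))
        (torus ħ (fun i => (a i : ℂ)) x (vec ħ fun i => (a i : ℂ))) γ =
      (((-(2 * Real.pi * ħ)) ^ N.choose 3 * (2 * ħ) ^ (N + 1).choose 3 : ℝ) : ℂ) *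
        integrand ħ a x γ := by
  have h := congrArg (fun t : ℝ => (t : ℂ)) (mu₀_mul_norm_vec_sq hħ a γ)
  rw [Complex.ofReal_mul, Complex.ofReal_mul _ (weight ħ a γ), ← Complex.normSq_eq_norm_sq,
    Complex.normSq_eq_conj_mul_self] at h
  rw [pairingIntegrand, torus, integrand_eq, ← weight_eq_kernel, phase]
  simp only [cartan_eq]
  linear_combination
    Complex.exp (-∑ i : Fin N, (x i : ℂ) * rowSumDiff N (scaledArray ħ a γ) i) * h

end Pairing

end Sutherland

end

theorem theorem5p2 (N : ℕ) (ħ : ℝ) (hħ : 0 < ħ) (a : Fin N → ℝ) :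
    (∀ x : Fin N → ℝ, MeasureTheory.Integrable (Sutherland.integrand ħ a x)) ∧
    Sutherland.IsEigenfunction ħ a (Sutherland.waveFunction ħ a) ∧
    (∀ n : Fin N, 1 ≤ (n : ℕ) → ∀ γ ∈ Sutherland.genericSet ħ (fun i => (a i : ℂ)),
      Sutherland.raising ħ (fun i => (a i : ℂ)) n (Sutherland.vec ħ fun i => (a i : ℂ)) γ
        - Sutherland.lowering ħ (fun i => (a i : ℂ)) n (Sutherland.vec ħ fun i => (a i : ℂ)) γ
        = 0) ∧
    (∀ x : Fin N → ℝ,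
      MeasureTheory.Integrable (Sutherland.pairingIntegrand ħ a
        (Sutherland.vec ħ fun i => (a i : ℂ))
        (Sutherland.torus ħ (fun i => (a i : ℂ)) x (Sutherland.vec ħ fun i => (a i : ℂ)))) ∧
      Sutherland.pairing ħ a
          (Sutherland.vec ħ fun i => (a i : ℂ))
          (Sutherland.torus ħ (fun i => (a i : ℂ)) x (Sutherland.vec ħ fun i => (a i : ℂ)))
        = (((-(2 * Real.pi * ħ)) ^ N.choose 3 * (2 * ħ) ^ (N + 1).choose 3 : ℝ) : ℂ)
          * ∫ γ : Sutherland.Tri N → ℝ, Sutherland.integrand ħ a x γ) := by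
  have hint := Sutherland.integrable_integrand ħ a hħ
  refine ⟨hint, Sutherland.isEigenfunction_waveFunction hħ a,
    fun n hn γ hγ => Sutherland.raising_vec_sub_lowering_vec hħ _ n hn hγ, fun x => ⟨?_, ?_⟩⟩
  · exact ((hint x).const_mul _).congr (Filter.Eventually.of_forall fun γ =>
      (Sutherland.pairingIntegrand_eq hħ a γ x).symm)
  · rw [Sutherland.pairing, ← MeasureTheory.integral_const_mul]
    simp only [Sutherland.pairingIntegrand_eq hħ]
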